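/- For $q\in[0,1)$ let $A_q=\{z\in\mathbb C: q<|z|<1\}$, let $\mathbb U=\{|z|<1\}$ and $\mathbb H=\{\operatorname{Im} z>0\}$. For a simply connected domain $D$ and distinct boundary points $z_1,z_2$ near which $\partial D$ is smooth, a hull in $D$ from $z_1$ to $z_2$ is a compact, connected set $\gamma\subset\overline D$ with connected complement $\mathbb C\setminus\gamma$ and $\gamma\cap\partial D=\{z_1,z_2\}$. The conformal restriction measure $P^b_{D,z_1,z_2}$ of exponent $b\ge 5/8$ is the probability measure on such hulls (with the $\sigma$-algebra generated by the events $\{\gamma\cap A=\emptyset\}$, $A$ compact) such that $P^b_{D,z_1,z_2}(\gamma\subset D')=|\varphi'(z_1)\varphi'(z_2)|^b$ whenever $D'\subset D$ is a simply connected subdomain with $D\setminus D'$ bounded away from $z_1,z_2$ and $\varphi$ is a conformal map of $D'$ onto $D$ with $\varphi(z_1)=z_1$, $\varphi(z_2)=z_2$. Here $\gamma\subset D'$ means $\gamma\setminus\{z_1,z_2\}\subset D'$, and values and derivatives at boundary points are those of the boundary extension. Let $b\ge 5/8$, $x\in(0,\pi]$, $q\in[0,1)$, and let $L\in[0,1)$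 and $f$ be such that $f$ maps $A_q$ conformally onto $\mathbb U\setminus[-L,L]$, is extended continuously to the unit circle, and is normalized by $f(1)=1$. Put $z_1=e^{ix/2}$, $z_2=e^{-ix/2}$ and $u=i\,\dfrac{1+f(z_1)}{1-f(z_1)}$. Then $f$ has a (one-sided) complex derivative $f'(z_1)$ at $z_1$, and $$P^b_{\mathbb U,e^{ix},1}(\gamma\subset A_q)=P^b_{\mathbb H,u,-u}\left(\gamma\cap i\left[\tfrac{1-L}{1+L},\tfrac{1+L}{1-L}\right]=\emptyset\right)\cdot\left|\frac{f'(z_1)\,(z_1-z_2)}{f(z_1)-f(z_2)}\right|^{2b}.$$ -/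

import Mathlib

open MeasureTheory Set

/-- The unit disk `𝕌 = {z : |z| < 1}`. -/
def unitDisk : Set ℂ := {z | ‖z‖ < 1}

/-- The upper half-plane `ℍ = {z : Im z > 0}`. -/
def upperHalf : Set ℂ := {z | 0 < z.im}

/-- The annulus `A_q = {z : q < |z| < 1}` (the punctured disk for `q = 0`). -/
def annulus (q : ℝ) : Set ℂ := {z | q < ‖z‖ ∧ ‖z‖ < 1}

/-- The segment `[-L, L]` of the real axis, as a subset of `ℂ`. -/
def realSlit (L : ℝ) : Set ℂ := (fun t : ℝ => (t : ℂ)) '' Icc (-L) L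

/-- The segment `i [s, t]` of the imaginary axis, as a subset of `ℂ`. -/
def imagSegment (s t : ℝ) : Set ℂ := (fun y : ℝ => Complex.I * (y : ℂ)) '' Icc s t

/-- `f` maps `D'` conformally (holomorphically and bijectively) onto `D`. -/
def MapsConformallyOnto (f : ℂ → ℂ) (D' D : Set ℂ) : Prop :=
  DifferentiableOn ℂ f D' ∧ BijOn f D' D

/-- `γ` is a hull in `D` from `z₁` to `z₂`: a closed, simply connected subset of the closure of
`D` which meets the boundary of `D` exactly in `z₁` and `z₂`. In an unbounded simply connected
plane domain the point at infinity is a boundary point too, so that `γ` is compact in all cases.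
A compact connected plane set is simply connected (has no holes) iff its complement is connected. -/
def IsHull (D : Set ℂ) (z₁ z₂ : ℂ) (γ : Set ℂ) : Prop :=
  IsCompact γ ∧ IsConnected γ ∧ IsConnected γᶜ ∧ γ ⊆ closure D ∧ γ ∩ frontier D = {z₁, z₂}

/-- The space of all hulls in `D` from `z₁` to `z₂`. -/
def Hull (D : Set ℂ) (z₁ z₂ : ℂ) : Type := {γ : Set ℂ // IsHull D z₁ z₂ γ}

/-- The event that the random hull does not meet `A`. -/
def avoids {D : Set ℂ} {z₁ z₂ : ℂ} (A : Set ℂ) : Set (Hull D z₁ z₂) := {γ | γ.1 ∩ A = ∅}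

/-- The event `γ ⊂ D'`, for a subdomain `D'` of `D`. The hull always contains its endpoints,
which lie on the boundary, so these are disregarded. -/
def staysIn {D : Set ℂ} {z₁ z₂ : ℂ} (D' : Set ℂ) : Set (Hull D z₁ z₂) :=
  {γ | γ.1 \ {z₁, z₂} ⊆ D'}

/-- The usual σ-algebra for random closed sets, generated by the events that the hull avoids a
given compact set. -/
instance Hull.measurableSpace (D : Set ℂ) (z₁ z₂ : ℂ) : MeasurableSpace (Hull D z₁ z₂) :=
  MeasurableSpace.generateFrom {S | ∃ A : Set ℂ, IsCompact A ∧ S = avoids A}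

/-- `P` is the conformal restriction measure `P^b_{D, z₁, z₂}` of exponent `b` on hulls in `D`
from `z₁` to `z₂`, for a simply connected domain `D` with smooth boundary near the two distinct
boundary points `z₁`, `z₂`: the probability measure with
`P (γ ⊂ D') = |φ'(z₁) φ'(z₂)| ^ b` for all simply connected subdomains `D'` of `D` with `D \ D'`
bounded away from `z₁` and `z₂`, where `φ` maps `D'` conformally onto `D` with `φ(z₁) = z₁` and
`φ(z₂) = z₂` (boundary values). The numbers `d₁`, `d₂` are the derivatives `φ'(z₁)`, `φ'(z₂)`.
An open set `D'` with a conformal map onto `D` is automatically connected and simply connected. -/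
structure IsRestrictionMeasure (b : ℝ) (D : Set ℂ) (z₁ z₂ : ℂ)
    (P : Measure (Hull D z₁ z₂)) : Prop where
  isProbabilityMeasure : IsProbabilityMeasure P
  restriction : ∀ (D' : Set ℂ) (φ : ℂ → ℂ) (d₁ d₂ : ℂ),
    IsOpen D' → D' ⊆ D → z₁ ∉ closure (D \ D') → z₂ ∉ closure (D \ D') →
    MapsConformallyOnto φ D' D → φ z₁ = z₁ → φ z₂ = z₂ →
    HasDerivWithinAt φ d₁ D' z₁ → HasDerivWithinAt φ d₂ D' z₂ →
    P.real (staysIn D') = ‖d₁ * d₂‖ ^ b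

/-! The restriction formula only speaks of simply connected subdomains, and `A_q` is not one. But a
hull in `A_q` does not separate the inner disk `|z| ≤ q` from the exterior of the unit disk. A path
in its complement joins the two, and finitely many closed disks from a fixed countable family cover
this path without touching the hull. Removing such disks from `A_q` leaves an open set `W` with
connected complement that still contains the hull (`exists_isFreeAt_diskUnionCompl`). So `{γ ⊂ A_q}`
is a countable union of events `{γ ⊂ W}`. In the half-plane the same sets `W`, pulled back by `k =
f⁻¹ ∘ cayley⁻¹`, exhaust the event that the hull misses the imaginary segment
(`IsSlitMap.staysFree_eq`).

Fix one `W`, and let `ψ` map the component of `W` touching `z₁` and `z₂` onto the disk. In a domain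
`D` with marked points `e₁`, `e₂` and a conformal map `k` of a subdomain onto `A_q`, the restriction
formula splits into two factors: `(|ψ'(z₁)ψ'(z₂)| / |ψ(z₁)-ψ(z₂)|²)^b`, which depends only on `W`,
and `(|e₁-e₂|² |k'(e₁)k'(e₂)|)^b`, which depends only on the chart
(`IsEndChart.restriction_conformal`). The reason is the Möbius identity `|M(a)-M(b)|² = |M'(a)M'(b)|
|a-b|²`. If `z₁` and `z₂` touch different components of `W`, both probabilities vanish. So the
probabilities in the two domains are proportional, with a constant independent of `W`. Finite
intersections of sets `W` have the same properties, hence inclusion-exclusion and a monotone limit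
carry the proportionality over to the union (`measureReal_iUnion_eq_mul`).

The chart factor is `|z₁-z₂|²` for a rotation of the disk and `|f(z₁)-f(z₂)|² / |f'(z₁)|²` for the
slit half-plane, before taking the power `b`. The second value uses `f(conj z) = conj f(z)`, which
follows from uniqueness of the slit map and also gives that `-u` is the Cayley image of `f(z₂)`.

The analytic input is Schwarz reflection at circular arcs, for boundary values and derivatives, and
the Riemann mapping theorem for components of bounded open sets with connected complement, where
Runge approximation supplies the primitives. -/

open Filter Topology Metric ComplexConjugate Interval

/-! ### Maximum principle and inverses of injective holomorphic maps -/

/-- Maximum modulus principle with boundary values understood as upper limits. -/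
theorem norm_le_one_of_eventually_frontier {Ω : Set ℂ} (ho : IsOpen Ω) (hb : Bornology.IsBounded Ω)
    (hc : IsPreconnected Ω) {F : ℂ → ℂ} (hF : DifferentiableOn ℂ F Ω)
    (hlim : ∀ c ∈ frontier Ω, ∀ ε > 0, ∀ᶠ z in 𝓝[Ω] c, ‖F z‖ < 1 + ε) {z : ℂ} (hz : z ∈ Ω) :
    ‖F z‖ ≤ 1 := by
  refine le_of_forall_pos_le_add fun ε hε => ?_
  by_contra! hlt
  -- Near the frontier `‖F‖ < 1 + ε`, so this superlevel set is compact in the plane. A maximum on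
  -- it is a maximum on `Ω`, which forces `Ω = T` to be clopen and bounded.
  set T : Set ℂ := {w | w ∈ Ω ∧ 1 + ε ≤ ‖F w‖} with hT
  have hTclosed : IsClosed T := by
    refine isClosed_of_closure_subset fun c hcT => ?_
    have hcΩ : c ∈ closure Ω := closure_mono (fun w hw => hw.1) hcT
    by_cases hcin : c ∈ Ω
    · refine ⟨hcin, ?_⟩
      by_contra! h
      have hcont : ContinuousAt (fun w => ‖F w‖) c :=
        (hF.continuousOn.continuousAt (ho.mem_nhds hcin)).norm
      obtain ⟨w, hw, hw2⟩ := mem_closure_iff_nhds.1 hcT _ (hcont.eventually_lt_const h)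
      exact absurd hw2.2 (not_le.2 hw)
    · have hfr : c ∈ frontier Ω := by
        rw [ho.frontier_eq]; exact ⟨hcΩ, hcin⟩
      have := hlim c hfr ε hε
      rw [eventually_nhdsWithin_iff] at this
      obtain ⟨w, hw, hw2⟩ := mem_closure_iff_nhds.1 hcT _ this
      exact absurd hw2.2 (not_le.2 (hw hw2.1))
  have hTcomp : IsCompact T := isCompact_of_isClosed_isBounded hTclosed (hb.subset fun w hw => hw.1)
  have hzT : z ∈ T := ⟨hz, hlt.le⟩
  obtain ⟨p, hpT, hp⟩ := hTcomp.exists_isMaxOn ⟨z, hzT⟩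
    (hF.continuousOn.norm.mono fun w hw => hw.1)
  have hmax : IsMaxOn (norm ∘ F) Ω p := by
    intro w hw
    by_cases h : 1 + ε ≤ ‖F w‖
    · exact hp ⟨hw, h⟩
    · exact (not_le.1 h).le.trans hpT.2
  have hconst := Complex.norm_eqOn_of_isPreconnected_of_isMaxOn hc ho hF hpT.1 hmax
  have hΩT : Ω = T := by
    refine Subset.antisymm (fun w hw => ⟨hw, ?_⟩) (fun w hw => hw.1)
    have := hconst hw
    simp only [Function.comp_apply, Function.const_apply] at this
    rw [this]; exact hpT.2
  have hclopen : IsClopen Ω := ⟨hΩT ▸ hTclosed, ho⟩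
  rcases isClopen_iff.1 hclopen with h | h
  · rw [h] at hz; exact hz
  · rw [h] at hb
    exact NormedSpace.unbounded_univ ℂ ℂ hb

theorem isOpen_image_of_injOn {Ω : Set ℂ} (ho : IsOpen Ω) {F : ℂ → ℂ}
    (hF : DifferentiableOn ℂ F Ω) (hi : InjOn F Ω) : IsOpen (F '' Ω) := by
  rw [isOpen_iff_mem_nhds]
  rintro _ ⟨a, ha, rfl⟩
  have han : AnalyticAt ℂ F a := hF.analyticAt (ho.mem_nhds ha)
  rcases han.eventually_constant_or_nhds_le_map_nhds with h | h
  · exfalso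
    have h2 : ∀ᶠ z in 𝓝[≠] a, F z = F a ∧ z ∈ Ω :=
      (h.and (ho.mem_nhds ha)).filter_mono nhdsWithin_le_nhds
    obtain ⟨z, hz, hza⟩ := (h2.and self_mem_nhdsWithin).exists
    exact hza (hi hz.2 ha hz.1)
  · exact h (image_mem_map (ho.mem_nhds ha))

theorem continuousOn_invFunOn_of_injOn {Ω : Set ℂ} (ho : IsOpen Ω) {F : ℂ → ℂ}
    (hF : DifferentiableOn ℂ F Ω) (hi : InjOn F Ω) :
    ContinuousOn (Function.invFunOn F Ω) (F '' Ω) := by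
  rintro _ ⟨a, ha, rfl⟩
  refine ContinuousAt.continuousWithinAt ?_
  have hl := hi.leftInvOn_invFunOn
  rw [ContinuousAt, hl ha]
  intro N hN
  have : F '' (interior N ∩ Ω) ∈ 𝓝 (F a) :=
    (isOpen_image_of_injOn (isOpen_interior.inter ho) (hF.mono inter_subset_right)
      (hi.mono inter_subset_right)).mem_nhds
      (mem_image_of_mem _ ⟨mem_interior_iff_mem_nhds.2 hN, ha⟩)
  rw [mem_map]
  filter_upwards [this]
  rintro _ ⟨z, hz, rfl⟩
  change Function.invFunOn F Ω (F z) ∈ N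
  rw [hl hz.2]
  exact interior_subset hz.1

/-- The zeros of `deriv F` are isolated because `F` is injective. Away from their images the inverse
function theorem applies; at their images the inverse is continuous, so the singularity is
removable. This avoids proving first that the derivative has no zeros. -/
theorem differentiableOn_invFunOn_of_injOn {Ω : Set ℂ} (ho : IsOpen Ω) {F : ℂ → ℂ}
    (hF : DifferentiableOn ℂ F Ω) (hi : InjOn F Ω) :
    DifferentiableOn ℂ (Function.invFunOn F Ω) (F '' Ω) := by
  have hl := hi.leftInvOn_invFunOn
  have hopen := isOpen_image_of_injOn ho hF hi
  have hcont := continuousOn_invFunOn_of_injOn ho hF hi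
  have key : ∀ z ∈ Ω, deriv F z ≠ 0 → DifferentiableAt ℂ (Function.invFunOn F Ω) (F z) := by
    intro z hz hne
    have h1 : HasDerivAt F (deriv F z) (Function.invFunOn F Ω (F z)) := by
      rw [hl hz]; exact (hF.differentiableAt (ho.mem_nhds hz)).hasDerivAt
    refine (HasDerivAt.of_local_left_inverse
      (hcont.continuousAt (hopen.mem_nhds (mem_image_of_mem _ hz))) h1 hne ?_).differentiableAt
    filter_upwards [hopen.mem_nhds (mem_image_of_mem F hz)]
    rintro _ ⟨w, hw, rfl⟩
    rw [hl hw]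
  rintro _ ⟨a, ha, rfl⟩
  refine (AnalyticAt.differentiableAt ?_).differentiableWithinAt
  refine Complex.analyticAt_of_differentiable_on_punctured_nhds_of_continuousAt ?_
    (hcont.continuousAt (hopen.mem_nhds (mem_image_of_mem _ ha)))
  have hda : AnalyticAt ℂ (deriv F) a := (hF.analyticAt (ho.mem_nhds ha)).deriv
  have hne : ∀ᶠ z in 𝓝[≠] a, deriv F z ≠ 0 := by
    rcases hda.eventually_eq_zero_or_eventually_ne_zero with h | h
    · exfalso
      obtain ⟨r, hr, hball⟩ := Metric.eventually_nhds_iff_ball.1 (h.and (ho.mem_nhds ha))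
      have hcst : ∀ z ∈ ball a r, F z = F a := fun z hz =>
        (convex_ball a r).is_const_of_fderivWithin_eq_zero (𝕜 := ℂ)
          (hF.mono fun w hw => (hball w hw).2) (fun w hw => by
            rw [fderivWithin_of_isOpen isOpen_ball hw]
            ext; simp [(hball w hw).1]) hz (mem_ball_self hr)
      have h2 : ∀ᶠ z in 𝓝[≠] a, z ∈ ball a r :=
        nhdsWithin_le_nhds (ball_mem_nhds a hr)
      obtain ⟨z, hz, hza⟩ := (h2.and self_mem_nhdsWithin).exists
      exact hza (hi (hball z hz).2 ha (hcst z hz))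
    · exact h
  rw [eventually_nhdsWithin_iff] at hne ⊢
  have hc := hcont.continuousAt (hopen.mem_nhds (mem_image_of_mem F ha))
  rw [ContinuousAt, hl ha] at hc
  filter_upwards [hc.eventually hne, hopen.mem_nhds (mem_image_of_mem F ha)]
  rintro _ h ⟨w, hw, rfl⟩ hwa
  rw [hl hw] at h
  exact key w hw (h fun e => hwa (by rw [mem_singleton_iff] at e ⊢; rw [e]))

theorem MapsConformallyOnto.invFunOn {F : ℂ → ℂ} {D' D : Set ℂ} (h : MapsConformallyOnto F D' D)
    (ho : IsOpen D') : MapsConformallyOnto (Function.invFunOn F D') D D' := by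
  refine ⟨?_, ?_⟩
  · rw [← h.2.image_eq]
    exact differentiableOn_invFunOn_of_injOn ho h.1 h.2.injOn
  · exact h.2.invOn_invFunOn.symm.bijOn h.2.surjOn.mapsTo_invFunOn h.2.mapsTo

theorem MapsConformallyOnto.comp {F G : ℂ → ℂ} {A B C : Set ℂ} (hG : MapsConformallyOnto G B C)
    (hF : MapsConformallyOnto F A B) : MapsConformallyOnto (G ∘ F) A C :=
  ⟨hG.1.comp hF.1 hF.2.mapsTo, hG.2.comp hF.2⟩

/-! ### Schwarz reflection -/

/-- The open rectangle `(-r, r) × (0, r)`. -/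
def upperBox (r : ℝ) : Set ℂ := {z | |z.re| < r ∧ 0 < z.im ∧ z.im < r}

theorem isOpen_upperBox (r : ℝ) : IsOpen (upperBox r) := by
  have h1 : IsOpen {z : ℂ | |z.re| < r} := isOpen_lt (by fun_prop) (by fun_prop)
  have h2 : IsOpen {z : ℂ | 0 < z.im} := isOpen_lt (by fun_prop) (by fun_prop)
  have h3 : IsOpen {z : ℂ | z.im < r} := isOpen_lt (by fun_prop) (by fun_prop)
  exact h1.inter (h2.inter h3)

theorem convex_box (c a b d : ℝ) : Convex ℝ {z : ℂ | |z.re - c| < a ∧ b < z.im ∧ z.im < d} := by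
  have h : {z : ℂ | |z.re - c| < a ∧ b < z.im ∧ z.im < d} =
      (Complex.reLm ⁻¹' (Ioo (c - a) (c + a))) ∩ (Complex.imLm ⁻¹' (Ioo b d)) := by
    ext z
    simp only [mem_ofPred_eq, mem_inter_iff, mem_preimage, Complex.reLm_coe, Complex.imLm_coe,
      mem_Ioo, abs_lt]
    constructor
    · rintro ⟨⟨h1, h2⟩, h3, h4⟩; exact ⟨⟨by linarith, by linarith⟩, h3, h4⟩
    · rintro ⟨⟨h1, h2⟩, h3, h4⟩; exact ⟨⟨by linarith, by linarith⟩, h3, h4⟩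
  rw [h]
  exact ((convex_Ioo _ _).linear_preimage _).inter ((convex_Ioo _ _).linear_preimage _)

theorem convex_upperBox (r : ℝ) : Convex ℝ (upperBox r) := by
  have := convex_box 0 r 0 r
  simpa [upperBox] using this

/-- Extended by zero to the real axis, the imaginary part is continuous on a compact rectangle. -/
theorem im_bounded_of_tendsto {r : ℝ} {G : ℂ → ℂ} (hr : 0 < r)
    (hG : DifferentiableOn ℂ G (upperBox r))
    (hlim : ∀ t : ℝ, |t| < r → Tendsto (fun z => (G z).im) (𝓝[upperBox r] (t : ℂ)) (𝓝 0)) :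
    ∃ M > 0, ∀ z : ℂ, |z.re| ≤ r / 2 → 0 < z.im → z.im ≤ r / 2 → (G z).im ≤ M := by
  set V : ℂ → ℝ := fun z => if z.im ≤ 0 then 0 else (G z).im with hV
  set S : Set ℂ := {z | |z.re| ≤ r / 2 ∧ 0 ≤ z.im ∧ z.im ≤ r / 2} with hS
  have hScl : IsClosed S := by
    have h1 : IsClosed {z : ℂ | |z.re| ≤ r / 2} := isClosed_le (by fun_prop) (by fun_prop)
    have h2 : IsClosed {z : ℂ | 0 ≤ z.im} := isClosed_le (by fun_prop) (by fun_prop)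
    have h3 : IsClosed {z : ℂ | z.im ≤ r / 2} := isClosed_le (by fun_prop) (by fun_prop)
    exact h1.inter (h2.inter h3)
  have hSb : Bornology.IsBounded S := by
    refine (isBounded_closedBall (x := (0 : ℂ)) (r := r)).subset fun z hz => ?_
    rw [mem_closedBall_zero_iff]
    refine (Complex.norm_le_abs_re_add_abs_im z).trans ?_
    rw [abs_of_nonneg hz.2.1]
    linarith [hz.1, hz.2.2]
  have hSc : IsCompact S := isCompact_of_isClosed_isBounded hScl hSb
  have hVc : ContinuousOn V S := by
    intro z hz
    rcases hz.2.1.eq_or_lt with h0 | h0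
    · have hzt : z = ((z.re : ℝ) : ℂ) := by apply Complex.ext <;> simp [← h0]
      have ht : |z.re| < r := by linarith [hz.1]
      have hl := hlim z.re ht
      rw [← hzt] at hl
      have hVz : V z = 0 := by simp [hV, ← h0]
      rw [ContinuousWithinAt, hVz, Metric.tendsto_nhds]
      intro ε hε
      have h1 := (Metric.tendsto_nhds.1 hl) ε hε
      rw [eventually_nhdsWithin_iff] at h1 ⊢
      filter_upwards [h1] with w hw hwS
      by_cases hw0 : w.im ≤ 0
      · simp [hV, hw0, hε]
      · simp only [hV, hw0, if_false]
        exact hw ⟨by linarith [hwS.1], not_le.1 hw0, by linarith [hwS.2.2]⟩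
    · have hzB : z ∈ upperBox r := ⟨by linarith [hz.1], h0, by linarith [hz.2.2]⟩
      have hc : ContinuousAt (fun w => (G w).im) z :=
        Complex.continuous_im.continuousAt.comp
          (hG.continuousOn.continuousAt ((isOpen_upperBox r).mem_nhds hzB))
      refine (hc.congr ?_).continuousWithinAt
      have : ∀ᶠ w : ℂ in 𝓝 z, 0 < w.im := Complex.continuous_im.continuousAt.eventually_const_lt h0
      filter_upwards [this] with w hw
      simp [hV, not_le.2 hw]
  obtain ⟨M, hM⟩ := (hSc.image_of_continuousOn hVc).bddAbove
  refine ⟨max M 1, by positivity, fun z h1 h2 h3 => le_trans ?_ (le_max_left _ _)⟩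
  have := hM (mem_image_of_mem V (show z ∈ S from ⟨h1, h2.le, h3⟩))
  simpa [hV, not_le.2 h2] using this

/-- A barrier argument: above each real point `x₀`, the imaginary part is compared with the harmonic
function `A Im w + B Re (w - x₀)²` on a small rectangle. This upgrades convergence to zero at the
axis to a linear bound, the first step towards a Lipschitz bound. -/
theorem im_le_mul_im {r : ℝ} {G : ℂ → ℂ} (hr : 0 < r)
    (hG : DifferentiableOn ℂ G (upperBox r))
    (hlim : ∀ t : ℝ, |t| < r → Tendsto (fun z => (G z).im) (𝓝[upperBox r] (t : ℂ)) (𝓝 0)) :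
    ∃ A > 0, ∀ z : ℂ, |z.re| ≤ r / 4 → 0 < z.im → z.im < r / 4 → (G z).im ≤ A * z.im := by
  obtain ⟨M, hM0, hM⟩ := im_bounded_of_tendsto hr hG hlim
  set a : ℝ := r / 4 with ha
  have ha0 : 0 < a := by positivity
  -- The barrier is nonnegative on the bottom side. On the vertical sides it is at least `B a² = M`,
  -- because `B y² ≤ B a y = A y / 2`; on the top it is at least `A a - B a² = M`.
  set B : ℝ := M / a ^ 2 with hB
  set A : ℝ := 2 * M / a with hA
  have hB0 : 0 < B := by positivity
  have hA0 : 0 < A := by positivity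
  have hBa : B * a ^ 2 = M := by rw [hB]; field_simp
  have hAa : A * a = 2 * M := by rw [hA]; field_simp
  refine ⟨A, hA0, fun z hz1 hz2 hz3 => ?_⟩
  set x₀ : ℝ := z.re with hx₀
  set Ω : Set ℂ := {w | |w.re - x₀| < a ∧ 0 < w.im ∧ w.im < a} with hΩ
  have hΩo : IsOpen Ω := by
    have h1 : IsOpen {w : ℂ | |w.re - x₀| < a} := isOpen_lt (by fun_prop) (by fun_prop)
    have h2 : IsOpen {z : ℂ | 0 < z.im} := isOpen_lt (by fun_prop) (by fun_prop)
    have h3 : IsOpen {z : ℂ | z.im < a} := isOpen_lt (by fun_prop) (by fun_prop)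
    exact h1.inter (h2.inter h3)
  have hΩr : ∀ w : ℂ, |w.re - x₀| ≤ a → |w.re| ≤ r / 2 := fun w hw => by
    have : |w.re| ≤ |w.re - x₀| + |x₀| := by
      simpa using abs_add_le (w.re - x₀) x₀
    linarith
  have hΩsub : Ω ⊆ upperBox r := fun w hw =>
    ⟨by linarith [hΩr w hw.1.le], hw.2.1, by linarith [hw.2.2]⟩
  have hcl : closure Ω ⊆ {w | |w.re - x₀| ≤ a ∧ 0 ≤ w.im ∧ w.im ≤ a} := by
    refine closure_minimal (fun w hw => ⟨hw.1.le, hw.2.1.le, hw.2.2.le⟩) ?_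
    have h1 : IsClosed {w : ℂ | |w.re - x₀| ≤ a} := isClosed_le (by fun_prop) (by fun_prop)
    have h2 : IsClosed {z : ℂ | 0 ≤ z.im} := isClosed_le (by fun_prop) (by fun_prop)
    have h3 : IsClosed {z : ℂ | z.im ≤ a} := isClosed_le (by fun_prop) (by fun_prop)
    exact h1.inter (h2.inter h3)
  have hΩb : Bornology.IsBounded Ω := by
    refine (isBounded_closedBall (x := (0 : ℂ)) (r := r)).subset fun w hw => ?_
    rw [mem_closedBall_zero_iff]
    refine (Complex.norm_le_abs_re_add_abs_im w).trans ?_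
    rw [abs_of_nonneg hw.2.1.le]
    linarith [hΩr w hw.1.le, hw.2.2]
  set F : ℂ → ℂ := fun w => Complex.exp (-Complex.I * (G w - (A * w + Complex.I * B * (w - x₀) ^ 2)))
    with hFdef
  have hFn : ∀ w, ‖F w‖ = Real.exp ((G w).im - (A * w.im + B * ((w.re - x₀) ^ 2 - w.im ^ 2))) := by
    intro w
    rw [hFdef, Complex.norm_exp]
    congr 1
    simp [pow_two, Complex.mul_re, Complex.mul_im]
  have hFd : DifferentiableOn ℂ F Ω := by
    have := hG.mono hΩsub
    simp only [hFdef]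
    fun_prop
  have hlimF : ∀ c ∈ frontier Ω, ∀ ε > 0, ∀ᶠ w in 𝓝[Ω] c, ‖F w‖ < 1 + ε := by
    intro c hc ε hε
    rw [hΩo.frontier_eq] at hc
    obtain ⟨hc1, hc2, hc3⟩ := hcl hc.1
    suffices h : ∃ v : ℝ, Tendsto (fun w => (G w).im) (𝓝[Ω] c) (𝓝 v) ∧
        v ≤ A * c.im + B * ((c.re - x₀) ^ 2 - c.im ^ 2) by
      obtain ⟨v, hv, hvle⟩ := h
      have h2 : Tendsto (fun w : ℂ => A * w.im + B * ((w.re - x₀) ^ 2 - w.im ^ 2)) (𝓝[Ω] c)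
          (𝓝 (A * c.im + B * ((c.re - x₀) ^ 2 - c.im ^ 2))) :=
        (Continuous.tendsto (by fun_prop) c).mono_left nhdsWithin_le_nhds
      have h3 := (Real.continuous_exp.tendsto _).comp (hv.sub h2)
      have h4 : Real.exp (v - (A * c.im + B * ((c.re - x₀) ^ 2 - c.im ^ 2))) < 1 + ε := by
        have : Real.exp (v - (A * c.im + B * ((c.re - x₀) ^ 2 - c.im ^ 2))) ≤ 1 :=
          Real.exp_le_one_iff.2 (by linarith)
        linarith
      filter_upwards [h3.eventually_lt_const h4] with w hw
      rw [hFn]; exact hw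
    rcases hc2.eq_or_lt with h0 | h0
    · have hct : c = ((c.re : ℝ) : ℂ) := by apply Complex.ext <;> simp [← h0]
      refine ⟨0, ?_, ?_⟩
      · have := hlim c.re (by linarith [hΩr c hc1])
        rw [← hct] at this
        exact this.mono_left (nhdsWithin_mono _ hΩsub)
      · rw [← h0]; nlinarith [mul_nonneg hB0.le (sq_nonneg (c.re - x₀))]
    · have hcB : c ∈ upperBox r := ⟨by linarith [hΩr c hc1], h0, by linarith⟩
      have hcG : ContinuousAt (fun w => (G w).im) c :=
        Complex.continuous_im.continuousAt.comp
          (hG.continuousOn.continuousAt ((isOpen_upperBox r).mem_nhds hcB))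
      refine ⟨(G c).im, hcG.tendsto.mono_left nhdsWithin_le_nhds, ?_⟩
      have hMc := hM c (hΩr c hc1) h0 (by linarith)
      refine hMc.trans ?_
      have hcase : |c.re - x₀| = a ∨ c.im = a := by
        by_contra! h
        exact hc.2 ⟨lt_of_le_of_ne hc1 h.1, h0, lt_of_le_of_ne hc3 h.2⟩
      have hBy : B * c.im ^ 2 ≤ B * a * c.im := by
        nlinarith [mul_nonneg hB0.le (mul_nonneg h0.le (sub_nonneg.2 hc3))]
      have hAB : B * a * c.im * 2 = A * c.im := by
        have : B * a * 2 = A := by rw [hA, hB]; field_simp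
        rw [← this]; ring
      rcases hcase with h | h
      · have : (c.re - x₀) ^ 2 = a ^ 2 := by rw [← sq_abs, h]
        rw [this]
        nlinarith [mul_pos hA0 h0]
      · rw [h] at hBy ⊢
        nlinarith [mul_nonneg hB0.le (sq_nonneg (c.re - x₀))]
  have hzΩ : z ∈ Ω := ⟨by simpa [hx₀] using ha0, hz2, hz3⟩
  have hres := norm_le_one_of_eventually_frontier hΩo hΩb (convex_box x₀ a 0 a).isPreconnected hFd
    hlimF hzΩ
  rw [hFn, Real.exp_le_one_iff] at hres
  have h5 : 0 ≤ B * z.im ^ 2 := by positivity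
  simp only [hx₀, sub_self] at hres
  nlinarith

/-- On the disk of radius `R = Im z / 2` about `z`, the real part of `-i (G - G z)` is at most `3/2
A Im z`. Borel–Carathéodory bounds the modulus by `3 A Im z` on radius `R / 2`, and Cauchy's
estimate gives `12 A`. -/
theorem norm_deriv_le_of_im_le {r A : ℝ} {G : ℂ → ℂ} (hA : 0 < A)
    (hG : DifferentiableOn ℂ G (upperBox r)) (hpos : ∀ z ∈ upperBox r, 0 < (G z).im)
    (hAim : ∀ z ∈ upperBox r, (G z).im ≤ A * z.im) :
    ∀ z ∈ upperBox (r / 2), ‖deriv G z‖ ≤ 12 * A := by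
  rintro z ⟨hz1, hz2, hz3⟩
  set R : ℝ := z.im / 2 with hR
  have hR0 : 0 < R := by positivity
  have hsub : ∀ ζ ∈ ball (0 : ℂ) R, z + ζ ∈ upperBox r := by
    intro ζ hζ
    rw [mem_ball_zero_iff] at hζ
    have h1 := (Complex.abs_re_le_norm ζ).trans_lt hζ
    have h2 := (Complex.abs_im_le_norm ζ).trans_lt hζ
    have h3 := abs_add_le z.re ζ.re
    rw [abs_lt] at h2
    refine ⟨?_, ?_, ?_⟩
    · rw [Complex.add_re]; linarith
    · rw [Complex.add_im]; linarith
    · rw [Complex.add_im]; linarith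
  set H : ℂ → ℂ := fun ζ => -Complex.I * (G (z + ζ) - G z) with hH
  have hHd : DifferentiableOn ℂ H (ball 0 R) := by
    have : DifferentiableOn ℂ (fun ζ => G (z + ζ)) (ball 0 R) :=
      hG.comp (by fun_prop) hsub
    exact (this.sub_const _).const_mul _
  have hre : MapsTo H (ball 0 R) {w | w.re ≤ 3 / 2 * A * z.im} := by
    intro ζ hζ
    have h1 := hAim _ (hsub ζ hζ)
    have h2 := hpos z (by simpa using hsub 0 (mem_ball_self hR0))
    have h3 : ζ.im ≤ R := by
      rw [mem_ball_zero_iff] at hζ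
      exact (le_abs_self _).trans ((Complex.abs_im_le_norm ζ).trans hζ.le)
    have h4 : A * ζ.im ≤ A * R := by gcongr
    simp only [hH, mem_ofPred_eq]
    simp only [Complex.add_im, Complex.mul_re, Complex.neg_re, Complex.I_re, neg_zero, zero_mul,
      Complex.neg_im, Complex.I_im, Complex.sub_im, zero_sub] at h1 ⊢
    rw [hR] at h4
    nlinarith
  have hbound : ∀ ζ ∈ sphere (0 : ℂ) (R / 2), ‖H ζ‖ ≤ 3 * A * z.im := by
    intro ζ hζ
    rw [mem_sphere_zero_iff_norm] at hζ
    have hb := Complex.borelCaratheodory_zero (M := 3 / 2 * A * z.im) (by positivity) hHd hre hR0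
      (z := ζ) (by rw [mem_ball_zero_iff, hζ]; linarith) (by simp [hH])
    rw [hζ] at hb
    refine hb.trans (le_of_eq ?_)
    have : R - R / 2 = R / 2 := by ring
    rw [this]; field_simp
  have hd := Complex.norm_deriv_le_of_forall_mem_sphere_norm_le (f := H) (c := 0) (R := R / 2)
    (by positivity) ?_ hbound
  · have hder : deriv H 0 = -Complex.I * deriv G z := by
      have h1 : HasDerivAt G (deriv G z) (z + 0) := by
        rw [add_zero]
        refine (hG.differentiableAt ((isOpen_upperBox r).mem_nhds ?_)).hasDerivAt
        simpa using hsub 0 (mem_ball_self hR0)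
      have h2 : HasDerivAt (fun ζ => G (z + ζ)) (deriv G z) 0 := HasDerivAt.comp_const_add z 0 h1
      exact ((h2.sub_const (G z)).const_mul (-Complex.I)).deriv
    rw [hder, norm_mul] at hd
    simp only [norm_neg, Complex.norm_I, one_mul] at hd
    refine hd.trans (le_of_eq ?_)
    rw [hR]; field_simp; norm_num
  · refine DifferentiableOn.diffContOnCl (hHd.mono ?_)
    rw [closure_ball _ (by positivity)]
    exact closedBall_subset_ball (by linarith)

/-- Painlevé: a continuous function on the plane which is holomorphic off the real axis in a ball is
holomorphic in this ball. -/
theorem differentiableOn_ball_of_off_real {Φ : ℂ → ℂ} {δ : ℝ} (hc : Continuous Φ)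
    (hd : ∀ z ∈ ball (0 : ℂ) δ, z.im ≠ 0 → DifferentiableAt ℂ Φ z) :
    DifferentiableOn ℂ Φ (ball 0 δ) := by
  rw [← Complex.isConservativeOn_and_continuousOn_iff_isDifferentiableOn isOpen_ball]
  refine ⟨?_, hc.continuousOn⟩
  -- A rectangle in one closed half-plane has its interior off the axis, so Cauchy's theorem holds
  -- for it. A rectangle crossing the axis is cut along the axis.
  have half : ∀ z w : ℂ, Complex.Rectangle z w ⊆ ball 0 δ → (0 ≤ z.im ∧ 0 ≤ w.im ∨ z.im ≤ 0 ∧ w.im ≤ 0) →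
      (∫ x : ℝ in z.re..w.re, Φ (x + z.im * Complex.I)) -
      (∫ x : ℝ in z.re..w.re, Φ (x + w.im * Complex.I)) +
      Complex.I • (∫ y : ℝ in z.im..w.im, Φ (w.re + y * Complex.I)) -
      Complex.I • (∫ y : ℝ in z.im..w.im, Φ (z.re + y * Complex.I)) = 0 := by
    intro z w hzw hs
    refine Complex.integral_boundary_rect_eq_zero_of_continuousOn_of_differentiableOn Φ z w
      hc.continuousOn fun x hx => ?_
    rw [Complex.mem_reProdIm] at hx
    refine (hd x (hzw ?_) ?_).differentiableWithinAt
    · rw [Complex.Rectangle, Complex.mem_reProdIm]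
      exact ⟨Ioo_subset_Icc_self hx.1, Ioo_subset_Icc_self hx.2⟩
    · have h2 := hx.2
      rcases hs with ⟨h, h'⟩ | ⟨h, h'⟩
      · exact (lt_of_le_of_lt (le_min h h') h2.1).ne'
      · exact (lt_of_lt_of_le h2.2 (max_le h h')).ne
  intro z w hzw
  rw [← add_eq_zero_iff_eq_neg, Complex.wedgeIntegral_add_wedgeIntegral_eq]
  by_cases hs : 0 ≤ z.im ∧ 0 ≤ w.im ∨ z.im ≤ 0 ∧ w.im ≤ 0
  · exact half z w hzw hs
  have h0 : (0 : ℝ) ∈ [[z.im, w.im]] := by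
    rw [mem_uIcc]
    by_contra! h
    apply hs
    rcases le_total 0 z.im with h1 | h1
    · exact .inl ⟨h1, by by_contra! h2; exact absurd (h.2 h2.le) (not_lt.2 h1)⟩
    · exact .inr ⟨h1, (h.1 h1).le⟩
  have e1 := half z ⟨w.re, 0⟩ (fun x hx => hzw ?_) (by
    rcases le_total 0 z.im with h1 | h1
    · exact .inl ⟨h1, le_rfl⟩
    · exact .inr ⟨h1, le_rfl⟩)
  have e2 := half ⟨z.re, 0⟩ w (fun x hx => hzw ?_) (by
    rcases le_total 0 w.im with h1 | h1
    · exact .inl ⟨le_rfl, h1⟩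
    · exact .inr ⟨le_rfl, h1⟩)
  · simp only at e1 e2
    have hi : ∀ a b c : ℝ, IntervalIntegrable (fun y : ℝ => Φ (a + y * Complex.I)) volume b c :=
      fun a b c => (Continuous.intervalIntegrable (by fun_prop) _ _)
    have a1 := intervalIntegral.integral_add_adjacent_intervals (hi w.re z.im 0) (hi w.re 0 w.im)
    have a2 := intervalIntegral.integral_add_adjacent_intervals (hi z.re z.im 0) (hi z.re 0 w.im)
    rw [← a1, ← a2, smul_add, smul_add]
    linear_combination (exp := 1) e1 + e2
  all_goals rw [Complex.Rectangle, Complex.mem_reProdIm] at hx ⊢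
  · exact ⟨hx.1, uIcc_subset_uIcc_right h0 hx.2⟩
  · exact ⟨hx.1, uIcc_subset_uIcc_left h0 hx.2⟩

/-- Schwarz reflection for a holomorphic function whose imaginary part is positive and vanishes at
the real axis. -/
theorem exists_reflection_real {r : ℝ} {G : ℂ → ℂ} (hr : 0 < r)
    (hG : DifferentiableOn ℂ G (upperBox r)) (hpos : ∀ z ∈ upperBox r, 0 < (G z).im)
    (hlim : ∀ t : ℝ, |t| < r → Tendsto (fun z => (G z).im) (𝓝[upperBox r] (t : ℂ)) (𝓝 0)) :
    ∃ δ > 0, ∃ H : ℂ → ℂ, DifferentiableOn ℂ H (ball 0 δ) ∧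
      (∀ z ∈ ball (0 : ℂ) δ, 0 < z.im → H z = G z) ∧
      (∀ z ∈ ball (0 : ℂ) δ, z.im = 0 → (H z).im = 0) ∧
      ∀ z ∈ ball (0 : ℂ) δ, z.im < 0 → (H z).im < 0 := by
  obtain ⟨A, hA, hAim⟩ := im_le_mul_im hr hG hlim
  have hsub : ∀ {s : ℝ}, s ≤ r → upperBox s ⊆ upperBox r := fun hs z hz =>
    ⟨hz.1.trans_le hs, hz.2.1, hz.2.2.trans_le hs⟩
  have hderiv := norm_deriv_le_of_im_le hA (hG.mono (hsub (by linarith : r / 4 ≤ r)))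
    (fun z hz => hpos z (hsub (by linarith) hz)) (fun z hz => hAim z hz.1.le hz.2.1 hz.2.2)
  set s : ℝ := r / 4 / 2 with hs
  have hs0 : 0 < s := by positivity
  have hsr : s ≤ r := by rw [hs]; linarith
  have hLip : LipschitzOnWith (12 * A).toNNReal G (upperBox s) := by
    refine (convex_upperBox s).lipschitzOnWith_of_nnnorm_deriv_le (𝕜 := ℂ) (fun z hz =>
      hG.differentiableAt ((isOpen_upperBox r).mem_nhds (hsub hsr hz))) fun z hz => ?_
    rw [← NNReal.coe_le_coe, coe_nnnorm, Real.coe_toNNReal _ (by positivity)]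
    exact hderiv z hz
  -- The derivative bound makes `G` Lipschitz up to the axis, so its real part has boundary values
  -- too, although only the imaginary part was assumed to have them.
  obtain ⟨G₀, hG₀, heq⟩ := hLip.extend_finite_dimension
  have hG₀c : Continuous G₀ := hG₀.continuous
  have hreal : ∀ t : ℝ, |t| < s → (G₀ t).im = 0 := by
    intro t ht
    have hne : (𝓝[upperBox s] (t : ℂ)).NeBot := by
      rw [← mem_closure_iff_nhdsWithin_neBot]
      have hc : ContinuousWithinAt (fun y : ℝ => (t : ℂ) + y * Complex.I) (Ioo 0 s) 0 := by fun_prop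
      have := hc.mem_closure (s := Ioo 0 s) (t := upperBox s) (by
        rw [closure_Ioo hs0.ne]; exact ⟨le_rfl, hs0.le⟩) (fun y hy => by
          refine ⟨?_, ?_, ?_⟩ <;> simp [hy.1, hy.2, ht])
      simpa using this
    have h1 : Tendsto (fun z => (G₀ z).im) (𝓝[upperBox s] (t : ℂ)) (𝓝 (G₀ t).im) :=
      (Continuous.tendsto (by fun_prop) (t : ℂ)).mono_left nhdsWithin_le_nhds
    have h2 : Tendsto (fun z => (G₀ z).im) (𝓝[upperBox s] (t : ℂ)) (𝓝 0) := by
      refine ((hlim t (ht.trans_le hsr)).mono_left (nhdsWithin_mono _ (hsub hsr))).congr' ?_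
      filter_upwards [self_mem_nhdsWithin] with z hz
      rw [heq hz]
    exact tendsto_nhds_unique h1 h2
  -- The extension is known to be real only on a short piece of the axis. The correction makes it
  -- real on the whole axis, so that gluing with the reflected function is continuous on the plane.
  set G₁ : ℂ → ℂ := fun z => G₀ z - Complex.I * ((G₀ (z.re : ℂ)).im : ℂ) with hG₁
  have hG₁c : Continuous G₁ := by simp only [hG₁]; fun_prop
  have hG₁eq : ∀ z ∈ upperBox s, G₁ z = G z := by
    intro z hz
    simp [hG₁, hreal z.re hz.1, heq hz]
  have hG₁real : ∀ z : ℂ, z.im = 0 → (G₁ z).im = 0 := by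
    intro z hz
    have : ((z.re : ℝ) : ℂ) = z := by apply Complex.ext <;> simp [hz]
    simp [hG₁, this]
  set H : ℂ → ℂ := fun z => if 0 ≤ z.im then G₁ z else conj (G₁ (conj z)) with hH
  have hHc : Continuous H := by
    refine Continuous.if_le hG₁c (by fun_prop) continuous_const Complex.continuous_im ?_
    intro z hz
    rw [Complex.conj_eq_iff_im.2 hz.symm, eq_comm, Complex.conj_eq_iff_im]
    exact hG₁real z hz.symm
  have hball : ∀ z ∈ ball (0 : ℂ) s, 0 < z.im → z ∈ upperBox s := fun z hz h => by
    rw [mem_ball_zero_iff] at hz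
    exact ⟨(Complex.abs_re_le_norm z).trans_lt hz, h,
      (le_abs_self _).trans_lt ((Complex.abs_im_le_norm z).trans_lt hz)⟩
  have hconj : ∀ z ∈ ball (0 : ℂ) s, conj z ∈ ball (0 : ℂ) s := fun z hz => by
    simpa using hz
  have hlow : ∀ z ∈ ball (0 : ℂ) s, z.im < 0 → conj z ∈ upperBox s := fun z hz h =>
    hball _ (hconj z hz) (by simpa using h)
  refine ⟨s, hs0, H, ?_, ?_, ?_, ?_⟩
  · refine differentiableOn_ball_of_off_real hHc fun z hz hz0 => ?_
    rcases hz0.lt_or_gt with h | h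
    · have hd : DifferentiableAt ℂ G (conj z) := hG.differentiableAt
        ((isOpen_upperBox r).mem_nhds (hsub hsr (hlow z hz h)))
      have hd2 := hd.conj_conj
      rw [Complex.conj_conj] at hd2
      refine hd2.congr_of_eventuallyEq ?_
      have h1 : ∀ᶠ w : ℂ in 𝓝 z, w.im < 0 :=
        Complex.continuous_im.continuousAt.eventually_lt_const h
      filter_upwards [h1, isOpen_ball.mem_nhds hz] with w hw hwb
      simp only [hH, not_le.2 hw, if_false, Function.comp_apply]
      rw [hG₁eq _ (hlow w hwb hw)]
    · have hd : DifferentiableAt ℂ G z := hG.differentiableAt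
        ((isOpen_upperBox r).mem_nhds (hsub hsr (hball z hz h)))
      refine hd.congr_of_eventuallyEq ?_
      filter_upwards [(isOpen_upperBox s).mem_nhds (hball z hz h)] with w hw
      simp only [hH, hw.2.1.le, if_true]
      rw [hG₁eq _ hw]
  · intro z hz h
    simp only [hH, h.le, if_true]
    exact hG₁eq _ (hball z hz h)
  · intro z hz h
    simp only [hH, h.ge, if_true]
    exact hG₁real z h
  · intro z hz h
    simp only [hH, not_le.2 h, if_false]
    rw [hG₁eq _ (hlow z hz h), Complex.conj_im, neg_lt_zero]
    exact hpos _ (hsub hsr (hlow z hz h))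

/-- If `g` is a primitive of `h' / h`, then `exp (-g) h` has zero derivative and is constant. -/
theorem exists_log_of_isExactOn {Ω : Set ℂ} (ho : IsOpen Ω) (hc : IsPreconnected Ω) {h : ℂ → ℂ}
    (hd : DifferentiableOn ℂ h Ω) (h0 : ∀ z ∈ Ω, h z ≠ 0)
    (hex : Complex.IsExactOn (fun z => deriv h z / h z) Ω) :
    ∃ l : ℂ → ℂ, DifferentiableOn ℂ l Ω ∧ ∀ z ∈ Ω, Complex.exp (l z) = h z := by
  obtain ⟨g, hg⟩ := hex
  rcases Ω.eq_empty_or_nonempty with rfl | ⟨z₀, hz₀⟩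
  · exact ⟨0, by simp⟩
  have hconst : ∀ z ∈ Ω, Complex.exp (-g z) * h z = Complex.exp (-g z₀) * h z₀ := by
    intro z hz
    have hder : ∀ w ∈ Ω, HasDerivAt (fun w => Complex.exp (-g w) * h w) 0 w := by
      intro w hw
      have h1 := (hg w hw).neg.cexp.mul (hd.differentiableAt (ho.mem_nhds hw)).hasDerivAt
      refine h1.congr_deriv ?_
      have := div_mul_cancel₀ (deriv h w) (h0 w hw)
      linear_combination -Complex.exp (-g w) * this
    refine ho.is_const_of_deriv_eq_zero (𝕜 := ℂ) (f := fun w => Complex.exp (-g w) * h w) hc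
      (fun w hw => (hder w hw).differentiableAt.differentiableWithinAt)
      (fun w hw => (hder w hw).deriv) hz hz₀
  set c := Complex.exp (-g z₀) * h z₀ with hcdef
  have hc0 : c ≠ 0 := mul_ne_zero (Complex.exp_ne_zero _) (h0 z₀ hz₀)
  refine ⟨fun z => g z + Complex.log c, fun z hz =>
    ((hg z hz).differentiableAt.add_const _).differentiableWithinAt, fun z hz => ?_⟩
  rw [Complex.exp_add, Complex.exp_log hc0, ← hconst z hz, ← mul_assoc, ← Complex.exp_add]
  simp

theorem exists_log_of_convex {Ω : Set ℂ} (ho : IsOpen Ω) (hc : Convex ℝ Ω) {h : ℂ → ℂ}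
    (hd : DifferentiableOn ℂ h Ω) (h0 : ∀ z ∈ Ω, h z ≠ 0) :
    ∃ l : ℂ → ℂ, DifferentiableOn ℂ l Ω ∧ ∀ z ∈ Ω, Complex.exp (l z) = h z := by
  refine exists_log_of_isExactOn ho hc.isPreconnected hd h0 ?_
  obtain ⟨g, hg⟩ := hc.exists_forall_hasDerivWithinAt (𝕜 := ℂ) ((hd.deriv ho).div hd h0)
  exact ⟨g, fun z hz => (hg z hz).hasDerivAt (ho.mem_nhds hz)⟩

theorem isOpen_unitDisk : IsOpen unitDisk := isOpen_lt continuous_norm continuous_const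

theorem unitDisk_eq_ball : unitDisk = ball 0 1 := by
  ext z; simp [unitDisk]

/-- Schwarz reflection at a circular arc, for a function with values in the disk whose modulus tends
to one at the arc. -/
theorem exists_reflection_circle {a : ℂ} (ha : ‖a‖ = 1) {ε : ℝ} (hε : 0 < ε) {F : ℂ → ℂ}
    (hF : DifferentiableOn ℂ F (unitDisk ∩ ball a ε))
    (hlt : ∀ z ∈ unitDisk ∩ ball a ε, ‖F z‖ < 1)
    (hlim : ∀ c ∈ ball a ε, ‖c‖ = 1 →
      Tendsto (fun z => ‖F z‖) (𝓝[unitDisk ∩ ball a ε] c) (𝓝 1)) :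
    ∃ δ > 0, ∃ H : ℂ → ℂ, DifferentiableOn ℂ H (ball a δ) ∧
      (∀ z ∈ ball a δ, ‖z‖ < 1 → H z = F z) ∧
      (∀ z ∈ ball a δ, ‖z‖ = 1 → ‖H z‖ = 1) ∧
      ∀ z ∈ ball a δ, 1 < ‖z‖ → 1 < ‖H z‖ := by
  have ha0 : a ≠ 0 := by rintro rfl; simp at ha
  obtain ⟨ε₁, hε₁, hball₁⟩ : ∃ ε₁ > 0, ∀ z ∈ unitDisk ∩ ball a ε ∩ ball a ε₁, F z ≠ 0 := by
    have h1 := (hlim a (mem_ball_self hε) ha).eventually_const_lt (by norm_num : (1 / 2 : ℝ) < 1)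
    rw [eventually_nhdsWithin_iff] at h1
    obtain ⟨ε₁, hε₁, h2⟩ := Metric.eventually_nhds_iff_ball.1 h1
    refine ⟨ε₁, hε₁, fun z hz h0 => ?_⟩
    have := h2 z hz.2 hz.1
    rw [h0, norm_zero] at this
    norm_num at this
  -- This substitution turns the circle into the real axis and the inside of the disk into the upper
  -- half-plane.
  set e : ℂ → ℂ := fun ζ => a * Complex.exp (Complex.I * ζ) with he
  have hec : Continuous e := by simp only [he]; fun_prop
  have hed : Differentiable ℂ e := by simp only [he]; fun_prop
  have hen : ∀ ζ, ‖e ζ‖ = Real.exp (-ζ.im) := fun ζ => by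
    simp [he, ha, Complex.norm_exp]
  have he0 : e 0 = a := by simp [he]
  obtain ⟨ρ, hρ, hρb⟩ : ∃ ρ > 0, ∀ ζ ∈ ball (0 : ℂ) ρ, e ζ ∈ ball a (min ε ε₁) := by
    have := hec.continuousAt (x := 0)
    rw [ContinuousAt, he0] at this
    exact Metric.eventually_nhds_iff_ball.1 (this.eventually (ball_mem_nhds a (lt_min hε hε₁)))
  set r : ℝ := ρ / 2 with hr
  have hr0 : 0 < r := by positivity
  have hbox : ∀ ζ ∈ upperBox r, e ζ ∈ unitDisk ∩ ball a ε ∩ ball a ε₁ := by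
    intro ζ hζ
    have h1 : ζ ∈ ball (0 : ℂ) ρ := by
      rw [mem_ball_zero_iff]
      refine (Complex.norm_le_abs_re_add_abs_im ζ).trans_lt ?_
      rw [abs_of_pos hζ.2.1]
      linarith [hζ.1, hζ.2.2]
    have h2 := hρb ζ h1
    rw [mem_ball] at h2
    refine ⟨⟨?_, ?_⟩, ?_⟩
    · change ‖e ζ‖ < 1
      rw [hen, Real.exp_lt_one_iff]
      linarith [hζ.2.1]
    · exact h2.trans_le (min_le_left _ _)
    · exact h2.trans_le (min_le_right _ _)
  obtain ⟨l, hl, hlexp⟩ := exists_log_of_convex (h := fun ζ => F (e ζ)) (isOpen_upperBox r)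
    (convex_upperBox r) (hF.comp hed.differentiableOn fun ζ hζ => (hbox ζ hζ).1)
    (fun ζ hζ => hball₁ _ (hbox ζ hζ))
  -- `G = -i log F` has imaginary part `-log |F|`, which is positive and tends to zero at the axis,
  -- as reflection requires.
  set G : ℂ → ℂ := fun ζ => -Complex.I * l ζ with hG
  have hGim : ∀ ζ ∈ upperBox r, (G ζ).im = -Real.log ‖F (e ζ)‖ := by
    intro ζ hζ
    rw [← hlexp ζ hζ, Complex.norm_exp, Real.log_exp]
    simp [hG]
  have hGd : DifferentiableOn ℂ G (upperBox r) := hl.const_mul _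
  obtain ⟨δ₁, hδ₁, H, hHd, hHeq, hHreal, hHneg⟩ := exists_reflection_real hr0 hGd
    (fun ζ hζ => by
      rw [hGim ζ hζ, neg_pos]
      exact Real.log_neg (norm_pos_iff.2 (hball₁ _ (hbox ζ hζ))) (hlt _ (hbox ζ hζ).1))
    (fun t ht => by
      have ht1 : (t : ℂ) ∈ ball (0 : ℂ) ρ := by
        rw [mem_ball_zero_iff, Complex.norm_real, Real.norm_eq_abs]; linarith
      have hm := hlim (e t) (ball_subset_ball (min_le_left _ _) (hρb _ ht1)) (by rw [hen]; simp)
      have hte : Tendsto e (𝓝[upperBox r] (t : ℂ)) (𝓝[unitDisk ∩ ball a ε] (e t)) :=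
        tendsto_nhdsWithin_of_tendsto_nhds_of_eventually_within _
          ((hec.tendsto _).mono_left nhdsWithin_le_nhds)
          (by filter_upwards [self_mem_nhdsWithin] with ζ hζ using (hbox ζ hζ).1)
      have h2 := ((hm.comp hte).log one_ne_zero).neg
      rw [Real.log_one, neg_zero] at h2
      refine h2.congr' ?_
      filter_upwards [self_mem_nhdsWithin] with ζ hζ
      rw [hGim ζ hζ]; rfl)
  -- A local inverse of `e` at `a`, with `Im (k z) = -log |z|`.
  set k : ℂ → ℂ := fun z => -Complex.I * Complex.log (z / a) with hk
  have hka : k a = 0 := by simp [hk, ha0]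
  have hkc : ∀ z, z / a ∈ Complex.slitPlane → DifferentiableAt ℂ k z := fun z hz =>
    (DifferentiableAt.clog (f := fun z => z / a) (differentiableAt_id.div_const a) hz).const_mul _
  have hkcont : ContinuousAt k a := (hkc a (by simp [ha0])).continuousAt
  have hev1 : ∀ᶠ z in 𝓝 a, z / a ∈ Complex.slitPlane :=
    (ContinuousAt.div continuousAt_id continuousAt_const ha0).eventually
      (Complex.isOpen_slitPlane.mem_nhds (by simp [ha0]))
  have hev2 : ∀ᶠ z in 𝓝 a, k z ∈ ball (0 : ℂ) (min δ₁ r) := by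
    rw [ContinuousAt, hka] at hkcont
    exact hkcont.eventually (ball_mem_nhds _ (lt_min hδ₁ hr0))
  obtain ⟨δ, hδ, hδb⟩ := Metric.eventually_nhds_iff_ball.1 (hev1.and hev2)
  have hkim : ∀ z, (k z).im = -Real.log ‖z‖ := by
    intro z
    simp [hk, Complex.log_re, ha]
  have hek : ∀ z ∈ ball a δ, e (k z) = z := by
    intro z hz
    have h0 : z / a ≠ 0 := Complex.slitPlane_ne_zero (hδb z hz).1
    simp only [he, hk]
    rw [← mul_assoc, mul_neg, Complex.I_mul_I, neg_neg, one_mul, Complex.exp_log h0,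
      mul_div_cancel₀ _ ha0]
  have hz0 : ∀ z ∈ ball a δ, 0 < ‖z‖ := fun z hz => by
    have h0 : z / a ≠ 0 := Complex.slitPlane_ne_zero (hδb z hz).1
    exact norm_pos_iff.2 fun h => h0 (by simp [h])
  have hkδ₁ : ∀ z ∈ ball a δ, k z ∈ ball (0 : ℂ) δ₁ := fun z hz =>
    ball_subset_ball (min_le_left _ _) (hδb z hz).2
  refine ⟨δ, hδ, fun z => Complex.exp (Complex.I * H (k z)), ?_, ?_, ?_, ?_⟩
  · intro z hz
    have h1 : DifferentiableAt ℂ H (k z) := hHd.differentiableAt (isOpen_ball.mem_nhds (hkδ₁ z hz))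
    exact ((h1.comp z (hkc z (hδb z hz).1)).const_mul _).cexp.differentiableWithinAt
  · intro z hz hz1
    have hpos : 0 < (k z).im := by
      rw [hkim, neg_pos]; exact Real.log_neg (hz0 z hz) hz1
    have hkr : ‖k z‖ < r := by
      simpa using ball_subset_ball (min_le_right _ _) (hδb z hz).2
    have hkbox : k z ∈ upperBox r := ⟨(Complex.abs_re_le_norm _).trans_lt hkr, hpos,
      (le_abs_self _).trans_lt ((Complex.abs_im_le_norm _).trans_lt hkr)⟩
    have h1 := hlexp (k z) hkbox
    simp only [hek z hz] at h1
    rw [← h1]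
    beta_reduce
    rw [hHeq _ (hkδ₁ z hz) hpos]
    congr 1
    simp only [hG]
    rw [← mul_assoc, mul_neg, Complex.I_mul_I, neg_neg, one_mul]
  · intro z hz hz1
    have h1 := hHreal _ (hkδ₁ z hz) (by rw [hkim, hz1]; simp)
    rw [Complex.norm_exp]
    simp [h1]
  · intro z hz hz1
    have h1 := hHneg _ (hkδ₁ z hz) (by rw [hkim, neg_lt_zero]; exact Real.log_pos hz1)
    rw [Complex.norm_exp, Real.one_lt_exp_iff]
    simp [h1]

/-! ### Runge approximation and primitives -/

/-- The Cauchy–Pompeiu formula for compactly supported functions. -/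
theorem integral_dbar_div {g : ℂ → ℂ} (hg : ContDiff ℝ 1 g) (hs : HasCompactSupport g) (z : ℂ) :
    ∫ ζ, (fderiv ℝ g ζ 1 + Complex.I * fderiv ℝ g ζ Complex.I) / (ζ - z) =
      -(2 * Real.pi) * g z := by
  set D := fderiv ℝ g with hD
  have hDc : Continuous D := hg.continuous_fderiv one_ne_zero
  have hDs : HasCompactSupport D := hs.fderiv ℝ
  have hgd : ∀ w, HasFDerivAt g (D w) w := fun w => (hg.differentiable one_ne_zero w).hasFDerivAt
  set E : ℝ → ℂ := fun θ => Complex.exp (θ * Complex.I) with hE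
  have hEc : Continuous E := by simp only [hE]; fun_prop
  have hEn : ∀ θ, ‖E θ‖ = 1 := fun θ => by simp [hE, Complex.norm_exp]
  have hE0 : ∀ θ, E θ ≠ 0 := fun θ => Complex.exp_ne_zero _
  -- In polar coordinates about `z` the integrand becomes `A + i B`, with `A` the radial derivative
  -- of `g` and `r B` the angular one. The angular part integrates to zero over circles, the radial
  -- part to `-g z` along each ray.
  set A : ℝ × ℝ → ℂ := fun p => D (z + p.1 * E p.2) (E p.2) with hA
  set B : ℝ × ℝ → ℂ := fun p => D (z + p.1 * E p.2) (Complex.I * E p.2) with hB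
  have hpt : Continuous fun p : ℝ × ℝ => z + p.1 * E p.2 := by fun_prop
  have hAc : Continuous A := (hDc.comp hpt).clm_apply (by fun_prop)
  have hBc : Continuous B := (hDc.comp hpt).clm_apply (by fun_prop)
  obtain ⟨R₀, hR₀⟩ := hDs.isCompact.isBounded.subset_closedBall 0
  have hzero : ∀ p : ℝ × ℝ, R₀ + ‖z‖ < p.1 → D (z + p.1 * E p.2) = 0 := by
    intro p hp
    by_contra h
    have h1 := hR₀ (subset_tsupport D h)
    rw [mem_closedBall_zero_iff] at h1
    have h2 : ‖(p.1 : ℂ) * E p.2‖ ≤ ‖z + p.1 * E p.2‖ + ‖z‖ := by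
      have := norm_sub_le (z + p.1 * E p.2) z
      simpa using this
    rw [norm_mul, hEn, mul_one, Complex.norm_real, Real.norm_eq_abs] at h2
    linarith [le_abs_self p.1]
  set T : Set (ℝ × ℝ) := Ioi 0 ×ˢ Ioo (-Real.pi) Real.pi with hT
  have hTm : MeasurableSet T := measurableSet_Ioi.prod measurableSet_Ioo
  have hint : ∀ f : ℝ × ℝ → ℂ, Continuous f → (∀ p : ℝ × ℝ, R₀ + ‖z‖ < p.1 → f p = 0) →
      IntegrableOn f T := by
    intro f hf h0
    have h1 : IntegrableOn f (Icc 0 (R₀ + ‖z‖) ×ˢ Icc (-Real.pi) Real.pi) :=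
      hf.continuousOn.integrableOn_compact (isCompact_Icc.prod isCompact_Icc)
    refine h1.of_forall_sdiff_eq_zero hTm fun p hp => h0 p ?_
    by_contra! hle
    exact hp.2 ⟨⟨(mem_Ioi.1 hp.1.1).le, hle⟩, Ioo_subset_Icc_self hp.1.2⟩
  have hAi := hint A hAc fun p hp => by simp [hA, hzero p hp]
  have hBi := hint B hBc fun p hp => by simp [hB, hzero p hp]
  have hEd : ∀ θ : ℝ, HasDerivAt E (E θ * Complex.I) θ := by
    intro θ
    have h1 : HasDerivAt (fun t : ℝ => (t : ℂ) * Complex.I) (1 * Complex.I) θ :=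
      (Complex.ofRealCLM.hasDerivAt (x := θ)).mul_const _
    simpa [hE] using h1.cexp
  have hBint : ∫ p in T, B p = 0 := by
    rw [hT, Measure.volume_eq_prod, setIntegral_prod _ hBi]
    refine setIntegral_eq_zero_of_forall_eq_zero fun r hr => ?_
    rw [← integral_Ioc_eq_integral_Ioo, ← intervalIntegral.integral_of_le (by linarith [Real.pi_pos])]
    have hder : ∀ θ ∈ uIcc (-Real.pi) Real.pi, HasDerivAt (fun θ : ℝ => g (z + r * E θ))
        (r • B (r, θ)) θ := by
      intro θ _
      have h1 : HasDerivAt (fun θ : ℝ => z + r * E θ) (r * (E θ * Complex.I)) θ :=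
        ((hEd θ).const_mul _).const_add z
      have h2 := (hgd (z + r * E θ)).comp_hasDerivAt θ h1
      refine h2.congr_deriv ?_
      simp only [hB]
      rw [← map_smul, Complex.real_smul]
      ring_nf
    have h3 := intervalIntegral.integral_eq_sub_of_hasDerivAt hder
      (Continuous.intervalIntegrable (by fun_prop) _ _)
    rw [intervalIntegral.integral_smul] at h3
    have h4 : E Real.pi = E (-Real.pi) := by
      simp only [hE, Complex.exp_pi_mul_I, Complex.ofReal_neg]
      rw [neg_mul, Complex.exp_neg_pi_mul_I]
    rw [h4, sub_self] at h3
    exact (smul_eq_zero.1 h3).resolve_left (ne_of_gt hr)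
  have hAint : ∫ p in T, A p = -(2 * Real.pi) * g z := by
    rw [hT, Measure.volume_eq_prod, setIntegral_prod _ hAi, integral_integral_swap]
    · have hinner : ∀ θ : ℝ, ∫ r in Ioi (0 : ℝ), A (r, θ) = -g z := by
        intro θ
        have hγ : ContDiff ℝ 1 (fun r : ℝ => z + r * E θ) :=
          contDiff_const.add (Complex.ofRealCLM.contDiff.mul contDiff_const)
        have hf : ContDiff ℝ 1 (fun r : ℝ => g (z + r * E θ)) := hg.comp hγ
        have hfs : HasCompactSupport (fun r : ℝ => g (z + r * E θ)) := by
          refine hs.comp_isClosedEmbedding (g := fun r : ℝ => z + r * E θ) ?_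
          refine Isometry.isClosedEmbedding (Isometry.of_dist_eq fun r s => ?_)
          rw [dist_add_left, dist_eq_norm, ← sub_mul, norm_mul, hEn, mul_one,
            ← Complex.ofReal_sub, Complex.norm_real, dist_eq_norm]
        have h1 := hfs.integral_Ioi_deriv_eq hf 0
        simp only [Complex.ofReal_zero, zero_mul, add_zero] at h1
        rw [← h1]
        refine integral_congr_ae (Eventually.of_forall fun r => ?_)
        have h2 : HasDerivAt (fun r : ℝ => z + r * E θ) (1 * E θ) r :=
          ((Complex.ofRealCLM.hasDerivAt (x := r)).mul_const _).const_add z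
        rw [one_mul] at h2
        exact ((hgd (z + r * E θ)).comp_hasDerivAt r h2).deriv.symm
      simp only [hinner]
      rw [setIntegral_const]
      rw [Measure.real, Real.volume_Ioo, ENNReal.toReal_ofReal (by linarith [Real.pi_pos]),
        Complex.real_smul]
      push_cast
      ring
    · rw [IntegrableOn, Measure.volume_eq_prod, ← Measure.prod_restrict] at hAi
      exact hAi
  have hshift : ∫ ζ, (D ζ 1 + Complex.I * D ζ Complex.I) / (ζ - z) =
      ∫ ζ, (D (z + ζ) 1 + Complex.I * D (z + ζ) Complex.I) / ζ := by
    rw [← integral_add_left_eq_self _ z]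
    simp
  rw [hshift, ← Complex.integral_comp_polarCoord_symm]
  have hEq : ∫ p in polarCoord.target, p.1 • ((D (z + Complex.polarCoord.symm p) 1 +
      Complex.I * D (z + Complex.polarCoord.symm p) Complex.I) / Complex.polarCoord.symm p) =
      ∫ p in T, (A p + Complex.I * B p) := by
    rw [polarCoord_target]
    refine setIntegral_congr_fun hTm fun p hp => ?_
    have hp0 : (p.1 : ℂ) ≠ 0 := Complex.ofReal_ne_zero.2 (ne_of_gt hp.1)
    have hexp : E p.2 = (Real.cos p.2 : ℂ) + Real.sin p.2 * Complex.I := by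
      rw [hE, Complex.ofReal_cos, Complex.ofReal_sin]; exact Complex.exp_mul_I _
    have hpe : Complex.polarCoord.symm p = p.1 * E p.2 := by
      rw [Complex.polarCoord_symm_apply, hexp]
    simp only [hpe, hA, hB]
    set w := z + p.1 * E p.2
    have h1 : D w (E p.2) = Real.cos p.2 * D w 1 + Real.sin p.2 * D w Complex.I := by
      have : E p.2 = Real.cos p.2 • (1 : ℂ) + Real.sin p.2 • Complex.I := by
        rw [hexp]; simp
      rw [this, map_add, map_smul, map_smul]; simp
    have h2 : D w (Complex.I * E p.2) = Real.cos p.2 * D w Complex.I - Real.sin p.2 * D w 1 := by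
      have : Complex.I * E p.2 = Real.cos p.2 • Complex.I - Real.sin p.2 • (1 : ℂ) := by
        rw [hexp]; simp only [Complex.real_smul]
        linear_combination (Real.sin p.2 : ℂ) * Complex.I_mul_I
      rw [this, map_sub, map_smul, map_smul]; simp
    rw [h1, h2, Complex.real_smul, mul_div_assoc', mul_div_mul_left _ _ hp0, div_eq_iff (hE0 _), hexp]
    have hcs : (Real.cos p.2 : ℂ) ^ 2 + (Real.sin p.2 : ℂ) ^ 2 = 1 := by
      norm_cast; exact Real.cos_sq_add_sin_sq _
    generalize (Real.cos p.2 : ℂ) = c at *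
    generalize (Real.sin p.2 : ℂ) = s at *
    linear_combination (exp := 1) (-(D w 1) - Complex.I * D w Complex.I) * hcs +
      (s ^ 2 * D w 1 - s * c * D w Complex.I ) * Complex.I_sq
  rw [hEq, integral_add hAi (hBi.const_mul _), integral_const_mul, hBint, hAint]
  simp

/-- The thickening is the sum of `E` and a ball, hence a continuous image of a connected product. -/
theorem isPreconnected_thickening {E : Set ℂ} (hE : IsPreconnected E) (δ : ℝ) :
    IsPreconnected (thickening δ E) := by
  rw [← add_ball_zero, ← add_image_prod]
  exact (hE.prod (convex_ball 0 δ).isPreconnected).image _ (by fun_prop)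

theorem Submodule.integral_mem_of_isClosed {X M : Type*} [MeasurableSpace X] {μ : Measure X}
    [NormedAddCommGroup M] [NormedSpace ℂ M] [CompleteSpace M] (S : Submodule ℂ M)
    (hS : IsClosed (S : Set M)) {Ψ : X → M} (hi : Integrable Ψ μ) (hΨ : ∀ x, Ψ x ∈ S) :
    ∫ x, Ψ x ∂μ ∈ S := by
  have : IsClosed (S : Set M) := hS
  have h1 := (S.mkQL).integral_comp_comm hi
  have h2 : ∀ x, S.mkQL (Ψ x) = 0 := fun x => by
    rw [Submodule.mkQL_apply, Submodule.mkQ_apply]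
    exact (Submodule.Quotient.mk_eq_zero S).2 (hΨ x)
  simp only [h2, integral_zero] at h1
  rw [Submodule.mkQL_apply, Submodule.mkQ_apply, eq_comm, Submodule.Quotient.mk_eq_zero] at h1
  exact h1

/-- Poles off a compact set with connected complement can be pushed to infinity. -/
theorem mem_closure_polynomialFunctions_of_mul_eq_one {K : Set ℂ} [CompactSpace K]
    (hKc : IsPreconnected Kᶜ) {ζ : ℂ} (hζ : ζ ∉ K) {R : C(K, ℂ)} (hR : ∀ z : K, R z * (ζ - z) = 1) :
    R ∈ (polynomialFunctions K).topologicalClosure := by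
  set S := (polynomialFunctions K).topologicalClosure with hSdef
  have hS : IsClosed (S : Set C(K, ℂ)) := Subalgebra.isClosed_topologicalClosure _
  have hX : Polynomial.toContinuousMapOnAlgHom K Polynomial.X ∈ S :=
    Subalgebra.le_topologicalClosure _ ⟨Polynomial.X, by simp, rfl⟩
  set x : S := ⟨_, hX⟩ with hx
  have hxz : ∀ z : K, (x : C(K, ℂ)) z = z := fun z => by simp [hx]
  have hsp : spectrum ℂ (x : C(K, ℂ)) = K := by
    rw [ContinuousMap.spectrum_eq_range]
    ext w
    constructor
    · rintro ⟨z, rfl⟩; rw [hxz]; exact z.2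
    · intro hw; exact ⟨⟨w, hw⟩, hxz _⟩
  -- Passing to a closed subalgebra can enlarge a spectrum only by filling holes, and `K` has none.
  -- So `ζ - z` stays invertible in the closure of the polynomials.
  have hsp2 : spectrum ℂ x = K := by
    rw [Subalgebra.spectrum_eq_of_isPreconnected_compl S x (by rw [hsp]; exact hKc), hsp]
  have hu : IsUnit (algebraMap ℂ S ζ - x) := by
    have : ζ ∉ spectrum ℂ x := by rw [hsp2]; exact hζ
    exact spectrum.notMem_iff.1 this
  obtain ⟨y, hy⟩ := hu.exists_right_inv
  have hyR : (y : C(K, ℂ)) = R := by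
    ext z
    have h1 := congrArg (fun s : S => (s : C(K, ℂ)) z) hy
    simp only [MulMemClass.coe_mul, ContinuousMap.mul_apply, AddSubgroupClass.coe_sub,
      ContinuousMap.sub_apply, hxz, OneMemClass.coe_one, ContinuousMap.one_apply] at h1
    have h2 : ((algebraMap ℂ S ζ : S) : C(K, ℂ)) z = ζ := rfl
    rw [h2] at h1
    have h3 := hR z
    calc (y : C(K, ℂ)) z = (R z * (ζ - z)) * (y : C(K, ℂ)) z := by rw [h3, one_mul]
      _ = R z := by rw [mul_assoc, h1, mul_one]
  rw [← hyR]; exact y.2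

/-- Runge approximation by polynomials. -/
theorem exists_polynomial_approx {W K : Set ℂ} (hW : IsOpen W) (hK : IsCompact K) (hKW : K ⊆ W)
    (hKc : IsPreconnected Kᶜ) {h : ℂ → ℂ} (hh : DifferentiableOn ℂ h W) {ε : ℝ} (hε : 0 < ε) :
    ∃ p : Polynomial ℂ, ∀ z ∈ K, ‖p.eval z - h z‖ < ε := by
  have : CompactSpace K := isCompact_iff_compactSpace.1 hK
  obtain ⟨K', hK', hKK', hK'W⟩ := exists_compact_between hK hW hKW
  obtain ⟨χ, hχ1, hχ0, -⟩ := exists_contMDiffMap_one_nhds_of_subset_interior (n := 1)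
    (I := modelWithCornersSelf ℝ ℂ) hK.isClosed hKK'
  have hχs : ContDiff ℝ 1 (χ : ℂ → ℝ) := χ.contMDiff.contDiff
  set g : ℂ → ℂ := fun z => (χ z : ℂ) * h z with hg
  have hg0 : ∀ z ∉ K', g z = 0 := fun z hz => by simp [hg, hχ0 z hz]
  have hgs : HasCompactSupport g := HasCompactSupport.intro hK' hg0
  have hgc : ContDiff ℝ 1 g := by
    rw [contDiff_iff_contDiffAt]
    intro z
    by_cases hz : z ∈ W
    · have h1 : ContDiffAt ℝ 1 h z :=
        ((hh.contDiffOn hW (n := 1)).contDiffAt (hW.mem_nhds hz)).restrict_scalars ℝ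
      exact (Complex.ofRealCLM.contDiff.comp hχs).contDiffAt.mul h1
    · have : g =ᶠ[𝓝 z] fun _ => 0 := by
        filter_upwards [hK'.isClosed.isOpen_compl.mem_nhds fun h => hz (hK'W h)] with w hw
        exact hg0 w hw
      exact contDiffAt_const.congr_of_eventuallyEq this
  obtain ⟨N, hNo, hKN, hNχ⟩ := (mem_nhdsSet_iff_exists.1 hχ1)
  -- This is `2 ∂̄g`. It vanishes near `K`, where `g = h`, so the Cauchy–Pompeiu integral only uses
  -- poles off `K`.
  set c : ℂ → ℂ := fun ζ => fderiv ℝ g ζ 1 + Complex.I * fderiv ℝ g ζ Complex.I with hc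
  have hDc : Continuous (fderiv ℝ g) := hgc.continuous_fderiv one_ne_zero
  have hcc : Continuous c := by simp only [hc]; fun_prop
  have hcs : HasCompactSupport c := by
    refine HasCompactSupport.intro (hgs.fderiv ℝ).isCompact fun ζ hζ => ?_
    have := image_eq_zero_of_notMem_tsupport hζ
    simp [hc, this]
  have hcN : ∀ ζ ∈ N ∩ W, c ζ = 0 := by
    intro ζ hζ
    have heq : g =ᶠ[𝓝 ζ] h := by
      filter_upwards [hNo.mem_nhds hζ.1] with w hw
      have : χ w = 1 := hNχ hw
      simp [hg, this]
    have hd := hh.differentiableAt (hW.mem_nhds hζ.2)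
    have hf : fderiv ℝ g ζ = (fderiv ℂ h ζ).restrictScalars ℝ := by
      rw [heq.fderiv_eq, hd.fderiv_restrictScalars ℝ]
    have h2 : fderiv ℂ h ζ Complex.I = Complex.I * fderiv ℂ h ζ 1 := by
      rw [← smul_eq_mul, ← map_smul, smul_eq_mul, mul_one]
    simp only [hc, hf, ContinuousLinearMap.coe_restrictScalars', h2]
    rw [← mul_assoc, Complex.I_mul_I]
    ring
  have hΨc : Continuous fun p : ℂ × K => c p.1 / (p.1 - p.2) := by
    rw [continuous_iff_continuousAt]
    rintro ⟨ζ, z⟩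
    by_cases hz : ζ = z
    · have hmem : N ∩ W ∈ 𝓝 ζ := (hNo.inter hW).mem_nhds (hz ▸ ⟨hKN z.2, hKW z.2⟩)
      have : (fun p : ℂ × K => c p.1 / (p.1 - p.2)) =ᶠ[𝓝 (ζ, z)] fun _ => 0 := by
        filter_upwards [continuousAt_fst.preimage_mem_nhds hmem] with p hp
        rw [hcN _ hp, zero_div]
      exact continuousAt_const.congr this.symm
    · refine ContinuousAt.div (by fun_prop) (by fun_prop) ?_
      exact sub_ne_zero.2 hz
  -- The integral is taken in `C(K, ℂ)`, where a closed subspace containing all values of the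
  -- integrand contains the integral. No Riemann sums are needed.
  set Ψ : C(ℂ, C(K, ℂ)) := ContinuousMap.curry ⟨_, hΨc⟩ with hΨ
  have hΨz : ∀ ζ (z : K), Ψ ζ z = c ζ / (ζ - z) := fun ζ z => rfl
  have hΨi : Integrable Ψ := by
    refine Ψ.continuous.integrable_of_hasCompactSupport ?_
    refine HasCompactSupport.intro hcs.isCompact fun ζ hζ => ?_
    ext z
    rw [hΨz, image_eq_zero_of_notMem_tsupport hζ]
    simp
  set S := (polynomialFunctions K).topologicalClosure with hSdef
  have hmem : ∫ ζ, Ψ ζ ∈ Subalgebra.toSubmodule S := by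
    refine Submodule.integral_mem_of_isClosed _ (Subalgebra.isClosed_topologicalClosure _) hΨi
      fun ζ => ?_
    rw [Subalgebra.mem_toSubmodule]
    by_cases hζ : ζ ∈ K
    · have : Ψ ζ = 0 := by
        ext z; rw [hΨz, hcN ζ ⟨hKN hζ, hKW hζ⟩]; simp
      rw [this]; exact zero_mem S
    · have hne : ∀ z : K, ζ - z ≠ 0 := fun z hz => hζ (sub_eq_zero.1 hz ▸ z.2)
      set R : C(K, ℂ) := ⟨fun z => (ζ - z)⁻¹,
        Continuous.inv₀ (by fun_prop) hne⟩ with hR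
      have h1 : R ∈ S := mem_closure_polynomialFunctions_of_mul_eq_one hKc hζ fun z =>
        inv_mul_cancel₀ (hne z)
      have h2 : Ψ ζ = c ζ • R := by
        ext z; rw [hΨz, div_eq_mul_inv]; rfl
      rw [h2]; exact S.smul_mem h1 _
  have hval : ∀ z : K, (∫ ζ, Ψ ζ) z = -(2 * Real.pi) * h z := by
    intro z
    rw [ContinuousMap.integral_apply hΨi]
    simp only [hΨz, hc]
    rw [integral_dbar_div hgc hgs]
    have : χ z = 1 := hNχ (hKN z.2)
    simp [hg, this]
  have hmem2 : (-(2 * Real.pi : ℂ))⁻¹ • ∫ ζ, Ψ ζ ∈ S :=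
    S.smul_mem ((Subalgebra.mem_toSubmodule _).1 hmem) _
  obtain ⟨q, hq, hqd⟩ := Metric.mem_closure_iff.1 hmem2 ε hε
  obtain ⟨p, -, rfl⟩ := hq
  refine ⟨p, fun z hz => ?_⟩
  have h1 := (ContinuousMap.dist_apply_le_dist (⟨z, hz⟩ : K)).trans_lt hqd
  rw [ContinuousMap.smul_apply, hval, dist_comm, dist_eq_norm, smul_eq_mul] at h1
  have h0 : (-(2 * Real.pi : ℂ)) ≠ 0 := by
    simp [Real.pi_ne_zero]
  rw [inv_mul_cancel_left₀ h0] at h1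
  exact h1

/-- Polynomials have primitives, and locally uniform polynomial approximations of `h` have
primitives that converge on the connected set `V` once they agree at one point. Connectedness of the
complement is asked of `W` only, not of `V`. -/
theorem isExactOn_of_isPreconnected_compl {W V : Set ℂ} (hW : IsOpen W)
    (hWb : Bornology.IsBounded W) (hWc : IsPreconnected Wᶜ) (hV : IsOpen V)
    (hVc : IsPreconnected V) (hVW : V ⊆ W) {h : ℂ → ℂ} (hh : DifferentiableOn ℂ h W) :
    Complex.IsExactOn h V := by
  rcases V.eq_empty_or_nonempty with rfl | ⟨z₀, hz₀⟩
  · exact ⟨0, by simp⟩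
  -- The compact exhaustion consists of complements of thickenings of `Wᶜ`, so each member inherits
  -- a connected complement.
  have hKW : ∀ n : ℕ, (thickening (1 / (n + 1 : ℝ)) Wᶜ)ᶜ ⊆ W := fun n z hz => by
    by_contra hzW
    exact hz (self_subset_thickening (by positivity) _ hzW)
  have hex : ∀ n : ℕ, ∃ p : Polynomial ℂ, ∀ z ∈ (thickening (1 / (n + 1 : ℝ)) Wᶜ)ᶜ,
      ‖p.eval z - h z‖ < 1 / (n + 1 : ℝ) := by
    intro n
    refine exists_polynomial_approx hW ?_ (hKW n) ?_ hh (by positivity)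
    · exact isCompact_of_isClosed_isBounded isOpen_thickening.isClosed_compl
        (hWb.subset (hKW n))
    · rw [compl_compl]; exact isPreconnected_thickening hWc _
  choose p hp using hex
  have hloc : TendstoLocallyUniformlyOn (fun n z => (p n).eval z) h atTop W := by
    rw [tendstoLocallyUniformlyOn_iff_forall_isCompact hW]
    intro K hKW hK
    rw [Metric.tendstoUniformlyOn_iff]
    intro ε hε
    obtain ⟨δ, hδ, hKδ⟩ := hK.exists_thickening_subset_open hW hKW
    obtain ⟨m, hm⟩ := exists_nat_one_div_lt (lt_min hδ hε)
    filter_upwards [eventually_ge_atTop m] with n hn z hz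
    have hnm : 1 / (n + 1 : ℝ) ≤ 1 / (m + 1 : ℝ) := by
      gcongr
    have hn2 := hnm.trans_lt hm
    rw [dist_comm, dist_eq_norm]
    refine (hp n z fun hzt => ?_).trans (hn2.trans_le (min_le_right _ _))
    rw [mem_thickening_iff] at hzt
    obtain ⟨w, hw, hzw⟩ := hzt
    refine hw (hKδ ?_)
    rw [mem_thickening_iff]
    exact ⟨z, hz, by rw [dist_comm]; exact hzw.trans (hn2.trans_le (min_le_left _ _))⟩
  have hprim : ∀ n : ℕ, ∃ P : ℂ → ℂ, P z₀ = 0 ∧ ∀ z ∈ (univ : Set ℂ),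
      HasDerivAt P ((p n).eval z) z := fun n =>
    (Differentiable.isExactOn_univ (p n).differentiable).with_val_at z₀ 0
  choose P hP0 hPd using hprim
  -- The points where the primitives converge form a relatively clopen subset of `V` containing
  -- `z₀`.
  set T : Set ℂ := {x | x ∈ V ∧ Cauchy (map (fun n => P n x) atTop)} with hT
  have hballs : ∀ x r, 0 < r → closedBall x r ⊆ V → Cauchy (map (fun n => P n x) atTop) →
      ∀ y ∈ ball x r, Cauchy (map (fun n => P n y) atTop) := by
    intro x r _ hxr hC y hy
    have h1 : UniformCauchySeqOn (fun n z => (p n).eval z) atTop (ball x r) := by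
      have h2 := (tendstoLocallyUniformlyOn_iff_forall_isCompact hW).1 hloc _ (hxr.trans hVW)
        (isCompact_closedBall x r)
      exact h2.uniformCauchySeqOn.mono ball_subset_closedBall
    exact (uniformCauchySeqOn_ball_of_deriv h1 (fun n z _ => hPd n z (mem_univ _)) hC).cauchy_map hy
  have hTo : IsOpen T := by
    rw [Metric.isOpen_iff]
    rintro x ⟨hxV, hxC⟩
    obtain ⟨r, hr, hxr⟩ := Metric.nhds_basis_closedBall.mem_iff.1 (hV.mem_nhds hxV)
    exact ⟨r, hr, fun y hy => ⟨hxr (ball_subset_closedBall hy), hballs x r hr hxr hxC y hy⟩⟩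
  have hVT : V ⊆ T := by
    refine hVc.subset_of_closure_inter_subset hTo ⟨z₀, hz₀, hz₀, ?_⟩ ?_
    · simp only [hP0]
      exact tendsto_const_nhds.cauchy_map
    · rintro x ⟨hxT, hxV⟩
      obtain ⟨r, hr, hxr⟩ := Metric.nhds_basis_closedBall.mem_iff.1 (hV.mem_nhds hxV)
      obtain ⟨y, hyT, hxy⟩ := Metric.mem_closure_iff.1 hxT (r / 2) (by positivity)
      refine ⟨hxV, hballs y (r / 2) (by positivity) (fun z hz => hxr ?_) hyT.2 x hxy⟩
      rw [mem_closedBall] at hz ⊢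
      linarith [dist_triangle z y x, dist_comm x y]
  have hlim : ∀ x ∈ V, ∃ y, Tendsto (fun n => P n x) atTop (𝓝 y) := fun x hx =>
    cauchy_map_iff_exists_tendsto.1 (hVT hx).2
  choose! g hg using hlim
  exact ⟨g, fun z hz => hasDerivAt_of_tendstoLocallyUniformlyOn hV (hloc.mono hVW)
    (Eventually.of_forall fun n x _ => hPd n x (mem_univ _)) hg hz⟩

/-! ### The Riemann mapping theorem -/

/-- Hurwitz: a nonconstant locally uniform limit of injective holomorphic functions is injective. -/
theorem injOn_of_tendstoLocallyUniformlyOn {ι : Type*} {l : Filter ι} [l.NeBot] {Ω : Set ℂ}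
    (ho : IsOpen Ω) (hc : IsPreconnected Ω) {F : ι → ℂ → ℂ} {f : ℂ → ℂ}
    (hF : ∀ n, DifferentiableOn ℂ (F n) Ω) (hi : ∀ n, InjOn (F n) Ω)
    (hlim : TendstoLocallyUniformlyOn F f l Ω) {z₀ : ℂ} (hz₀ : z₀ ∈ Ω) (hd : deriv f z₀ ≠ 0) :
    InjOn f Ω := by
  have hf : DifferentiableOn ℂ f Ω := hlim.differentiableOn (Eventually.of_forall hF) ho
  intro a ha b hb hab
  by_contra hne
  set g : ℂ → ℂ := fun z => f z - f b with hg
  have hgd : DifferentiableOn ℂ g Ω := hf.sub_const _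
  have hga : g a = 0 := sub_eq_zero.2 hab
  have hnz : ∀ᶠ z in 𝓝[≠] a, g z ≠ 0 := by
    rcases (hgd.analyticAt (ho.mem_nhds ha)).eventually_eq_zero_or_eventually_ne_zero with h | h
    · exfalso
      have h1 : EqOn g 0 Ω := (hgd.analyticOnNhd ho).eqOn_of_preconnected_of_eventuallyEq
        (analyticOnNhd_const) hc ha h
      refine hd ?_
      have h2 : f =ᶠ[𝓝 z₀] fun _ => f b := by
        filter_upwards [ho.mem_nhds hz₀] with w hw
        exact sub_eq_zero.1 (h1 hw)
      rw [h2.deriv_eq, deriv_const]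
    · exact h
  rw [eventually_nhdsWithin_iff] at hnz
  obtain ⟨s, hs, hsb⟩ := Metric.eventually_nhds_iff_ball.1 (hnz.and (ho.mem_nhds ha))
  set r : ℝ := min (s / 2) (dist a b / 2) with hr
  have hab0 : 0 < dist a b := dist_pos.2 hne
  have hr0 : 0 < r := lt_min (by positivity) (by positivity)
  have hrs : closedBall a r ⊆ ball a s := closedBall_subset_ball
    ((min_le_left _ _).trans_lt (by linarith))
  have hrΩ : closedBall a r ⊆ Ω := fun z hz => (hsb z (hrs hz)).2
  have hbr : b ∉ closedBall a r := by
    rw [mem_closedBall, dist_comm, not_le]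
    exact (min_le_right _ _).trans_lt (by linarith)
  have hsph : ∀ z ∈ sphere a r, g z ≠ 0 := fun z hz =>
    (hsb z (hrs (sphere_subset_closedBall hz))).1 (ne_of_mem_sphere hz hr0.ne')
  obtain ⟨p, hp, hpmin⟩ := (isCompact_sphere a r).exists_isMinOn
    (NormedSpace.sphere_nonempty.2 hr0.le)
    ((hgd.continuousOn.mono (sphere_subset_closedBall.trans hrΩ)).norm)
  set m : ℝ := ‖g p‖ with hm
  have hm0 : 0 < m := norm_pos_iff.2 (hsph p hp)
  have hmin : ∀ z ∈ sphere a r, m ≤ ‖g z‖ := fun z hz => hpmin hz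
  have hK : IsCompact (closedBall a r ∪ {b}) := (isCompact_closedBall a r).union isCompact_singleton
  have hu := (tendstoLocallyUniformlyOn_iff_forall_isCompact ho).1 hlim _
    (union_subset hrΩ (singleton_subset_iff.2 hb)) hK
  rw [Metric.tendstoUniformlyOn_iff] at hu
  obtain ⟨n, hn⟩ := (hu (m / 4) (by positivity)).exists
  set G : ℂ → ℂ := fun z => F n z - F n b with hG
  have hclose : ∀ z ∈ closedBall a r, ‖G z - g z‖ < m / 2 := by
    intro z hz
    have h1 := hn z (.inl hz)
    have h2 := hn b (.inr rfl)
    rw [dist_comm, dist_eq_norm] at h1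
    rw [dist_eq_norm] at h2
    have : G z - g z = (F n z - f z) + (f b - F n b) := by simp only [hG, hg]; ring
    rw [this]
    exact (norm_add_le _ _).trans_lt (by linarith)
  have hGne : ∀ z ∈ closedBall a r, G z ≠ 0 := fun z hz h0 =>
    hbr (hi n (hrΩ hz) hb (sub_eq_zero.1 h0) ▸ hz)
  have hGd : DifferentiableOn ℂ G Ω := (hF n).sub_const _
  -- `G` has no zeros in the closed ball, by injectivity of `F n`, and is at least `m / 2` on the
  -- circle. The maximum principle for `1 / G` then contradicts `‖G a‖ < m / 2`.
  have hbound : ‖(G a)⁻¹‖ ≤ (m / 2)⁻¹ := by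
    refine Complex.norm_le_of_forall_mem_frontier_norm_le (f := fun z => (G z)⁻¹)
      (U := ball a r) isBounded_ball ?_ ?_ (subset_closure (mem_ball_self hr0))
    · refine DifferentiableOn.diffContOnCl ?_
      rw [closure_ball _ hr0.ne']
      exact (hGd.mono hrΩ).inv hGne
    · intro z hz
      rw [frontier_ball _ hr0.ne'] at hz
      rw [norm_inv]
      refine inv_anti₀ (by positivity) ?_
      have h1 := hclose z (sphere_subset_closedBall hz)
      have h2 := hmin z hz
      have h3 := norm_sub_norm_le (g z) (G z)
      rw [norm_sub_rev (G z) (g z)] at h1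
      linarith
  have ha' : ‖G a‖ < m / 2 := by
    have := hclose a (mem_closedBall_self hr0.le)
    rwa [hga, sub_zero] at this
  have hGa : 0 < ‖G a‖ := norm_pos_iff.2 (hGne a (mem_closedBall_self hr0.le))
  rw [norm_inv] at hbound
  have := (inv_le_inv₀ hGa (by positivity)).1 hbound
  linarith

/-- Montel: along an ultrafilter, holomorphic functions with values in the disk converge locally
uniformly. -/
theorem exists_tendstoLocallyUniformlyOn_ultrafilter {ι : Type*} (l : Ultrafilter ι) {Ω : Set ℂ}
    (ho : IsOpen Ω) {F : ι → ℂ → ℂ} (hF : ∀ n, DifferentiableOn ℂ (F n) Ω)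
    (hb : ∀ n, MapsTo (F n) Ω unitDisk) :
    ∃ f : ℂ → ℂ, TendstoLocallyUniformlyOn F f l Ω := by
  have hpt : ∀ z ∈ Ω, ∃ y, Tendsto (fun n => F n z) l (𝓝 y) := by
    intro z hz
    obtain ⟨y, -, hy⟩ := (isCompact_closedBall (0 : ℂ) 1).ultrafilter_le_nhds
      (l.map fun n => F n z) (by
        rw [le_principal_iff, Ultrafilter.coe_map, mem_map]
        exact Eventually.of_forall fun n => mem_closedBall_zero_iff.2 (hb n hz).le)
    exact ⟨y, hy⟩
  choose! f hf using hpt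
  refine ⟨f, ?_⟩
  rw [Metric.tendstoLocallyUniformlyOn_iff]
  intro ε hε x hx
  obtain ⟨R, hR, hRΩ⟩ := Metric.isOpen_iff.1 ho x hx
  -- The Schwarz lemma gives a Lipschitz constant common to all `n`, so pointwise convergence along
  -- the ultrafilter is locally uniform.
  have hlip : ∀ n, ∀ z ∈ ball x R, dist (F n z) (F n x) ≤ 2 / R * dist z x := by
    intro n z hz
    refine Complex.dist_le_div_mul_dist_of_mapsTo_ball ((hF n).mono hRΩ) (fun w hw => ?_) hz
    rw [mem_closedBall, dist_eq_norm]
    refine (norm_sub_le _ _).trans ?_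
    have h1 : ‖F n w‖ < 1 := hb n (hRΩ hw)
    have h2 : ‖F n x‖ < 1 := hb n hx
    linarith
  have hlipf : ∀ z ∈ ball x R, dist (f z) (f x) ≤ 2 / R * dist z x := fun z hz =>
    le_of_tendsto ((hf z (hRΩ hz)).dist (hf x hx)) (Eventually.of_forall fun n => hlip n z hz)
  set s : ℝ := min R (ε * R / 8) with hs
  have hs0 : 0 < s := lt_min hR (by positivity)
  refine ⟨ball x s, mem_nhdsWithin_of_mem_nhds (ball_mem_nhds x hs0), ?_⟩
  filter_upwards [(Metric.tendsto_nhds.1 (hf x hx)) (ε / 4) (by positivity)] with n hn z hz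
  have hzR : z ∈ ball x R := ball_subset_ball (min_le_left _ _) hz
  have hzs : 2 / R * dist z x ≤ ε / 4 := by
    have h1 : dist z x ≤ ε * R / 8 := (le_of_lt hz).trans (min_le_right _ _)
    calc 2 / R * dist z x ≤ 2 / R * (ε * R / 8) := by gcongr
      _ = ε / 4 := by field_simp; norm_num
  have h1 := (hlip n z hzR).trans hzs
  have h2 := (hlipf z hzR).trans hzs
  calc dist (f z) (F n z) ≤ dist (f z) (f x) + dist (f x) (F n x) + dist (F n x) (F n z) :=
        dist_triangle4 _ _ _ _
    _ < ε := by rw [dist_comm (f x) (F n x), dist_comm (F n x) (F n z)]; linarith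

/-- The automorphism of the disk which moves `w` to zero. -/
noncomputable def diskShift (w ζ : ℂ) : ℂ := (ζ - w) / (1 - conj w * ζ)

theorem normSq_one_sub_conj_mul (w ζ : ℂ) :
    ‖1 - conj w * ζ‖ ^ 2 - ‖ζ - w‖ ^ 2 = (1 - ‖w‖ ^ 2) * (1 - ‖ζ‖ ^ 2) := by
  simp only [Complex.sq_norm, Complex.normSq_apply]
  simp
  ring

theorem one_sub_conj_mul_ne_zero {w ζ : ℂ} (hw : ‖w‖ < 1) (hζ : ‖ζ‖ < 1) :
    1 - conj w * ζ ≠ 0 := by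
  intro h
  have h1 : conj w * ζ = 1 := (sub_eq_zero.1 h).symm
  have h2 : ‖w‖ * ‖ζ‖ = 1 := by
    rw [← Complex.norm_conj w, ← norm_mul, h1, norm_one]
  nlinarith [norm_nonneg w, norm_nonneg ζ]

theorem norm_diskShift_lt_one {w ζ : ℂ} (hw : ‖w‖ < 1) (hζ : ‖ζ‖ < 1) : ‖diskShift w ζ‖ < 1 := by
  have h0 := one_sub_conj_mul_ne_zero hw hζ
  rw [diskShift, norm_div, div_lt_one (norm_pos_iff.2 h0)]
  have h1 := normSq_one_sub_conj_mul w ζ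
  have h2 : 0 < (1 - ‖w‖ ^ 2) * (1 - ‖ζ‖ ^ 2) := by
    have := norm_nonneg w; have := norm_nonneg ζ
    apply mul_pos <;> nlinarith
  exact lt_of_pow_lt_pow_left₀ 2 (norm_nonneg _) (by linarith)

theorem hasDerivAt_diskShift {w ζ : ℂ} (hw : ‖w‖ < 1) (hζ : ‖ζ‖ < 1) :
    HasDerivAt (diskShift w) ((1 - conj w * w) / (1 - conj w * ζ) ^ 2) ζ := by
  have h0 := one_sub_conj_mul_ne_zero hw hζ
  have h1 : HasDerivAt (fun z : ℂ => z - w) 1 ζ := (hasDerivAt_id ζ).sub_const w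
  have h2 : HasDerivAt (fun z : ℂ => 1 - conj w * z) (-(conj w * 1)) ζ :=
    ((hasDerivAt_id ζ).const_mul _).const_sub 1
  refine (h1.div h2 h0).congr_deriv ?_
  congr 1; ring

theorem injOn_diskShift {w : ℂ} (hw : ‖w‖ < 1) : InjOn (diskShift w) unitDisk := by
  intro a ha b hb hab
  have h0 := one_sub_conj_mul_ne_zero hw ha
  have h1 := one_sub_conj_mul_ne_zero hw hb
  rw [diskShift, diskShift, div_eq_div_iff h0 h1] at hab
  have h2 : (1 - conj w * w) * (a - b) = 0 := by linear_combination hab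
  rcases mul_eq_zero.1 h2 with h | h
  · exact absurd h (one_sub_conj_mul_ne_zero hw hw)
  · exact sub_eq_zero.1 h

/-- Koebe's square root trick. -/
theorem exists_norm_deriv_lt {Ω : Set ℂ} (ho : IsOpen Ω) (hc : IsPreconnected Ω)
    (hex : ∀ h : ℂ → ℂ, DifferentiableOn ℂ h Ω → Complex.IsExactOn h Ω) {f : ℂ → ℂ}
    (hf : DifferentiableOn ℂ f Ω) (hi : InjOn f Ω) (hm : MapsTo f Ω unitDisk) {z₀ : ℂ}
    (hz₀ : z₀ ∈ Ω) (hf0 : f z₀ = 0) (hd : deriv f z₀ ≠ 0) {w : ℂ} (hw : w ∈ unitDisk)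
    (hwf : w ∉ f '' Ω) :
    ∃ F : ℂ → ℂ, DifferentiableOn ℂ F Ω ∧ InjOn F Ω ∧ MapsTo F Ω unitDisk ∧ F z₀ = 0 ∧
      ‖deriv f z₀‖ < ‖deriv F z₀‖ := by
  -- The omitted value is moved to zero, so a holomorphic square root exists; it is again injective
  -- with values in the disk.
  set q : ℂ → ℂ := fun z => diskShift w (f z) with hq
  have hqd' : ∀ z ∈ Ω, HasDerivAt q ((1 - conj w * w) / (1 - conj w * f z) ^ 2 * deriv f z) z :=
    fun z hz => (hasDerivAt_diskShift hw (hm hz)).comp z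
      (hf.differentiableAt (ho.mem_nhds hz)).hasDerivAt
  have hqd : DifferentiableOn ℂ q Ω := fun z hz =>
    (hqd' z hz).differentiableAt.differentiableWithinAt
  have hq0 : ∀ z ∈ Ω, q z ≠ 0 := by
    intro z hz h0
    rcases div_eq_zero_iff.1 (show (f z - w) / (1 - conj w * f z) = 0 from h0) with h | h
    · exact hwf ⟨z, hz, sub_eq_zero.1 h⟩
    · exact one_sub_conj_mul_ne_zero hw (hm hz) h
  obtain ⟨l, hl, hle⟩ := exists_log_of_isExactOn ho hc hqd hq0
    (hex _ ((hqd.deriv ho).div hqd hq0))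
  set p : ℂ → ℂ := fun z => Complex.exp (l z / 2) with hp
  have hpd : DifferentiableOn ℂ p Ω := (hl.div_const 2).cexp
  have hp2 : ∀ z ∈ Ω, p z ^ 2 = q z := fun z hz => by
    rw [← hle z hz, hp, ← Complex.exp_nat_mul]; congr 1; push_cast; ring
  have hpm : MapsTo p Ω unitDisk := by
    intro z hz
    have h1 : ‖q z‖ < 1 := norm_diskShift_lt_one hw (hm hz)
    rw [← hp2 z hz, norm_pow] at h1
    exact (pow_lt_one_iff_of_nonneg (norm_nonneg _) two_ne_zero).1 h1
  have hpi : InjOn p Ω := by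
    intro a ha b hb hab
    have h1 : q a = q b := by rw [← hp2 a ha, ← hp2 b hb, hab]
    exact hi ha hb (injOn_diskShift hw (hm ha) (hm hb) h1)
  have hpz : ‖p z₀‖ < 1 := hpm hz₀
  refine ⟨fun z => diskShift (p z₀) (p z), ?_, ?_, ?_, ?_, ?_⟩
  · exact fun z hz => ((hasDerivAt_diskShift hpz (hpm hz)).differentiableAt.comp z
      (hpd.differentiableAt (ho.mem_nhds hz))).differentiableWithinAt
  · exact (injOn_diskShift hpz).comp hpi hpm
  · exact fun z hz => norm_diskShift_lt_one hpz (hpm hz)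
  · simp [diskShift]
  · have hpz' : HasDerivAt p (deriv p z₀) z₀ :=
      (hpd.differentiableAt (ho.mem_nhds hz₀)).hasDerivAt
    have hFd := ((hasDerivAt_diskShift hpz hpz).comp z₀ hpz').deriv
    have hsq : HasDerivAt (fun z => p z ^ 2) (2 * p z₀ * deriv p z₀) z₀ := by
      simpa using hpz'.fun_pow 2
    have hqe : (fun z => p z ^ 2) =ᶠ[𝓝 z₀] q := by
      filter_upwards [ho.mem_nhds hz₀] with z hz using hp2 z hz
    have hkey : 2 * p z₀ * deriv p z₀ = (1 - conj w * w) * deriv f z₀ := by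
      have h1 := (hqd' z₀ hz₀).unique (hsq.congr_of_eventuallyEq hqe.symm)
      rw [← h1, hf0]; simp
    have hcw : ∀ v : ℂ, ‖v‖ < 1 → ‖1 - conj v * v‖ = 1 - ‖v‖ ^ 2 := by
      intro v hv
      rw [mul_comm, Complex.mul_conj, Complex.normSq_eq_norm_sq]
      rw [← Complex.ofReal_one, ← Complex.ofReal_sub, Complex.norm_real, Real.norm_eq_abs,
        abs_of_pos]
      nlinarith [norm_nonneg v]
    set t : ℝ := ‖p z₀‖ with ht
    have htw : t ^ 2 = ‖w‖ := by
      have h1 := hp2 z₀ hz₀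
      rw [ht, ← norm_pow, h1, hq]
      simp [hf0, diskShift]
    have ht0 : 0 < t := norm_pos_iff.2 (Complex.exp_ne_zero _)
    have hn := congrArg norm hkey
    rw [norm_mul, norm_mul, norm_mul, hcw w hw, ← htw, ← ht, Complex.norm_two] at hn
    -- With `t = |p z₀| = |w|^(1/2) < 1`, the gain factor `(1 + t²) / (2t)` exceeds one.
    have hF : ‖deriv (fun z => diskShift (p z₀) (p z)) z₀‖ = (1 + t ^ 2) / (2 * t) * ‖deriv f z₀‖ := by
      have : deriv (fun z => diskShift (p z₀) (p z)) z₀ = _ := hFd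
      rw [this, norm_mul, norm_div, norm_pow, hcw _ hpz, ← ht]
      have h1 : 0 < 1 - t ^ 2 := by nlinarith
      field_simp
      nlinarith
    rw [hF]
    have hd0 : 0 < ‖deriv f z₀‖ := norm_pos_iff.2 hd
    refine lt_mul_of_one_lt_left hd0 ?_
    rw [lt_div_iff₀ (by positivity)]
    nlinarith [sq_pos_of_pos (sub_pos.2 hpz)]

/-- The Riemann mapping theorem for bounded domains on which holomorphic functions have
primitives. -/
theorem exists_mapsConformallyOnto_unitDisk {Ω : Set ℂ} (ho : IsOpen Ω) (hc : IsPreconnected Ω)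
    (hne : Ω.Nonempty) (hb : Bornology.IsBounded Ω)
    (hex : ∀ h : ℂ → ℂ, DifferentiableOn ℂ h Ω → Complex.IsExactOn h Ω) :
    ∃ φ : ℂ → ℂ, MapsConformallyOnto φ Ω unitDisk := by
  obtain ⟨z₀, hz₀⟩ := hne
  set Fam : Set (ℂ → ℂ) := {F | DifferentiableOn ℂ F Ω ∧ InjOn F Ω ∧ MapsTo F Ω unitDisk ∧ F z₀ = 0}
    with hFam
  set S : Set ℝ := (fun F : ℂ → ℂ => ‖deriv F z₀‖) '' Fam with hS
  obtain ⟨R, hR, hRb⟩ := hb.subset_ball_lt 0 z₀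
  have hF₀ : (fun z => (z - z₀) / (R : ℂ)) ∈ Fam := by
    have hRc : (R : ℂ) ≠ 0 := Complex.ofReal_ne_zero.2 hR.ne'
    refine ⟨by fun_prop, ?_, ?_, by simp⟩
    · intro a _ b _ hab
      simpa [hRc] using hab
    · intro z hz
      have := hRb hz
      rw [mem_ball, dist_eq_norm] at this
      change ‖(z - z₀) / (R : ℂ)‖ < 1
      rwa [norm_div, Complex.norm_real, Real.norm_of_nonneg hR.le, div_lt_one hR]
  have hS0 : R⁻¹ ∈ S := by
    refine ⟨_, hF₀, ?_⟩
    have : HasDerivAt (fun z => (z - z₀) / (R : ℂ)) (1 / R) z₀ :=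
      ((hasDerivAt_id z₀).sub_const z₀).div_const _
    beta_reduce
    rw [this.deriv]
    simp [abs_of_pos hR]
  obtain ⟨ρ, hρ, hρΩ⟩ := Metric.isOpen_iff.1 ho z₀ hz₀
  have hSb : BddAbove S := by
    refine ⟨1 / ρ, ?_⟩
    rintro _ ⟨F, hF, rfl⟩
    refine Complex.norm_deriv_le_div_of_mapsTo_ball (hF.1.mono hρΩ) (fun z hz => ?_) hρ
    rw [hF.2.2.2, mem_closedBall_zero_iff]
    exact (hF.2.2.1 (hρΩ hz)).le
  obtain ⟨u, -, hu, huS⟩ := exists_seq_tendsto_sSup ⟨_, hS0⟩ hSb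
  choose F hF hFu using huS
  obtain ⟨f, hf⟩ := exists_tendstoLocallyUniformlyOn_ultrafilter (hyperfilter ℕ) ho
    (fun n => (hF n).1) (fun n => (hF n).2.2.1)
  have hfd : DifferentiableOn ℂ f Ω := hf.differentiableOn (Eventually.of_forall fun n => (hF n).1) ho
  -- The limit maximizes the derivative at `z₀`. Its positive derivative makes it injective by
  -- Hurwitz, and a value omitted in the disk would contradict maximality by Koebe's trick.
  have hder : ‖deriv f z₀‖ = sSup S := by
    have h1 := ((hf.deriv (Eventually.of_forall fun n => (hF n).1) ho).tendsto_at hz₀).norm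
    have h2 : Tendsto u (hyperfilter ℕ) (𝓝 (sSup S)) := hu.mono_left Nat.hyperfilter_le_atTop
    refine tendsto_nhds_unique h1 (h2.congr fun n => ?_)
    exact (hFu n).symm
  have hpos : 0 < sSup S := (inv_pos.2 hR).trans_le (le_csSup hSb hS0)
  have hd0 : deriv f z₀ ≠ 0 := by
    rw [← norm_pos_iff, hder]; exact hpos
  have hinj : InjOn f Ω := injOn_of_tendstoLocallyUniformlyOn ho hc (fun n => (hF n).1)
    (fun n => (hF n).2.1) hf hz₀ hd0
  have hf0 : f z₀ = 0 := by
    refine tendsto_nhds_unique (hf.tendsto_at hz₀) ?_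
    simp only [(hF _).2.2.2]
    exact tendsto_const_nhds
  have hmap : MapsTo f Ω unitDisk := by
    have hcl : f '' Ω ⊆ closedBall 0 1 := by
      rintro _ ⟨z, hz, rfl⟩
      refine isClosed_closedBall.mem_of_tendsto (hf.tendsto_at hz) (Eventually.of_forall fun n => ?_)
      rw [mem_closedBall_zero_iff]; exact ((hF n).2.2.1 hz).le
    have h1 := interior_maximal hcl (isOpen_image_of_injOn ho hfd hinj)
    rw [interior_closedBall _ one_ne_zero, ← unitDisk_eq_ball] at h1
    exact fun z hz => h1 (mem_image_of_mem f hz)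
  refine ⟨f, hfd, hmap, hinj, fun w hw => ?_⟩
  by_contra hwf
  obtain ⟨F', h1, h2, h3, h4, h5⟩ := exists_norm_deriv_lt ho hc hex hfd hinj hmap hz₀ hf0 hd0 hw hwf
  have := le_csSup hSb ⟨F', ⟨h1, h2, h3, h4⟩, rfl⟩
  rw [hder] at h5
  exact absurd h5 (not_lt.2 this)

/-! ### Möbius maps, disk charts and the Cayley transform -/

/-- The fractional linear map `z ↦ (a z + b) / (c z + d)`. -/
noncomputable def moebius (a b c d z : ℂ) : ℂ := (a * z + b) / (c * z + d)

theorem hasDerivAt_moebius {a b c d z : ℂ} (h : c * z + d ≠ 0) :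
    HasDerivAt (moebius a b c d) ((a * d - b * c) / (c * z + d) ^ 2) z := by
  have h1 : HasDerivAt (fun z : ℂ => a * z + b) (a * 1) z :=
    ((hasDerivAt_id z).const_mul a).add_const b
  have h2 : HasDerivAt (fun z : ℂ => c * z + d) (c * 1) z :=
    ((hasDerivAt_id z).const_mul c).add_const d
  refine (h1.div h2 h).congr_deriv ?_
  congr 1; ring

/-- `N` maps the disk conformally onto `D`, with boundary values `e₁`, `e₂` at `a₁`, `a₂`, and its
derivatives there are related to these as for a fractional linear map. -/
def IsDiskChart (N : ℂ → ℂ) (D : Set ℂ) (a₁ a₂ e₁ e₂ : ℂ) : Prop :=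
  MapsConformallyOnto N unitDisk D ∧ N a₁ = e₁ ∧ N a₂ = e₂ ∧ ∃ n₁ n₂ : ℂ,
    HasDerivAt N n₁ a₁ ∧ HasDerivAt N n₂ a₂ ∧ ‖e₁ - e₂‖ ^ 2 = ‖n₁ * n₂‖ * ‖a₁ - a₂‖ ^ 2

theorem IsDiskChart.comp {M N : ℂ → ℂ} {D : Set ℂ} {a₁ a₂ b₁ b₂ e₁ e₂ : ℂ}
    (hN : IsDiskChart N D b₁ b₂ e₁ e₂) (hM : IsDiskChart M unitDisk a₁ a₂ b₁ b₂) :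
    IsDiskChart (N ∘ M) D a₁ a₂ e₁ e₂ := by
  obtain ⟨hN, hN1, hN2, n₁, n₂, hn₁, hn₂, hn⟩ := hN
  obtain ⟨hM, hM1, hM2, m₁, m₂, hm₁, hm₂, hm⟩ := hM
  subst hM1 hM2
  refine ⟨hN.comp hM, hN1, hN2, _, _, hn₁.comp _ hm₁, hn₂.comp _ hm₂, ?_⟩
  rw [hn, hm]; simp only [norm_mul]; ring

/-- The difference of the values is `(ad - bc)(a₁ - a₂) / ((c a₁ + d)(c a₂ + d))`, and its square is
the product of the two derivatives times `(a₁ - a₂)²`. -/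
theorem isDiskChart_moebius {a b c d : ℂ} {D : Set ℂ} {a₁ a₂ e₁ e₂ : ℂ}
    (hm : MapsConformallyOnto (moebius a b c d) unitDisk D) (h₁ : c * a₁ + d ≠ 0)
    (h₂ : c * a₂ + d ≠ 0) (he₁ : moebius a b c d a₁ = e₁) (he₂ : moebius a b c d a₂ = e₂) :
    IsDiskChart (moebius a b c d) D a₁ a₂ e₁ e₂ := by
  refine ⟨hm, he₁, he₂, _, _, hasDerivAt_moebius h₁, hasDerivAt_moebius h₂, ?_⟩
  have : e₁ - e₂ = (a * d - b * c) * (a₁ - a₂) / ((c * a₁ + d) * (c * a₂ + d)) := by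
    rw [← he₁, ← he₂, moebius, moebius, div_sub_div _ _ h₁ h₂]
    congr 1; ring
  rw [this]
  simp only [norm_div, norm_mul, norm_pow]
  have h₁' := norm_ne_zero_iff.2 h₁
  have h₂' := norm_ne_zero_iff.2 h₂
  field_simp

theorem mapsConformallyOnto_moebius {a b c d a' b' c' d' : ℂ} {D' D : Set ℂ}
    (h : MapsTo (moebius a b c d) D' D) (h' : MapsTo (moebius a' b' c' d') D D')
    (hd : ∀ z ∈ D', c * z + d ≠ 0)
    (hl : ∀ z ∈ D', moebius a' b' c' d' (moebius a b c d z) = z)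
    (hr : ∀ z ∈ D, moebius a b c d (moebius a' b' c' d' z) = z) :
    MapsConformallyOnto (moebius a b c d) D' D :=
  ⟨fun z hz => (hasDerivAt_moebius (hd z hz)).differentiableAt.differentiableWithinAt,
    (show InvOn (moebius a' b' c' d') (moebius a b c d) D' D from ⟨hl, hr⟩).bijOn h h'⟩

theorem isDiskChart_rotation {c : ℂ} (hc : ‖c‖ = 1) (a₁ a₂ : ℂ) :
    IsDiskChart (fun z => c * z) unitDisk a₁ a₂ (c * a₁) (c * a₂) := by
  have hc0 : c ≠ 0 := by rintro rfl; simp at hc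
  refine ⟨⟨by fun_prop, ?_⟩, rfl, rfl, c, c, ?_, ?_, ?_⟩
  · refine (show InvOn (fun z => c⁻¹ * z) (fun z => c * z) unitDisk unitDisk from
      ⟨fun z _ => ?_, fun z _ => ?_⟩).bijOn (fun z hz => ?_) (fun z hz => ?_)
    · simp [hc0]
    · simp [hc0]
    · simpa [unitDisk, hc] using hz
    · simpa [unitDisk, hc] using hz
  · simpa using (hasDerivAt_id a₁).const_mul c
  · simpa using (hasDerivAt_id a₂).const_mul c
  · rw [← mul_sub]; simp [hc]

/-- On the unit circle conjugation is inversion, under which `i (1 + a) / (1 - a)` is invariant; so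
this number is real. The product form avoids the division. -/
theorem exists_real_cayley {a : ℂ} (ha : ‖a‖ = 1) (ha1 : a ≠ 1) :
    ∃ t : ℝ, (t : ℂ) * (1 - a) = Complex.I * (1 + a) := by
  have h1 : 1 - a ≠ 0 := sub_ne_zero.2 ha1.symm
  have ha0 : a ≠ 0 := by rintro rfl; simp at ha
  have hconj : conj a = a⁻¹ := by
    rw [Complex.inv_def, Complex.normSq_eq_norm_sq, ha]; simp
  have : conj (Complex.I * (1 + a) / (1 - a)) = Complex.I * (1 + a) / (1 - a) := by
    rw [map_div₀, map_mul, map_add, map_sub, hconj, Complex.conj_I, map_one]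
    have h2 : 1 - a⁻¹ ≠ 0 := by
      intro h
      apply ha1
      have := sub_eq_zero.1 h
      rw [eq_comm, inv_eq_one] at this
      exact this
    rw [div_eq_div_iff h2 h1]
    field_simp
    ring
  obtain ⟨t, ht⟩ := Complex.conj_eq_iff_real.1 this
  exact ⟨t, by rw [← ht, div_mul_cancel₀ _ h1]⟩

/-- The matrix with entries `2i - t`, `t`, `-t`, `2i + t` is the translation by `t` of the
half-plane, conjugated by the Cayley transform. It fixes the point 1, which corresponds to infinity,
and its inverse is the same matrix for `-t`. -/
theorem shift_normSq (t : ℝ) (z : ℂ) :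
    Complex.normSq ((2 * Complex.I - t) * z + t) - Complex.normSq (-t * z + (2 * Complex.I + t)) =
      4 * (Complex.normSq z - 1) := by
  simp [Complex.normSq_apply]
  ring

theorem shift_den_ne_zero (t : ℝ) {z : ℂ} (hz : ‖z‖ ≤ 1) :
    -(t : ℂ) * z + (2 * Complex.I + t) ≠ 0 := by
  intro h
  have h1 := shift_normSq t z
  rw [h, map_zero, sub_zero, Complex.normSq_eq_norm_sq z] at h1
  have h2 : Complex.normSq ((2 * Complex.I - t) * z + t) = 0 := by
    refine le_antisymm ?_ (Complex.normSq_nonneg _)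
    nlinarith [norm_nonneg z]
  rw [Complex.normSq_eq_zero] at h2
  have h3 : (4 : ℂ) = 0 := by
    linear_combination -(t : ℂ) * h2 - (2 * Complex.I - t) * h + 4 * Complex.I_sq
  norm_num at h3

theorem shift_shift (t : ℝ) {z : ℂ} (hz : ‖z‖ < 1) :
    moebius (2 * Complex.I - (-t : ℝ)) ((-t : ℝ)) (-(-t : ℝ)) (2 * Complex.I + (-t : ℝ))
      (moebius (2 * Complex.I - t) t (-t) (2 * Complex.I + t) z) = z := by
  have h1 := shift_den_ne_zero t hz.le
  have hden : (t : ℂ) * ((2 * Complex.I - t) * z + t) +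
      (2 * Complex.I - t) * (-(t : ℂ) * z + (2 * Complex.I + t)) = -4 := by
    linear_combination 4 * Complex.I_sq
  have hnum : (2 * Complex.I + t) * ((2 * Complex.I - t) * z + t) -
      t * (-(t : ℂ) * z + (2 * Complex.I + t)) = -4 * z := by
    linear_combination 4 * z * Complex.I_sq
  rw [moebius, moebius]
  push_cast
  rw [sub_neg_eq_add, neg_neg, ← sub_eq_add_neg (2 * Complex.I)]
  have e1 : (2 * Complex.I + t) * (((2 * Complex.I - t) * z + t) / (-(t : ℂ) * z + (2 * Complex.I + t)))
      + -(t : ℂ) = -4 * z / (-(t : ℂ) * z + (2 * Complex.I + t)) := by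
    rw [← hnum, mul_div_assoc', div_add' _ _ _ h1]; congr 1; ring
  have e2 : (t : ℂ) * (((2 * Complex.I - t) * z + t) / (-(t : ℂ) * z + (2 * Complex.I + t)))
      + (2 * Complex.I - t) = -4 / (-(t : ℂ) * z + (2 * Complex.I + t)) := by
    rw [← hden, mul_div_assoc', div_add' _ _ _ h1]
  rw [e1, e2, div_div_div_cancel_right₀ h1]
  norm_num

theorem mapsTo_shift (t : ℝ) :
    MapsTo (moebius (2 * Complex.I - t) t (-t) (2 * Complex.I + t)) unitDisk unitDisk := by
  intro z hz
  have hz' : ‖z‖ < 1 := hz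
  have h1 := shift_den_ne_zero t hz'.le
  change ‖moebius _ _ _ _ z‖ < 1
  rw [moebius, norm_div, div_lt_one (norm_pos_iff.2 h1)]
  have h2 := shift_normSq t z
  simp only [Complex.normSq_eq_norm_sq] at h2
  refine lt_of_pow_lt_pow_left₀ 2 (norm_nonneg _) ?_
  nlinarith [norm_nonneg z]

theorem isDiskChart_shift (t : ℝ) {a : ℂ} (ha : ‖a‖ = 1) :
    IsDiskChart (moebius (2 * Complex.I - t) t (-t) (2 * Complex.I + t)) unitDisk 1 a 1
      (moebius (2 * Complex.I - t) t (-t) (2 * Complex.I + t) a) := by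
  refine isDiskChart_moebius (mapsConformallyOnto_moebius (mapsTo_shift t) (mapsTo_shift (-t))
    ?_ ?_ ?_) (shift_den_ne_zero t (by simp)) (shift_den_ne_zero t ha.le) ?_ rfl
  · exact fun z hz => shift_den_ne_zero t (le_of_lt hz)
  · exact fun z hz => shift_shift t hz
  · intro z hz
    have := shift_shift (-t) hz
    simpa using this
  · rw [moebius]
    rw [mul_one, mul_one, sub_add_cancel]
    have : -(t : ℂ) + (2 * Complex.I + t) = 2 * Complex.I := by ring
    rw [this, div_self (by simp)]

/-- The automorphisms of the disk act transitively on pairs of boundary points. -/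
theorem exists_isDiskChart_unitDisk {a₁ a₂ b₁ b₂ : ℂ} (ha₁ : ‖a₁‖ = 1) (ha₂ : ‖a₂‖ = 1)
    (ha : a₁ ≠ a₂) (hb₁ : ‖b₁‖ = 1) (hb₂ : ‖b₂‖ = 1) (hb : b₁ ≠ b₂) :
    ∃ M, IsDiskChart M unitDisk a₁ a₂ b₁ b₂ := by
  have ha0 : a₁ ≠ 0 := by rintro rfl; simp at ha₁
  have hb0 : b₁ ≠ 0 := by rintro rfl; simp at hb₁
  set a := a₁⁻¹ * a₂ with hadef
  set b := b₁⁻¹ * b₂ with hbdef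
  have hna : ‖a‖ = 1 := by simp [hadef, ha₁, ha₂]
  have hnb : ‖b‖ = 1 := by simp [hbdef, hb₁, hb₂]
  have ha1 : a ≠ 1 := fun h => ha (by rw [hadef, inv_mul_eq_one₀ ha0] at h; exact h)
  have hb1 : b ≠ 1 := fun h => hb (by rw [hbdef, inv_mul_eq_one₀ hb0] at h; exact h)
  obtain ⟨s, hs⟩ := exists_real_cayley hna ha1
  obtain ⟨r, hr⟩ := exists_real_cayley hnb hb1
  -- After rotating both first points to 1, the remaining points have real Cayley coordinates `s`
  -- and `r`, and the translation by `r - s` matches them.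
  have hT := isDiskChart_shift (r - s) hna
  have hTa : moebius (2 * Complex.I - (r - s : ℝ)) (r - s : ℝ) (-(r - s : ℝ))
      (2 * Complex.I + (r - s : ℝ)) a = b := by
    rw [moebius, div_eq_iff (shift_den_ne_zero _ hna.le)]
    push_cast
    linear_combination (1 - a) * hr - (1 - b) * hs
  rw [hTa] at hT
  have h1 := isDiskChart_rotation (c := a₁⁻¹) (by simp [ha₁]) a₁ a₂
  rw [inv_mul_cancel₀ ha0, ← hadef] at h1
  have h2 := isDiskChart_rotation hb₁ 1 b
  rw [mul_one, hbdef, mul_inv_cancel_left₀ hb0] at h2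
  exact ⟨_, h2.comp (hT.comp h1)⟩

/-- The Cayley transform, which maps the disk onto the upper half-plane. -/
noncomputable def cayley : ℂ → ℂ := moebius Complex.I Complex.I (-1) 1

theorem cayley_apply (w : ℂ) : cayley w = Complex.I * (1 + w) / (1 - w) := by
  rw [cayley, moebius]; congr 1 <;> ring

/-- The inverse of the Cayley transform. -/
noncomputable def cayleyInv : ℂ → ℂ := moebius 1 (-Complex.I) 1 Complex.I

theorem cayley_im (w : ℂ) : (cayley w).im = (1 - Complex.normSq w) / Complex.normSq (1 - w) := by
  rw [cayley_apply, Complex.div_im]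
  simp [Complex.normSq_apply]
  rw [← sub_div]
  congr 1; ring

theorem mapsTo_cayley : MapsTo cayley unitDisk upperHalf := by
  intro w hw
  have hw' : ‖w‖ < 1 := hw
  have h1 : w ≠ 1 := by rintro rfl; simp at hw'
  change 0 < (cayley w).im
  rw [cayley_im]
  refine div_pos ?_ (Complex.normSq_pos.2 (sub_ne_zero.2 h1.symm))
  rw [Complex.normSq_eq_norm_sq]
  nlinarith [norm_nonneg w]

theorem add_I_ne_zero {ζ : ℂ} (h : 0 ≤ ζ.im) : ζ + Complex.I ≠ 0 := by
  intro h0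
  have := congrArg Complex.im h0
  simp at this
  linarith

theorem cayleyInv_apply (ζ : ℂ) : cayleyInv ζ = (ζ - Complex.I) / (ζ + Complex.I) := by
  rw [cayleyInv, moebius]; congr 1 <;> ring

theorem norm_cayleyInv_lt_one {ζ : ℂ} (h : 0 < ζ.im) : ‖cayleyInv ζ‖ < 1 := by
  rw [cayleyInv_apply, norm_div, div_lt_one (norm_pos_iff.2 (add_I_ne_zero h.le))]
  refine lt_of_pow_lt_pow_left₀ 2 (norm_nonneg _) ?_
  simp only [Complex.sq_norm, Complex.normSq_apply]
  simp
  nlinarith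

theorem cayleyInv_cayley {w : ℂ} (hw : w ≠ 1) : cayleyInv (cayley w) = w := by
  have h1 : 1 - w ≠ 0 := sub_ne_zero.2 hw.symm
  have h2 : Complex.I * (1 + w) / (1 - w) - Complex.I = 2 * Complex.I * w / (1 - w) := by
    field_simp; ring
  have h3 : Complex.I * (1 + w) / (1 - w) + Complex.I = 2 * Complex.I / (1 - w) := by
    field_simp; ring
  rw [cayley_apply, cayleyInv_apply, h2, h3, div_div_div_cancel_right₀ h1]
  have := Complex.I_ne_zero
  field_simp

theorem cayley_cayleyInv {ζ : ℂ} (hζ : ζ + Complex.I ≠ 0) : cayley (cayleyInv ζ) = ζ := by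
  have h2 : 1 + (ζ - Complex.I) / (ζ + Complex.I) = 2 * ζ / (ζ + Complex.I) := by
    field_simp; ring
  have h3 : 1 - (ζ - Complex.I) / (ζ + Complex.I) = 2 * Complex.I / (ζ + Complex.I) := by
    field_simp; ring
  rw [cayleyInv_apply, cayley_apply, h2, h3]
  have := Complex.I_ne_zero
  field_simp

theorem mapsConformallyOnto_cayley : MapsConformallyOnto cayley unitDisk upperHalf := by
  have hne : ∀ w ∈ unitDisk, w ≠ 1 := by
    rintro w hw rfl
    simp [unitDisk] at hw
  refine mapsConformallyOnto_moebius (a' := 1) (b' := -Complex.I) (c' := 1) (d' := Complex.I)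
    mapsTo_cayley (fun ζ hζ => norm_cayleyInv_lt_one hζ) (fun w hw => ?_)
    (fun w hw => cayleyInv_cayley (hne w hw)) (fun ζ hζ => cayley_cayleyInv (add_I_ne_zero (le_of_lt hζ)))
  rw [neg_one_mul, neg_add_eq_sub]
  exact sub_ne_zero.2 (hne w hw).symm

theorem exists_isDiskChart_upperHalf {a₁ a₂ b₁ b₂ : ℂ} (ha₁ : ‖a₁‖ = 1) (ha₂ : ‖a₂‖ = 1)
    (ha : a₁ ≠ a₂) (hb₁ : ‖b₁‖ = 1) (hb₂ : ‖b₂‖ = 1) (hb : b₁ ≠ b₂) (h₁ : b₁ ≠ 1) (h₂ : b₂ ≠ 1) :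
    ∃ M, IsDiskChart M upperHalf a₁ a₂ (cayley b₁) (cayley b₂) := by
  obtain ⟨M, hM⟩ := exists_isDiskChart_unitDisk ha₁ ha₂ ha hb₁ hb₂ hb
  refine ⟨_, (isDiskChart_moebius (a₁ := b₁) (a₂ := b₂) mapsConformallyOnto_cayley ?_ ?_ rfl rfl).comp hM⟩
  · rw [neg_one_mul, neg_add_eq_sub]; exact sub_ne_zero.2 h₁.symm
  · rw [neg_one_mul, neg_add_eq_sub]; exact sub_ne_zero.2 h₂.symm

/-! ### Boundary behaviour of the slit map -/

theorem isPreconnected_polar {I : Set ℝ} (hI : IsPreconnected I) (h0 : ∀ r ∈ I, 0 ≤ r) :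
    IsPreconnected {z : ℂ | ‖z‖ ∈ I} := by
  have h := (hI.prod (isPreconnected_univ (α := ℝ))).image
    (fun p : ℝ × ℝ => (p.1 : ℂ) * Complex.exp (p.2 * Complex.I)) (by fun_prop)
  refine (congrArg IsPreconnected ?_).mp h
  ext z
  simp only [mem_image, mem_prod, mem_univ, and_true, Prod.exists, mem_ofPred_eq]
  constructor
  · rintro ⟨r, θ, hr, rfl⟩
    rwa [norm_mul, Complex.norm_exp_ofReal_mul_I, mul_one, Complex.norm_real,
      Real.norm_of_nonneg (h0 r hr)]
  · exact fun hz => ⟨‖z‖, z.arg, hz, Complex.norm_mul_exp_arg_mul_I z⟩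

theorem isOpen_annulus (q : ℝ) : IsOpen (annulus q) :=
  (isOpen_lt continuous_const continuous_norm).inter (isOpen_lt continuous_norm continuous_const)

theorem isPreconnected_annulus {q : ℝ} (hq : 0 ≤ q) : IsPreconnected (annulus q) :=
  isPreconnected_polar (I := Ioo q 1) isPreconnected_Ioo fun _ hr => hq.trans hr.1.le

theorem isPreconnected_compl_unitDisk : IsPreconnected unitDiskᶜ := by
  have := isPreconnected_polar (I := Ici 1) isPreconnected_Ici fun _ hr => zero_le_one.trans hr
  refine (congrArg IsPreconnected ?_).mp this
  ext z; simp [unitDisk]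

theorem isCompact_realSlit (L : ℝ) : IsCompact (realSlit L) :=
  isCompact_Icc.image Complex.continuous_ofReal

theorem norm_le_of_mem_realSlit {L : ℝ} {w : ℂ} (hw : w ∈ realSlit L) : ‖w‖ ≤ L := by
  obtain ⟨t, ht, rfl⟩ := hw
  simpa [abs_le] using ht

theorem isOpen_unitDisk_diff_realSlit (L : ℝ) : IsOpen (unitDisk \ realSlit L) :=
  isOpen_unitDisk.sdiff (isCompact_realSlit L).isClosed

/-- The annulus together with its outer boundary circle. -/
def outerAnnulus (q : ℝ) : Set ℂ := {z : ℂ | q < ‖z‖ ∧ ‖z‖ ≤ 1}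

/-- `f` maps the annulus conformally onto the slit disk and extends continuously to the unit
circle, with `f 1 = 1`. -/
structure IsSlitMap (q L : ℝ) (f : ℂ → ℂ) : Prop where
  q_nonneg : 0 ≤ q
  q_lt : q < 1
  L_nonneg : 0 ≤ L
  L_lt : L < 1
  conformal : MapsConformallyOnto f (annulus q) (unitDisk \ realSlit L)
  continuousOn : ContinuousOn f (outerAnnulus q)
  map_one : f 1 = 1

namespace IsSlitMap

variable {q L : ℝ} {f : ℂ → ℂ}

theorem annulus_subset (q : ℝ) : annulus q ⊆ outerAnnulus q := fun _ h => ⟨h.1, h.2.le⟩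

theorem neBot_nhdsWithin_annulus (hq : q < 1) {a : ℂ} (ha : ‖a‖ = 1) :
    (𝓝[annulus q] a).NeBot := by
  have h1 : Tendsto (fun r : ℝ => (r : ℂ) * a) (𝓝[<] 1) (𝓝[annulus q] a) := by
    refine tendsto_nhdsWithin_iff.2 ⟨?_, ?_⟩
    · have : ContinuousAt (fun r : ℝ => (r : ℂ) * a) 1 := by fun_prop
      simpa [ContinuousAt] using this.tendsto.mono_left nhdsWithin_le_nhds
    · filter_upwards [Ioo_mem_nhdsLT (show max q 0 < 1 from max_lt hq one_pos)] with r hr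
      have hr0 := (le_max_right q 0).trans_lt hr.1
      have : ‖(r : ℂ) * a‖ = r := by
        rw [norm_mul, ha, mul_one, Complex.norm_real, Real.norm_of_nonneg hr0.le]
      refine ⟨?_, ?_⟩ <;> rw [this]
      exacts [(le_max_left q 0).trans_lt hr.1, hr.2]
  exact h1.neBot

theorem norm_lt (h : IsSlitMap q L f) {z : ℂ} (hz : z ∈ annulus q) : ‖f z‖ < 1 :=
  (h.conformal.2.mapsTo hz).1

/-- Preimages of compact sets stay away from both boundary circles. -/
theorem exists_radii (h : IsSlitMap q L f) {C : Set ℂ} (hC : IsCompact C)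
    (hCs : C ⊆ unitDisk \ realSlit L) :
    ∃ r₀ > q, ∃ r₁ < 1, ∀ z ∈ annulus q, f z ∈ C → r₀ ≤ ‖z‖ ∧ ‖z‖ ≤ r₁ := by
  have hk := h.conformal.invFunOn (isOpen_annulus q)
  have hl := h.conformal.2.injOn.leftInvOn_invFunOn
  set k := Function.invFunOn f (annulus q)
  have hc : IsCompact (k '' C) := hC.image_of_continuousOn (hk.1.continuousOn.mono hCs)
  have hsub : k '' C ⊆ annulus q := (hk.2.mapsTo.mono_left hCs).image_subset
  rcases (k '' C).eq_empty_or_nonempty with he | hne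
  · refine ⟨q + 1, by linarith, 0, by norm_num, fun z hz hfz => ?_⟩
    exact absurd (mem_image_of_mem k hfz) (by simp [he])
  obtain ⟨m, hm, hmin⟩ := hc.exists_isMinOn hne continuous_norm.continuousOn
  obtain ⟨M, hM, hmax⟩ := hc.exists_isMaxOn hne continuous_norm.continuousOn
  refine ⟨‖m‖, (hsub hm).1, ‖M‖, (hsub hM).2, fun z hz hfz => ?_⟩
  have : z ∈ k '' C := ⟨f z, hfz, hl hz⟩
  exact ⟨hmin this, hmax this⟩

/-- A boundary value cannot lie in the open slit disk, since preimages of compact sets stay away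
from the circle. So its modulus is 1 or at most `L`. The moduli on the connected circle form an
interval containing `|f 1| = 1`, so they cannot jump over the gap between `L` and 1. -/
theorem norm_eq_one (h : IsSlitMap q L f) {a : ℂ} (ha : ‖a‖ = 1) : ‖f a‖ = 1 := by
  have hmem : ∀ a : ℂ, ‖a‖ = 1 → a ∈ outerAnnulus q := fun a ha => ⟨ha ▸ h.q_lt, ha.le⟩
  have hcw : ∀ a : ℂ, ‖a‖ = 1 → Tendsto f (𝓝[annulus q] a) (𝓝 (f a)) := fun a ha =>
    (h.continuousOn a (hmem a ha)).mono (annulus_subset q)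
  have hle : ∀ a : ℂ, ‖a‖ = 1 → ‖f a‖ ≤ 1 := fun a ha => by
    have := neBot_nhdsWithin_annulus h.q_lt ha
    refine le_of_tendsto (hcw a ha).norm ?_
    filter_upwards [self_mem_nhdsWithin] with z hz using (h.norm_lt hz).le
  have hnot : ∀ a : ℂ, ‖a‖ = 1 → f a ∉ unitDisk \ realSlit L := fun a ha hfa => by
    obtain ⟨ε, hε, hsub⟩ := nhds_basis_closedBall.mem_iff.1
      ((isOpen_unitDisk_diff_realSlit L).mem_nhds hfa)
    obtain ⟨r₀, _, r₁, hr₁, hr⟩ := h.exists_radii (isCompact_closedBall _ _) hsub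
    have := neBot_nhdsWithin_annulus h.q_lt ha
    have h1 : ∀ᶠ z in 𝓝[annulus q] a, f z ∈ closedBall (f a) ε :=
      hcw a ha (closedBall_mem_nhds _ hε)
    have h2 : ∀ᶠ z in 𝓝[annulus q] a, r₁ < ‖z‖ :=
      ((continuous_norm.tendsto a).mono_left nhdsWithin_le_nhds).eventually_const_lt (by rwa [ha])
    obtain ⟨z, ⟨hz1, hz2⟩, hz3⟩ := ((h1.and h2).and self_mem_nhdsWithin).exists
    exact absurd (hr z hz3 hz1).2 (not_le.2 hz2)
  by_contra hne
  have hlt : ‖f a‖ < 1 := lt_of_le_of_ne (hle a ha) hne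
  have hL : ‖f a‖ ≤ L := norm_le_of_mem_realSlit (by
    by_contra hs; exact hnot a ha ⟨hlt, hs⟩)
  have hconn : IsPreconnected {z : ℂ | ‖z‖ ∈ ({1} : Set ℝ)} :=
    isPreconnected_polar isPreconnected_singleton (by simp)
  have hivt := hconn.intermediate_value (f := fun z => ‖f z‖) (a := a) (b := 1) (by simpa using ha)
    (by simp) ((h.continuousOn.mono fun z hz => hmem z hz).norm)
  obtain ⟨c, hc, hc2⟩ := hivt (a := (L + 1) / 2)
    ⟨by linarith [h.L_lt], by simp only [h.map_one, norm_one]; linarith [h.L_lt]⟩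
  simp only at hc2
  refine hnot c hc ⟨?_, fun hs => ?_⟩
  · change ‖f c‖ < 1; rw [hc2]; linarith [h.L_lt]
  · have := norm_le_of_mem_realSlit hs; linarith [h.L_lt]

/-- The preimage of a circle of radius `ρ` between `L` and 1 avoids a thin annulus at the inner
boundary, so there `|f|` is either always below or always above `ρ`. In the second case the values
in the disk of radius `ρ` come from a compact set, whose image would contain the point 0 of the
slit. -/
theorem exists_norm_lt_near_inner (h : IsSlitMap q L f) :
    ∃ ρ < 1, L < ρ ∧ ∃ r₀ > q, r₀ < 1 ∧ ∀ z, q < ‖z‖ → ‖z‖ < r₀ → ‖f z‖ < ρ := by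
  obtain ⟨ρ, hLρ, hρ⟩ := exists_between h.L_lt
  have hρ0 : 0 < ρ := h.L_nonneg.trans_lt hLρ
  obtain ⟨r', hr', _, _, hr⟩ := h.exists_radii (C := sphere 0 ρ) (isCompact_sphere _ _) (by
    intro w hw
    rw [mem_sphere_zero_iff_norm] at hw
    refine ⟨show ‖w‖ < 1 by rwa [hw], fun hs => ?_⟩
    have := norm_le_of_mem_realSlit hs
    linarith)
  obtain ⟨s, hqs, hs1⟩ := exists_between h.q_lt
  set r₀ := min r' s with hr₀
  have hqr : q < r₀ := lt_min hr' hqs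
  have hr1 : r₀ < 1 := (min_le_right _ _).trans_lt hs1
  have hsub : {z : ℂ | ‖z‖ ∈ Ioo q r₀} ⊆ annulus q := fun z hz => ⟨hz.1, hz.2.trans hr1⟩
  have hconn : IsPreconnected {z : ℂ | ‖z‖ ∈ Ioo q r₀} :=
    isPreconnected_polar isPreconnected_Ioo fun r hr => h.q_nonneg.trans hr.1.le
  have hne : ∀ z : ℂ, ‖z‖ ∈ Ioo q r₀ → ‖f z‖ ≠ ρ := fun z hz heq => by
    have := (hr z (hsub hz) (by simpa using heq)).1
    exact absurd (hz.2.trans_le (min_le_left _ _)) (not_lt.2 this)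
  refine ⟨ρ, hρ, hLρ, r₀, hqr, hr1, fun z hz1 hz2 => ?_⟩
  by_contra! hge
  have hgt : ∀ y : ℂ, ‖y‖ ∈ Ioo q r₀ → ρ < ‖f y‖ := by
    intro y hy
    by_contra! hy2
    obtain ⟨c, hc, hc2⟩ := hconn.intermediate_value (f := fun z => ‖f z‖) hy
      (show z ∈ {z : ℂ | ‖z‖ ∈ Ioo q r₀} from ⟨hz1, hz2⟩)
      ((h.continuousOn.mono (hsub.trans (annulus_subset q))).norm) ⟨hy2, hge⟩
    exact hne c hc hc2
  -- the complement of the slit in a smaller closed disk would be compact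
  have hR : IsCompact {z : ℂ | ‖z‖ ∈ Icc r₀ 1} := by
    refine (isCompact_closedBall (0 : ℂ) 1).of_isClosed_subset
      (isClosed_Icc.preimage continuous_norm) fun z hz => by simpa using hz.2
  have hsubR : {z : ℂ | ‖z‖ ∈ Icc r₀ 1} ⊆ outerAnnulus q := fun z hz =>
    ⟨hqr.trans_le hz.1, hz.2⟩
  have hcl : IsClosed (f '' {z : ℂ | ‖z‖ ∈ Icc r₀ 1} ∩ closedBall 0 ρ) :=
    (hR.image_of_continuousOn (h.continuousOn.mono hsubR)).isClosed.inter isClosed_closedBall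
  -- These points lie off the real axis, hence in the slit disk, and converge to 0, which is on the
  -- slit even for `L = 0`.
  have hmem : ∀ n : ℕ, (ρ / (n + 1) : ℝ) * Complex.I ∈
      f '' {z : ℂ | ‖z‖ ∈ Icc r₀ 1} ∩ closedBall 0 ρ := by
    intro n
    have hn : (0 : ℝ) < n + 1 := by positivity
    have hpos : 0 < ρ / (n + 1) := by positivity
    have hle : ρ / (n + 1) ≤ ρ := div_le_self hρ0.le (by linarith [n.cast_nonneg (α := ℝ)])
    have hnorm : ‖((ρ / (n + 1) : ℝ) : ℂ) * Complex.I‖ = ρ / (n + 1) := by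
      rw [norm_mul, Complex.norm_I, mul_one, Complex.norm_real, Real.norm_of_nonneg hpos.le]
    have hU : ((ρ / (n + 1) : ℝ) : ℂ) * Complex.I ∈ unitDisk \ realSlit L := by
      refine ⟨?_, ?_⟩
      · change ‖_‖ < 1; rw [hnorm]; exact hle.trans_lt hρ
      · rintro ⟨t, -, ht⟩
        have := congrArg Complex.im ht
        simp only [Complex.ofReal_im, Complex.mul_im, Complex.ofReal_re, Complex.I_im, mul_one,
          Complex.I_re, mul_zero, add_zero] at this
        linarith
    obtain ⟨z, hz, hfz⟩ := h.conformal.2.surjOn hU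
    have hmb : ((ρ / (n + 1) : ℝ) : ℂ) * Complex.I ∈ closedBall (0 : ℂ) ρ := by
      rw [mem_closedBall_zero_iff, hnorm]; exact hle
    refine ⟨⟨z, ⟨?_, hz.2.le⟩, hfz⟩, hmb⟩
    by_contra! hlt
    have := hgt z ⟨hz.1, hlt⟩
    rw [hfz, hnorm] at this
    linarith
  have h0 : (0 : ℂ) ∈ f '' {z : ℂ | ‖z‖ ∈ Icc r₀ 1} ∩ closedBall 0 ρ := by
    refine hcl.mem_of_tendsto (b := atTop) ?_ (Eventually.of_forall hmem)
    have h1 : Tendsto (fun n : ℕ => ρ / ((n : ℝ) + 1)) atTop (𝓝 0) :=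
      tendsto_const_nhds.div_atTop (tendsto_atTop_add_const_right _ _ tendsto_natCast_atTop_atTop)
    have h2 := ((Complex.continuous_ofReal.tendsto 0).comp h1).mul_const Complex.I
    simpa using h2
  obtain ⟨⟨z, hz, hfz⟩, -⟩ := h0
  rcases hz.2.lt_or_eq with hz1 | hz1
  · have := (h.conformal.2.mapsTo (show z ∈ annulus q from ⟨hqr.trans_le hz.1, hz1⟩)).2
    rw [hfz] at this
    exact this ⟨0, ⟨by linarith [h.L_nonneg], h.L_nonneg⟩, by simp⟩
  · have := h.norm_eq_one hz1
    rw [hfz] at this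
    simp at this

/-- Near the inner circle the values are close to the slit. -/
theorem exists_mem_near_inner (h : IsSlitMap q L f) {N : Set ℂ} (hN : IsOpen N)
    (hNs : realSlit L ⊆ N) : ∃ r > q, r < 1 ∧ ∀ z, q < ‖z‖ → ‖z‖ < r → f z ∈ N := by
  obtain ⟨ρ, hρ, hLρ, r₀, hqr, hr1, hr₀⟩ := h.exists_norm_lt_near_inner
  -- This is compact in the slit disk, so near the inner circle `f` avoids it while its modulus
  -- stays below `ρ`.
  obtain ⟨r', hr', _, _, hr⟩ := h.exists_radii (C := closedBall 0 ρ \ N)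
    ((isCompact_closedBall _ _).diff hN) (by
      rintro w ⟨hw, hwN⟩
      exact ⟨show ‖w‖ < 1 by exact (mem_closedBall_zero_iff.1 hw).trans_lt hρ,
        fun hs => hwN (hNs hs)⟩)
  refine ⟨min r₀ r', lt_min hqr hr', (min_le_left _ _).trans_lt hr1, fun z hz1 hz2 => ?_⟩
  by_contra hzN
  have h1 := hr₀ z hz1 (hz2.trans_le (min_le_left _ _))
  have h2 := (hr z ⟨hz1, (hz2.trans_le (min_le_left _ _)).trans hr1⟩
    ⟨by simpa using h1.le, hzN⟩).1
  exact absurd (hz2.trans_le (min_le_right _ _)) (not_lt.2 h2)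

/-- Points with values close to the slit are close to the inner circle. -/
theorem exists_nhds_slit (h : IsSlitMap q L f) {r : ℝ} (hr : q < r) :
    ∃ N, IsOpen N ∧ realSlit L ⊆ N ∧ ∀ z ∈ annulus q, f z ∈ N → ‖z‖ < r := by
  have hR : IsCompact {z : ℂ | ‖z‖ ∈ Icc r 1} := by
    refine (isCompact_closedBall (0 : ℂ) 1).of_isClosed_subset
      (isClosed_Icc.preimage continuous_norm) fun z hz => by simpa using hz.2
  have hsubR : {z : ℂ | ‖z‖ ∈ Icc r 1} ⊆ outerAnnulus q := fun z hz => ⟨hr.trans_le hz.1, hz.2⟩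
  refine ⟨(f '' {z : ℂ | ‖z‖ ∈ Icc r 1})ᶜ,
    (hR.image_of_continuousOn (h.continuousOn.mono hsubR)).isClosed.isOpen_compl, ?_, ?_⟩
  · rintro w hw ⟨z, hz, rfl⟩
    rcases hz.2.lt_or_eq with hz1 | hz1
    · exact (h.conformal.2.mapsTo (show z ∈ annulus q from ⟨hr.trans_le hz.1, hz1⟩)).2 hw
    · have := h.norm_eq_one hz1
      linarith [norm_le_of_mem_realSlit hw, h.L_lt]
  · intro z hz hfz
    by_contra! hlt
    exact hfz ⟨z, ⟨hlt, hz.2.le⟩, rfl⟩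

/-- Points with values close to the unit circle are close to the unit circle. -/
theorem exists_norm_gt (h : IsSlitMap q L f) {r : ℝ} (hr : r < 1) :
    ∃ ρ < 1, ∀ z ∈ annulus q, ρ < ‖f z‖ → r < ‖z‖ := by
  obtain ⟨ρ, hρ, hLρ, r₀, hqr, hr1, hr₀⟩ := h.exists_norm_lt_near_inner
  have hR : IsCompact {z : ℂ | ‖z‖ ∈ Icc r₀ r} := by
    refine (isCompact_closedBall (0 : ℂ) 1).of_isClosed_subset
      (isClosed_Icc.preimage continuous_norm) fun z hz => by simpa using hz.2.trans hr.le
  have hsubR : {z : ℂ | ‖z‖ ∈ Icc r₀ r} ⊆ annulus q := fun z hz =>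
    ⟨hqr.trans_le hz.1, hz.2.trans_lt hr⟩
  rcases {z : ℂ | ‖z‖ ∈ Icc r₀ r}.eq_empty_or_nonempty with he | hne
  · refine ⟨ρ, hρ, fun z hz hfz => ?_⟩
    by_contra! hzr
    rcases lt_or_ge ‖z‖ r₀ with h1 | h1
    · linarith [hr₀ z hz.1 h1]
    · have : z ∈ {z : ℂ | ‖z‖ ∈ Icc r₀ r} := ⟨h1, hzr⟩
      rw [he] at this; exact this
  · obtain ⟨m, hm, hmax⟩ := hR.exists_isMaxOn hne
      ((h.continuousOn.mono (hsubR.trans (annulus_subset q))).norm)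
    refine ⟨max ρ ‖f m‖, max_lt hρ (h.norm_lt (hsubR hm)), fun z hz hfz => ?_⟩
    by_contra! hzr
    rcases lt_or_ge ‖z‖ r₀ with h1 | h1
    · linarith [hr₀ z hz.1 h1, le_max_left ρ ‖f m‖]
    · have h2 : ‖f z‖ ≤ ‖f m‖ := hmax (show z ∈ {z : ℂ | ‖z‖ ∈ Icc r₀ r} from ⟨h1, hzr⟩)
      linarith [le_max_right ρ ‖f m‖]

end IsSlitMap

theorem annulus_subset_unitDisk_diff {L : ℝ} : annulus L ⊆ unitDisk \ realSlit L := fun _ hw =>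
  ⟨hw.2, fun hs => absurd hw.1 (not_lt.2 (norm_le_of_mem_realSlit hs))⟩

theorem unitDisk_inter_ball_subset_annulus {q : ℝ} {a : ℂ} (ha : ‖a‖ = 1) :
    unitDisk ∩ ball a (1 - q) ⊆ annulus q := fun z hz => by
  refine ⟨?_, hz.1⟩
  have h1 := norm_sub_norm_le a z
  have h2 : ‖a - z‖ < 1 - q := by rw [← dist_eq_norm, dist_comm]; exact hz.2
  linarith

namespace IsSlitMap

variable {q L : ℝ} {f g : ℂ → ℂ}

theorem tendsto_annulus (h : IsSlitMap q L f) {a : ℂ} (ha : ‖a‖ = 1) :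
    Tendsto f (𝓝[annulus q] a) (𝓝[unitDisk \ realSlit L] (f a)) :=
  tendsto_nhdsWithin_iff.2 ⟨(h.continuousOn a ⟨ha ▸ h.q_lt, ha.le⟩).mono (annulus_subset q),
    by filter_upwards [self_mem_nhdsWithin] with z hz using h.conformal.2.mapsTo hz⟩

/-- Since `|f|` tends to 1 at the outer circle, `f` continues analytically across it by reflection.
-/
theorem hasDerivWithinAt (h : IsSlitMap q L f) {a : ℂ} (ha : ‖a‖ = 1) :
    ∃ d, HasDerivWithinAt f d (annulus q) a := by
  have hsub := unitDisk_inter_ball_subset_annulus (q := q) ha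
  obtain ⟨δ, hδ, H, hH, hHf, -⟩ := exists_reflection_circle ha (sub_pos.2 h.q_lt)
    (h.conformal.1.mono hsub) (fun z hz => h.norm_lt (hsub hz)) (fun c _ hc => by
      have := ((h.tendsto_annulus hc).mono_right nhdsWithin_le_nhds).norm
      rw [h.norm_eq_one hc] at this
      exact this.mono_left (nhdsWithin_mono _ hsub))
  have hHa : HasDerivAt H (deriv H a) a :=
    (hH.differentiableAt (isOpen_ball.mem_nhds (mem_ball_self hδ))).hasDerivAt
  have hev : ∀ᶠ z in 𝓝[annulus q] a, f z = H z := by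
    filter_upwards [self_mem_nhdsWithin, nhdsWithin_le_nhds (ball_mem_nhds a hδ)] with z hz hz2
    exact (hHf z hz2 hz.2).symm
  refine ⟨deriv H a, hHa.hasDerivWithinAt.congr_of_eventuallyEq hev ?_⟩
  have := neBot_nhdsWithin_annulus h.q_lt ha
  refine tendsto_nhds_unique ((h.tendsto_annulus ha).mono_right nhdsWithin_le_nhds) ?_
  exact (hHa.continuousAt.continuousWithinAt (s := annulus q)).tendsto.congr'
    (hev.mono fun z hz => hz.symm)

theorem neBot_nhdsWithin_slitDisk (h : IsSlitMap q L f) {w : ℂ} (hw : ‖w‖ = 1) :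
    (𝓝[unitDisk \ realSlit L] w).NeBot :=
  (neBot_nhdsWithin_annulus h.L_lt hw).mono (nhdsWithin_mono _ annulus_subset_unitDisk_diff)

/-- The inverse also tends to the unit circle in modulus (`exists_norm_gt`), so reflection applies
to it as well. Its boundary value is the only preimage on the circle. The update at `w` is needed
because `invFunOn` has an arbitrary value there. -/
theorem exists_extension_invFunOn (h : IsSlitMap q L f) {w : ℂ} (hw : ‖w‖ = 1) :
    ∃ a e, ‖a‖ = 1 ∧ f a = w ∧ (∀ a', ‖a'‖ = 1 → f a' = w → a' = a) ∧
      HasDerivWithinAt (Function.update (Function.invFunOn f (annulus q)) w a) e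
        (unitDisk \ realSlit L) w ∧
      Tendsto (Function.invFunOn f (annulus q)) (𝓝[unitDisk \ realSlit L] w) (𝓝[annulus q] a) := by
  have hsub : unitDisk ∩ ball w (1 - L) ⊆ unitDisk \ realSlit L :=
    (unitDisk_inter_ball_subset_annulus hw).trans annulus_subset_unitDisk_diff
  have hk := h.conformal.invFunOn (isOpen_annulus q)
  have hfk : ∀ w ∈ unitDisk \ realSlit L, f (Function.invFunOn f (annulus q) w) = w := fun w hw =>
    h.conformal.2.surjOn.rightInvOn_invFunOn hw
  have hkf : ∀ z ∈ annulus q, Function.invFunOn f (annulus q) (f z) = z := fun z hz =>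
    h.conformal.2.injOn.leftInvOn_invFunOn hz
  set k := Function.invFunOn f (annulus q)
  have hnorm : ∀ c : ℂ, ‖c‖ = 1 → Tendsto (fun z => ‖k z‖) (𝓝[unitDisk \ realSlit L] c) (𝓝 1) := by
    intro c hc
    rw [tendsto_order]
    refine ⟨fun r hr => ?_, fun r hr => ?_⟩
    · obtain ⟨ρ, hρ, hρr⟩ := h.exists_norm_gt hr
      have h2 : ∀ᶠ z in 𝓝[unitDisk \ realSlit L] c, ρ < ‖z‖ :=
        ((continuous_norm.tendsto c).mono_left nhdsWithin_le_nhds).eventually_const_lt (by rwa [hc])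
      filter_upwards [h2, self_mem_nhdsWithin] with z hz hzm
      exact hρr _ (hk.2.mapsTo hzm) (by rwa [hfk z hzm])
    · filter_upwards [self_mem_nhdsWithin] with z hz
      exact (hk.2.mapsTo hz).2.trans hr
  obtain ⟨δ, hδ, H, hH, hHk, -⟩ := exists_reflection_circle hw (sub_pos.2 h.L_lt)
    (hk.1.mono hsub) (fun z hz => (hk.2.mapsTo (hsub hz)).2) (fun c _ hc =>
      (hnorm c hc).mono_left (nhdsWithin_mono _ hsub))
  have hHa : HasDerivAt H (deriv H w) w :=
    (hH.differentiableAt (isOpen_ball.mem_nhds (mem_ball_self hδ))).hasDerivAt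
  have hev : k =ᶠ[𝓝[unitDisk \ realSlit L] w] H := by
    filter_upwards [self_mem_nhdsWithin, nhdsWithin_le_nhds (ball_mem_nhds w hδ)] with z hz hz2
    exact (hHk z hz2 hz.1).symm
  have := h.neBot_nhdsWithin_slitDisk hw
  have hkH : Tendsto k (𝓝[unitDisk \ realSlit L] w) (𝓝 (H w)) :=
    (hHa.continuousAt.continuousWithinAt.tendsto).congr' hev.symm
  have hH1 : ‖H w‖ = 1 := tendsto_nhds_unique hkH.norm (hnorm w hw)
  have hkA : Tendsto k (𝓝[unitDisk \ realSlit L] w) (𝓝[annulus q] (H w)) :=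
    tendsto_nhdsWithin_iff.2 ⟨hkH, by
      filter_upwards [self_mem_nhdsWithin] with z hz using hk.2.mapsTo hz⟩
  refine ⟨H w, deriv H w, hH1, ?_, ?_, ?_, hkA⟩
  · have h1 := ((h.tendsto_annulus hH1).mono_right nhdsWithin_le_nhds).comp hkA
    refine tendsto_nhds_unique h1 ?_
    refine (tendsto_id.mono_left nhdsWithin_le_nhds).congr' ?_
    filter_upwards [self_mem_nhdsWithin] with z hz using (hfk z hz).symm
  · intro a' ha' hfa'
    have := neBot_nhdsWithin_annulus h.q_lt ha'
    have h1 := h.tendsto_annulus ha'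
    rw [hfa'] at h1
    have h2 := hkH.comp h1
    refine tendsto_nhds_unique ((tendsto_id.mono_left nhdsWithin_le_nhds).congr' ?_) h2
    filter_upwards [self_mem_nhdsWithin] with z hz using (hkf z hz).symm
  · refine hHa.hasDerivWithinAt.congr_of_eventuallyEq ?_ (by simp)
    filter_upwards [hev, self_mem_nhdsWithin] with z hz hz2
    rw [Function.update_of_ne, hz]
    rintro rfl
    have : ‖z‖ < 1 := hz2.1
    linarith

theorem injOn_outerAnnulus (h : IsSlitMap q L f) : InjOn f (outerAnnulus q) := by
  intro z hz z' hz' heq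
  have hlt : ∀ z z' : ℂ, z ∈ outerAnnulus q → ‖z‖ < 1 → z' ∈ outerAnnulus q → f z = f z' →
      ‖z'‖ < 1 := by
    intro z z' hz hz1 hz' heq
    refine lt_of_le_of_ne hz'.2 fun h1 => ?_
    have := h.norm_eq_one h1
    rw [← heq] at this
    linarith [h.norm_lt ⟨hz.1, hz1⟩]
  rcases hz.2.lt_or_eq with h1 | h1
  · exact h.conformal.2.injOn ⟨hz.1, h1⟩ ⟨hz'.1, hlt z z' hz h1 hz' heq⟩ heq
  rcases hz'.2.lt_or_eq with h2 | h2
  · exact h.conformal.2.injOn ⟨hz.1, hlt z' z hz' h2 hz heq.symm⟩ ⟨hz'.1, h2⟩ heq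
  obtain ⟨a, -, -, -, ha, -⟩ := h.exists_extension_invFunOn (h.norm_eq_one h1)
  rw [ha z h1 rfl, ha z' h2 heq.symm]

/-! ### Uniqueness and symmetry of the slit map -/

/-- The inverse of a slit map, including its boundary values on the unit circle. -/
noncomputable def inverse (q : ℝ) (f : ℂ → ℂ) : ℂ → ℂ := Function.invFunOn f (outerAnnulus q)

theorem inverse_apply (h : IsSlitMap q L f) {z : ℂ} (hz : z ∈ outerAnnulus q) :
    inverse q f (f z) = z :=
  h.injOn_outerAnnulus.leftInvOn_invFunOn hz

theorem surjOn_circle (h : IsSlitMap q L f) {w : ℂ} (hw : ‖w‖ = 1) : ∃ a, ‖a‖ = 1 ∧ f a = w := by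
  obtain ⟨a, -, ha, hfa, -⟩ := h.exists_extension_invFunOn hw
  exact ⟨a, ha, hfa⟩

theorem conformal_inverse (h : IsSlitMap q L f) :
    MapsConformallyOnto (inverse q f) (unitDisk \ realSlit L) (annulus q) := by
  have hk := h.conformal.invFunOn (isOpen_annulus q)
  have heq : EqOn (inverse q f) (Function.invFunOn f (annulus q)) (unitDisk \ realSlit L) := by
    intro w hw
    have h1 := h.conformal.2.surjOn.rightInvOn_invFunOn hw
    have h2 := h.inverse_apply (annulus_subset q (hk.2.mapsTo hw))
    rwa [h1] at h2
  exact ⟨hk.1.congr heq, hk.2.congr heq.symm⟩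

theorem apply_inverse (h : IsSlitMap q L f) {w : ℂ} (hw : w ∈ unitDisk \ realSlit L) :
    f (inverse q f w) = w := by
  obtain ⟨z, hz, rfl⟩ := h.conformal.2.surjOn hw
  rw [h.inverse_apply (annulus_subset q hz)]

theorem uniqueDiffWithinAt (h : IsSlitMap q L f) {a : ℂ} (ha : ‖a‖ = 1) :
    UniqueDiffWithinAt ℂ (annulus q) a := by
  rw [uniqueDiffWithinAt_iff_accPt, accPt_principal_iff_nhdsWithin, sdiff_singleton_eq_self]
  · exact neBot_nhdsWithin_annulus h.q_lt ha
  · intro h1; linarith [h1.2]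

theorem hasDerivWithinAt_inverse (h : IsSlitMap q L f) {a d : ℂ} (ha : ‖a‖ = 1)
    (hd : HasDerivWithinAt f d (annulus q) a) :
    d ≠ 0 ∧ HasDerivWithinAt (inverse q f) d⁻¹ (unitDisk \ realSlit L) (f a) := by
  obtain ⟨a', e, -, -, ha'a, hder, -⟩ := h.exists_extension_invFunOn (h.norm_eq_one ha)
  obtain rfl := ha'a a ha rfl
  have hder' : HasDerivWithinAt (inverse q f) e (unitDisk \ realSlit L) (f a) := by
    refine hder.congr (fun w hw => ?_) ?_
    · rw [Function.update_of_ne]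
      · have h1 := h.conformal.2.surjOn.rightInvOn_invFunOn hw
        have h2 := h.inverse_apply (annulus_subset q
          ((h.conformal.invFunOn (isOpen_annulus q)).2.mapsTo hw))
        rwa [h1] at h2
      · rintro rfl
        have : ‖f a‖ < 1 := hw.1
        linarith [h.norm_eq_one ha]
    · rw [h.inverse_apply ⟨ha ▸ h.q_lt, ha.le⟩]; simp
  have hcomp : HasDerivWithinAt (inverse q f ∘ f) (e * d) (annulus q) a :=
    hder'.comp a hd h.conformal.2.mapsTo
  have hid : HasDerivWithinAt (inverse q f ∘ f) 1 (annulus q) a := by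
    refine (hasDerivWithinAt_id a _).congr (fun z hz => ?_) ?_
    · exact h.inverse_apply (annulus_subset q hz)
    · exact h.inverse_apply ⟨ha ▸ h.q_lt, ha.le⟩
  have h1 : e * d = 1 := (h.uniqueDiffWithinAt ha).eq_deriv _ hcomp hid
  rw [eq_inv_of_mul_eq_one_left h1] at hder'
  exact ⟨right_ne_zero_of_mul_eq_one h1, hder'⟩

theorem tendsto_inverse (h : IsSlitMap q L f) {a : ℂ} (ha : ‖a‖ = 1) :
    Tendsto (inverse q f) (𝓝[unitDisk \ realSlit L] (f a)) (𝓝 a) := by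
  obtain ⟨d, hd⟩ := h.hasDerivWithinAt ha
  have := (h.hasDerivWithinAt_inverse ha hd).2.continuousWithinAt.tendsto
  rwa [h.inverse_apply ⟨ha ▸ h.q_lt, ha.le⟩] at this

/-- A Schwarz lemma for the annulus. The composite preserves each boundary circle, so its quotient
by `z` has upper limits of modulus at most one at both. For `q = 0` the origin is a removable
singularity and the usual Schwarz lemma applies. -/
theorem norm_inverse_comp_le (h : IsSlitMap q L f) (hg : IsSlitMap q L g) {z : ℂ}
    (hz : z ∈ annulus q) : ‖inverse q f (g z)‖ ≤ ‖z‖ := by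
  have hconf : MapsConformallyOnto (inverse q f ∘ g) (annulus q) (annulus q) :=
    h.conformal_inverse.comp hg.conformal
  have hinner : ∀ r > q, ∃ s > q, s < 1 ∧ ∀ z, q < ‖z‖ → ‖z‖ < s → ‖inverse q f (g z)‖ < r := by
    intro r hr
    obtain ⟨N, hN, hNs, hNr⟩ := h.exists_nhds_slit hr
    obtain ⟨s, hs, hs1, hsN⟩ := hg.exists_mem_near_inner hN hNs
    refine ⟨s, hs, hs1, fun z hz1 hz2 => hNr _ (hconf.2.mapsTo ⟨hz1, hz2.trans hs1⟩) ?_⟩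
    rw [h.apply_inverse (hg.conformal.2.mapsTo ⟨hz1, hz2.trans hs1⟩)]
    exact hsN z hz1 hz2
  have hpos : ∀ z ∈ annulus q, 0 < ‖z‖ := fun z hz => h.q_nonneg.trans_lt hz.1
  rcases h.q_nonneg.eq_or_lt with rfl | hq
  · set F : ℂ → ℂ := Function.update (inverse 0 f ∘ g) 0 0 with hF
    have hFe : ∀ z, z ≠ 0 → F z = inverse 0 f (g z) := fun z hz => by
      simp [hF, Function.update_of_ne hz]
    have hmap : ∀ z, ‖z‖ < 1 → z ≠ 0 → inverse 0 f (g z) ∈ annulus 0 := fun z hz hz0 =>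
      hconf.2.mapsTo ⟨norm_pos_iff.2 hz0, hz⟩
    have hcont : ContinuousAt F 0 := by
      rw [Metric.continuousAt_iff]
      intro ε hε
      obtain ⟨s, hs, hs1, hsr⟩ := hinner ε hε
      refine ⟨s, hs, fun {z} hz => ?_⟩
      rw [dist_zero_right] at hz
      by_cases hz0 : z = 0
      · simp [hz0, hε]
      · rw [show F 0 = 0 by simp [hF], dist_zero_right, hFe z hz0]
        exact hsr z (norm_pos_iff.2 hz0) hz
    have hdiff : DifferentiableOn ℂ F (ball 0 1) := by
      refine (Complex.differentiableOn_compl_singleton_and_continuousAt_iff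
        (ball_mem_nhds 0 one_pos)).1 ⟨?_, hcont⟩
      refine (hconf.1.mono fun z hz => ?_).congr fun z hz => hFe z hz.2
      exact ⟨norm_pos_iff.2 hz.2, by simpa using hz.1⟩
    have hmaps : MapsTo F (ball 0 1) (ball 0 1) := by
      intro z hz
      by_cases hz0 : z = 0
      · simp [hz0, hF]
      · rw [hFe z hz0]
        simpa using (hmap z (by simpa using hz) hz0).2
    have := Complex.norm_le_norm_of_mapsTo_ball hdiff
      (hmaps.mono_right ball_subset_closedBall) (by simp [hF])
      (z := z) hz.2
    rwa [hFe z (norm_pos_iff.1 (hpos z hz))] at this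
  · have hb : Bornology.IsBounded (annulus q) :=
      isBounded_ball.subset (fun z hz => by simpa using hz.2 : annulus q ⊆ ball 0 1)
    have hne : ∀ z ∈ annulus q, z ≠ 0 := fun z hz => norm_pos_iff.1 (hpos z hz)
    have hle := norm_le_one_of_eventually_frontier (isOpen_annulus q) hb
      (isPreconnected_annulus h.q_nonneg) (F := fun z => inverse q f (g z) / z)
      (hconf.1.div differentiableOn_id hne) ?_ hz
    · rwa [norm_div, div_le_one (hpos z hz)] at hle
    intro c hc ε hε
    have hcl : q ≤ ‖c‖ ∧ ‖c‖ ≤ 1 := by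
      have : closure (annulus q) ⊆ {z : ℂ | q ≤ ‖z‖ ∧ ‖z‖ ≤ 1} :=
        closure_minimal (fun z hz => ⟨hz.1.le, hz.2.le⟩)
          ((isClosed_le continuous_const continuous_norm).inter
            (isClosed_le continuous_norm continuous_const))
      exact this (frontier_subset_closure hc)
    have hcn : c ∉ annulus q := by
      rw [frontier, (isOpen_annulus q).interior_eq] at hc; exact hc.2
    have hnc : Tendsto (fun z : ℂ => ‖z‖) (𝓝[annulus q] c) (𝓝 ‖c‖) :=
      (continuous_norm.tendsto c).mono_left nhdsWithin_le_nhds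
    rcases hcl.2.lt_or_eq with h1 | h1
    · have hcq : ‖c‖ = q := by
        by_contra hne
        exact hcn ⟨lt_of_le_of_ne hcl.1 (Ne.symm hne), h1⟩
      obtain ⟨s, hs, -, hsr⟩ := hinner (q * (1 + ε)) (by nlinarith)
      filter_upwards [self_mem_nhdsWithin, hnc.eventually_lt_const (hcq ▸ hs)] with z hz hzs
      rw [norm_div, div_lt_iff₀ (hpos z hz)]
      have := hsr z hz.1 hzs
      have h3 : q * (1 + ε) ≤ (1 + ε) * ‖z‖ := by
        rw [mul_comm]; exact mul_le_mul_of_nonneg_left hz.1.le (by linarith)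
      linarith
    · have h2 : (1 + ε)⁻¹ < ‖c‖ := by rw [h1]; exact inv_lt_one_of_one_lt₀ (by linarith)
      filter_upwards [self_mem_nhdsWithin, hnc.eventually_const_lt h2] with z hz hzs
      rw [norm_div, div_lt_iff₀ (hpos z hz)]
      have h3 := (hconf.2.mapsTo hz).2
      have h4 := (inv_lt_iff_one_lt_mul₀' (by linarith)).1 hzs
      exact lt_trans h3 h4

/-- A slit map with given `q` and `L` is unique. -/
theorem eqOn (h : IsSlitMap q L f) (hg : IsSlitMap q L g) : EqOn f g (outerAnnulus q) := by
  have hconf : MapsConformallyOnto (inverse q f ∘ g) (annulus q) (annulus q) :=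
    h.conformal_inverse.comp hg.conformal
  have hpos : ∀ z ∈ annulus q, 0 < ‖z‖ := fun z hz => h.q_nonneg.trans_lt hz.1
  have hne : ∀ z ∈ annulus q, z ≠ 0 := fun z hz => norm_pos_iff.1 (hpos z hz)
  -- Applying the inequality to the composite and to its inverse gives equality. The quotient by `z`
  -- then has constant modulus, so it is a constant, which the normalization at 1 identifies as 1.
  have hnorm : ∀ z ∈ annulus q, ‖inverse q f (g z)‖ = ‖z‖ := by
    intro z hz
    refine le_antisymm (h.norm_inverse_comp_le hg hz) ?_
    have h1 := hg.norm_inverse_comp_le h (hconf.2.mapsTo hz)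
    simp only [Function.comp_apply] at h1
    rwa [h.apply_inverse (hg.conformal.2.mapsTo hz),
      hg.inverse_apply (annulus_subset q hz)] at h1
  obtain ⟨z₀, hz₀⟩ : (annulus q).Nonempty := by
    have := neBot_nhdsWithin_annulus h.q_lt (a := 1) (by simp)
    by_contra! he
    rw [he, nhdsWithin_empty] at this
    exact this.ne rfl
  have hone : ∀ z ∈ annulus q, ‖inverse q f (g z) / z‖ = 1 := fun z hz => by
    rw [norm_div, hnorm z hz, div_self (hpos z hz).ne']
  have hconst := Complex.eqOn_of_isPreconnected_of_isMaxOn_norm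
    (f := fun z => inverse q f (g z) / z) (isPreconnected_annulus h.q_nonneg) (isOpen_annulus q)
    (hconf.1.div differentiableOn_id hne) hz₀
    (fun z hz => by
      change ‖_‖ ≤ ‖_‖
      rw [hone z hz, hone z₀ hz₀])
  set lam := inverse q f (g z₀) / z₀ with hlam
  have hlin : ∀ z ∈ annulus q, inverse q f (g z) = lam * z := fun z hz => by
    have := hconst hz
    simp only [Function.const_apply] at this
    rw [← this, div_mul_cancel₀ _ (hne z hz)]
  have h1 := neBot_nhdsWithin_annulus h.q_lt (a := 1) (by simp)
  have hl1 : lam = 1 := by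
    have t1 := hg.tendsto_annulus (a := 1) (by simp)
    have t2 := h.tendsto_inverse (a := 1) (by simp)
    rw [hg.map_one] at t1
    rw [h.map_one] at t2
    have t3 : Tendsto (fun z => lam * z) (𝓝[annulus q] 1) (𝓝 (lam * 1)) :=
      (continuous_const_mul lam).continuousAt.mono_left nhdsWithin_le_nhds
    have t4 := (t2.comp t1).congr' (f₂ := fun z => lam * z) (by
      filter_upwards [self_mem_nhdsWithin] with z hz using hlin z hz)
    simpa using tendsto_nhds_unique t3 t4
  have hin : EqOn f g (annulus q) := fun z hz => by
    have := h.apply_inverse (hg.conformal.2.mapsTo hz)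
    rwa [hlin z hz, hl1, one_mul] at this
  intro z hz
  rcases hz.2.lt_or_eq with h2 | h2
  · exact hin ⟨hz.1, h2⟩
  · have := neBot_nhdsWithin_annulus h.q_lt h2
    refine tendsto_nhds_unique ((h.tendsto_annulus h2).mono_right nhdsWithin_le_nhds)
      (((hg.tendsto_annulus h2).mono_right nhdsWithin_le_nhds).congr' ?_)
    filter_upwards [self_mem_nhdsWithin] with y hy using (hin hy).symm

theorem conj_conj (h : IsSlitMap q L f) : IsSlitMap q L (conj ∘ f ∘ conj) := by
  have hA : ∀ z, conj z ∈ annulus q ↔ z ∈ annulus q := fun z => by simp [annulus]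
  have hS : ∀ z, conj z ∈ unitDisk \ realSlit L ↔ z ∈ unitDisk \ realSlit L := fun z => by
    have : conj z ∈ realSlit L ↔ z ∈ realSlit L := by
      constructor
      · rintro ⟨t, ht, h⟩
        exact ⟨t, ht, by simpa using congrArg conj h⟩
      · rintro ⟨t, ht, rfl⟩
        exact ⟨t, ht, by simp⟩
    simp [unitDisk, this]
  refine ⟨h.q_nonneg, h.q_lt, h.L_nonneg, h.L_lt, ⟨fun z hz => ?_, ?_, ?_, ?_⟩, ?_, ?_⟩
  · have := h.conformal.1.differentiableAt ((isOpen_annulus q).mem_nhds ((hA z).2 hz))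
    exact (differentiableAt_conj_conj_iff.2 this).differentiableWithinAt
  · exact fun z hz => (hS _).2 (h.conformal.2.mapsTo ((hA z).2 hz))
  · intro z hz z' hz' heq
    have := h.conformal.2.injOn ((hA z).2 hz) ((hA z').2 hz')
      ((starRingEnd ℂ).injective heq)
    exact (starRingEnd ℂ).injective this
  · intro w hw
    obtain ⟨z, hz, hfz⟩ := h.conformal.2.surjOn ((hS w).2 hw)
    exact ⟨conj z, (hA z).2 hz, by simp [hfz]⟩
  · refine Complex.continuous_conj.comp_continuousOn (h.continuousOn.comp
      Complex.continuous_conj.continuousOn fun z hz => ?_)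
    simpa [outerAnnulus] using hz
  · simp [h.map_one]

/-- Because the slit is real, `conj ∘ f ∘ conj` is another slit map with the same `q` and `L`, and
uniqueness applies. -/
theorem apply_conj (h : IsSlitMap q L f) {z : ℂ} (hz : z ∈ outerAnnulus q) :
    f (conj z) = conj (f z) := by
  have := h.eqOn h.conj_conj hz
  simp only [Function.comp_apply] at this
  rw [this]; simp

theorem hasDerivWithinAt_conj (h : IsSlitMap q L f) {a d : ℂ} (ha : ‖a‖ = 1)
    (hd : HasDerivWithinAt f d (annulus q) a) :
    HasDerivWithinAt f (conj d) (annulus q) (conj a) := by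
  have hA : ∀ z, ‖z‖ = 1 → z ∉ annulus q := fun z hz hz2 => by linarith [hz2.2]
  have hca : ‖conj a‖ = 1 := by rwa [Complex.norm_conj]
  rw [hasDerivWithinAt_iff_tendsto_slope' (hA _ ha)] at hd
  rw [hasDerivWithinAt_iff_tendsto_slope' (hA _ hca)]
  have h1 : Tendsto conj (𝓝[annulus q] (conj a)) (𝓝[annulus q] a) := by
    refine tendsto_nhdsWithin_iff.2 ⟨?_, ?_⟩
    · have := (Complex.continuous_conj.tendsto (conj a)).mono_left
        (nhdsWithin_le_nhds (s := annulus q))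
      rwa [Complex.conj_conj] at this
    · filter_upwards [self_mem_nhdsWithin] with z hz
      simpa [annulus] using hz
  refine ((Complex.continuous_conj.tendsto d).comp (hd.comp h1)).congr' ?_
  filter_upwards [self_mem_nhdsWithin] with z hz
  simp only [Function.comp_apply, slope_def_field, map_div₀, map_sub, Complex.conj_conj]
  rw [h.apply_conj (annulus_subset q hz), h.apply_conj ⟨ha ▸ h.q_lt, ha.le⟩, Complex.conj_conj]

end IsSlitMap

/-! ### Conformal maps of components and their boundary values -/

theorem isOpen_diff_connectedComponentIn {W : Set ℂ} (hW : IsOpen W) (p : ℂ) :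
    IsOpen (W \ connectedComponentIn W p) := by
  rw [isOpen_iff_mem_nhds]
  rintro x ⟨hx, hxp⟩
  filter_upwards [hW.connectedComponentIn.mem_nhds (mem_connectedComponentIn hx)] with y hy
  refine ⟨connectedComponentIn_subset _ _ hy, fun hyp => hxp ?_⟩
  rw [connectedComponentIn_eq hyp, ← connectedComponentIn_eq hy]
  exact mem_connectedComponentIn hx

/-- Connectedness of the complement is known for `W` but not for its component. A function on the
component extends by zero to a holomorphic function on `W`, so primitives exist and the Riemann
mapping theorem applies. -/
theorem exists_mapsConformallyOnto_connectedComponentIn {W : Set ℂ} (hW : IsOpen W)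
    (hb : Bornology.IsBounded W) (hc : IsPreconnected Wᶜ) {p : ℂ} (hp : p ∈ W) :
    ∃ φ, MapsConformallyOnto φ (connectedComponentIn W p) unitDisk := by
  set V := connectedComponentIn W p with hV
  have hVW : V ⊆ W := connectedComponentIn_subset _ _
  have hVo : IsOpen V := hW.connectedComponentIn
  refine exists_mapsConformallyOnto_unitDisk hVo isPreconnected_connectedComponentIn
    ⟨p, mem_connectedComponentIn hp⟩ (hb.subset hVW) fun h hh => ?_
  have hext : DifferentiableOn ℂ (V.indicator h) W := by
    intro z hz
    refine DifferentiableAt.differentiableWithinAt ?_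
    by_cases hzV : z ∈ V
    · refine (hh.differentiableAt (hVo.mem_nhds hzV)).congr_of_eventuallyEq ?_
      filter_upwards [hVo.mem_nhds hzV] with y hy using indicator_of_mem hy h
    · refine (differentiableAt_const (0 : ℂ)).congr_of_eventuallyEq ?_
      filter_upwards [(isOpen_diff_connectedComponentIn hW p).mem_nhds ⟨hz, hzV⟩] with y hy
      exact indicator_of_notMem hy.2 h
  obtain ⟨g, hg⟩ := isExactOn_of_isPreconnected_compl hW hb hc hVo
    isPreconnected_connectedComponentIn hVW hext
  exact ⟨g, fun z hz => (hg z hz).congr_deriv (indicator_of_mem hz h)⟩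

theorem nonempty_unitDisk_inter_ball {a : ℂ} (ha : ‖a‖ = 1) {ε : ℝ} (hε : 0 < ε) :
    (unitDisk ∩ ball a ε).Nonempty := by
  have : a ∈ closure unitDisk := by
    rw [unitDisk_eq_ball, closure_ball _ one_ne_zero]; simp [ha]
  obtain ⟨z, hz, hz2⟩ := mem_closure_iff.1 this _ isOpen_ball (mem_ball_self hε)
  exact ⟨z, hz2, hz⟩

theorem isPreconnected_unitDisk_inter_ball (a : ℂ) (ε : ℝ) :
    IsPreconnected (unitDisk ∩ ball a ε) := by
  rw [unitDisk_eq_ball]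
  exact ((convex_ball _ _).inter (convex_ball _ _)).isPreconnected

/-- Reflection of a conformal map onto the disk at a free boundary arc of the unit circle. -/
theorem MapsConformallyOnto.exists_reflection {V : Set ℂ} {φ : ℂ → ℂ} (hV : IsOpen V)
    (hVU : V ⊆ unitDisk) (hφ : MapsConformallyOnto φ V unitDisk) {a : ℂ} (ha : ‖a‖ = 1) {ε : ℝ}
    (hε : 0 < ε) (haV : unitDisk ∩ ball a ε ⊆ V) :
    ∃ δ > 0, ∃ H : ℂ → ℂ, DifferentiableOn ℂ H (ball a δ) ∧
      (∀ z ∈ ball a δ, ‖z‖ < 1 → z ∈ V ∧ H z = φ z) ∧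
      (∀ z ∈ ball a δ, ‖z‖ = 1 → ‖H z‖ = 1) ∧ ∀ z ∈ ball a δ, 1 < ‖z‖ → 1 < ‖H z‖ := by
  have hk := hφ.invFunOn hV
  have hl := hφ.2.injOn.leftInvOn_invFunOn
  -- Preimages of smaller closed disks are compact in `V`, so a point of the unit circle has a
  -- neighbourhood that misses them.
  have hlim : ∀ c : ℂ, ‖c‖ = 1 → Tendsto (fun z => ‖φ z‖) (𝓝[V] c) (𝓝 1) := by
    intro c hc
    rw [tendsto_order]
    refine ⟨fun r hr => ?_, fun r hr => ?_⟩
    · have hsub : closedBall (0 : ℂ) r ⊆ unitDisk := fun w hw =>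
        (mem_closedBall_zero_iff.1 hw).trans_lt hr
      have hcpt := (isCompact_closedBall (0 : ℂ) r).image_of_continuousOn
        (hk.1.continuousOn.mono hsub)
      have hcn : c ∉ Function.invFunOn φ V '' closedBall (0 : ℂ) r := by
        rintro ⟨w, hw, rfl⟩
        have := hVU (hk.2.mapsTo (hsub hw))
        exact absurd this (by change ¬ ‖_‖ < 1; rw [hc]; simp)
      filter_upwards [self_mem_nhdsWithin,
        nhdsWithin_le_nhds (hcpt.isClosed.isOpen_compl.mem_nhds hcn)] with z hz hz2
      by_contra! hle
      exact hz2 ⟨φ z, by simpa using hle, hl hz⟩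
    · filter_upwards [self_mem_nhdsWithin] with z hz
      exact lt_trans (hφ.2.mapsTo hz) hr
  obtain ⟨δ, hδ, H, hH, h1, h2, h3⟩ := exists_reflection_circle ha hε (hφ.1.mono haV)
    (fun z hz => hφ.2.mapsTo (haV hz))
    (fun c _ hc => (hlim c hc).mono_left (nhdsWithin_mono _ haV))
  have hs := ball_subset_ball (x := a) (min_le_left δ ε)
  exact ⟨min δ ε, lt_min hδ hε, H, hH.mono hs, fun z hz hz1 =>
    ⟨haV ⟨hz1, ball_subset_ball (min_le_right δ ε) hz⟩, h1 z (hs hz) hz1⟩,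
    fun z hz => h2 z (hs hz), fun z hz => h3 z (hs hz)⟩

/-- A conformal map onto the disk has distinct boundary values, and derivatives, at two points on
free boundary arcs of the unit circle. -/
theorem MapsConformallyOnto.exists_boundary_values {V : Set ℂ} {φ : ℂ → ℂ} (hV : IsOpen V)
    (hVU : V ⊆ unitDisk) (hφ : MapsConformallyOnto φ V unitDisk) {z₁ z₂ : ℂ} (hz₁ : ‖z₁‖ = 1)
    (hz₂ : ‖z₂‖ = 1) (hne : z₁ ≠ z₂) {ε : ℝ} (hε : 0 < ε) (h₁ : unitDisk ∩ ball z₁ ε ⊆ V)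
    (h₂ : unitDisk ∩ ball z₂ ε ⊆ V) :
    ∃ ψ d₁ d₂, MapsConformallyOnto ψ V unitDisk ∧ ‖ψ z₁‖ = 1 ∧ ‖ψ z₂‖ = 1 ∧ ψ z₁ ≠ ψ z₂ ∧
      HasDerivWithinAt ψ d₁ V z₁ ∧ HasDerivWithinAt ψ d₂ V z₂ := by
  obtain ⟨δ₁, hδ₁, H₁, hH₁, hi₁, hc₁, ho₁⟩ := hφ.exists_reflection hV hVU hz₁ hε h₁
  obtain ⟨δ₂, hδ₂, H₂, hH₂, hi₂, hc₂, ho₂⟩ := hφ.exists_reflection hV hVU hz₂ hε h₂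
  have hn : ∀ z : ℂ, ‖z‖ = 1 → z ∉ V := fun z hz hzV => by
    have : ‖z‖ < 1 := hVU hzV
    linarith
  have hH : ∀ (a : ℂ) (δ : ℝ) (H : ℂ → ℂ), ‖a‖ = 1 → 0 < δ → DifferentiableOn ℂ H (ball a δ) →
      (∀ z ∈ ball a δ, ‖z‖ < 1 → z ∈ V ∧ H z = φ z) → (∀ z ∈ ball a δ, ‖z‖ = 1 → ‖H z‖ = 1) →
      𝓝 (H a) ≤ map H (𝓝 a) := by
    intro a δ H ha hδ hH hi hc
    have han : AnalyticAt ℂ H a := hH.analyticAt (ball_mem_nhds a hδ)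
    rcases han.eventually_constant_or_nhds_le_map_nhds with h | h
    · exfalso
      obtain ⟨r, hr, hsub⟩ := Metric.mem_nhds_iff.1 (h.and (ball_mem_nhds a hδ))
      obtain ⟨z, hz1, hz2⟩ := nonempty_unitDisk_inter_ball ha hr
      obtain ⟨h3, h4⟩ := hsub hz2
      obtain ⟨h5, h6⟩ := hi z h4 hz1
      have h7 : ‖φ z‖ < 1 := hφ.2.mapsTo h5
      rw [← h6, h3, hc a (mem_ball_self hδ) ha] at h7
      exact lt_irrefl _ h7
    · exact h
  have hder : ∀ (a : ℂ) (δ : ℝ) (H ψ : ℂ → ℂ), ‖a‖ = 1 → 0 < δ → DifferentiableOn ℂ H (ball a δ) →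
      (∀ z ∈ ball a δ, ‖z‖ < 1 → z ∈ V ∧ H z = φ z) → EqOn ψ φ V → ψ a = H a →
      HasDerivWithinAt ψ (deriv H a) V a := by
    intro a δ H ψ ha hδ hH hi hψ hψa
    have hHa : HasDerivAt H (deriv H a) a :=
      (hH.differentiableAt (isOpen_ball.mem_nhds (mem_ball_self hδ))).hasDerivAt
    refine hHa.hasDerivWithinAt.congr_of_eventuallyEq ?_ hψa
    filter_upwards [self_mem_nhdsWithin, nhdsWithin_le_nhds (ball_mem_nhds a hδ)] with z hz hz2
    rw [hψ hz, (hi z hz2 (hVU hz)).2]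
  set ψ : ℂ → ℂ := Function.update (Function.update φ z₁ (H₁ z₁)) z₂ (H₂ z₂) with hψ
  have hψ₂ : ψ z₂ = H₂ z₂ := by simp [hψ]
  have hψ₁ : ψ z₁ = H₁ z₁ := by rw [hψ, Function.update_of_ne hne]; simp
  have hψV : EqOn ψ φ V := fun z hz => by
    rw [hψ, Function.update_of_ne, Function.update_of_ne]
    · rintro rfl; exact hn _ hz₁ hz
    · rintro rfl; exact hn _ hz₂ hz
  refine ⟨ψ, deriv H₁ z₁, deriv H₂ z₂, ⟨hφ.1.congr hψV, hφ.2.congr hψV.symm⟩, ?_, ?_, ?_,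
    hder z₁ δ₁ H₁ ψ hz₁ hδ₁ hH₁ hi₁ hψV hψ₁, hder z₂ δ₂ H₂ ψ hz₂ hδ₂ hH₂ hi₂ hψV hψ₂⟩
  · rw [hψ₁]; exact hc₁ z₁ (mem_ball_self hδ₁) hz₁
  · rw [hψ₂]; exact hc₂ z₂ (mem_ball_self hδ₂) hz₂
  rw [hψ₁, hψ₂]
  intro heq
  -- If the boundary values agreed, the reflected maps would send disjoint balls about `z₁` and `z₂`
  -- onto neighbourhoods of the same point of the circle. A nearby value inside the disk would then
  -- have two preimages in `V`.
  obtain ⟨s, hs, hs1, hs2⟩ : ∃ s > 0, s ≤ δ₁ ∧ s ≤ δ₂ ∧ s ≤ dist z₁ z₂ / 2 :=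
    ⟨min (min δ₁ δ₂) (dist z₁ z₂ / 2), by
      have := dist_pos.2 hne
      positivity, (min_le_left _ _).trans (min_le_left _ _),
      (min_le_left _ _).trans (min_le_right _ _), min_le_right _ _⟩
  have n₁ : H₁ '' ball z₁ s ∈ 𝓝 (H₁ z₁) :=
    hH z₁ δ₁ H₁ hz₁ hδ₁ hH₁ hi₁ hc₁ (image_mem_map (ball_mem_nhds z₁ hs))
  have n₂ : H₂ '' ball z₂ s ∈ 𝓝 (H₁ z₁) := by
    rw [heq]
    exact hH z₂ δ₂ H₂ hz₂ hδ₂ hH₂ hi₂ hc₂ (image_mem_map (ball_mem_nhds z₂ hs))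
  obtain ⟨r, hr, hsub⟩ := Metric.mem_nhds_iff.1 (inter_mem n₁ n₂)
  obtain ⟨w, hw1, hw2⟩ := nonempty_unitDisk_inter_ball (hc₁ z₁ (mem_ball_self hδ₁) hz₁) hr
  have hw1' : ‖w‖ < 1 := hw1
  obtain ⟨⟨y₁, hy₁, hw₁⟩, y₂, hy₂, hw₂⟩ := hsub hw2
  have hin : ∀ (a : ℂ) (δ : ℝ) (H : ℂ → ℂ) (y : ℂ), (∀ z ∈ ball a δ, ‖z‖ = 1 → ‖H z‖ = 1) →
      (∀ z ∈ ball a δ, 1 < ‖z‖ → 1 < ‖H z‖) → y ∈ ball a δ → H y = w → ‖y‖ < 1 := by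
    intro a δ H y hc ho hy hyw
    by_contra! hge
    rcases hge.eq_or_lt with h | h
    · have := hc y hy h.symm
      rw [hyw] at this; linarith
    · have := ho y hy h
      rw [hyw] at this; linarith
  have hb₁ := ball_subset_ball hs1 hy₁
  have hb₂ := ball_subset_ball hs2.1 hy₂
  obtain ⟨hv₁, he₁⟩ := hi₁ y₁ hb₁ (hin z₁ δ₁ H₁ y₁ hc₁ ho₁ hb₁ hw₁)
  obtain ⟨hv₂, he₂⟩ := hi₂ y₂ hb₂ (hin z₂ δ₂ H₂ y₂ hc₂ ho₂ hb₂ hw₂)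
  have hyy : y₁ = y₂ := hφ.2.injOn hv₁ hv₂ (by rw [← he₁, ← he₂, hw₁, hw₂])
  rw [← hyy] at hy₂
  have := dist_triangle_left z₁ z₂ y₁
  rw [mem_ball] at hy₁ hy₂
  linarith [hs2.2]

/-! ### Free subdomains and the restriction formula in charts -/

/-- An open subset `W` of the annulus with connected complement which contains a one-sided
neighbourhood of `z₁` and of `z₂` in the disk. -/
structure IsFreeAt (q : ℝ) (z₁ z₂ : ℂ) (W : Set ℂ) : Prop where
  isOpen : IsOpen W
  subset : W ⊆ annulus q
  compl : IsPreconnected Wᶜ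
  exists_ball : ∃ ε > 0, unitDisk ∩ ball z₁ ε ⊆ W ∧ unitDisk ∩ ball z₂ ε ⊆ W

theorem annulus_subset_unitDisk (q : ℝ) : annulus q ⊆ unitDisk := fun _ hz => hz.2

/-- The complement of the intersection is a union of two connected sets sharing the point 1. The
intersection itself may be disconnected, which is why connectedness is not part of `IsFreeAt`. -/
theorem IsFreeAt.inter {q : ℝ} {z₁ z₂ : ℂ} {W W' : Set ℂ} (h : IsFreeAt q z₁ z₂ W)
    (h' : IsFreeAt q z₁ z₂ W') : IsFreeAt q z₁ z₂ (W ∩ W') := by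
  refine ⟨h.isOpen.inter h'.isOpen, inter_subset_left.trans h.subset, ?_, ?_⟩
  · rw [compl_inter]
    refine IsPreconnected.union 1 ?_ ?_ h.compl h'.compl
    · exact fun h1 => by simpa using (h.subset h1).2
    · exact fun h1 => by simpa using (h'.subset h1).2
  · obtain ⟨ε, hε, h₁, h₂⟩ := h.exists_ball
    obtain ⟨ε', hε', h₁', h₂'⟩ := h'.exists_ball
    have hl (x : ℂ) := ball_subset_ball (x := x) (min_le_left ε ε')
    have hr (x : ℂ) := ball_subset_ball (x := x) (min_le_right ε ε')
    exact ⟨min ε ε', lt_min hε hε',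
      fun z hz => ⟨h₁ ⟨hz.1, hl _ hz.2⟩, h₁' ⟨hz.1, hr _ hz.2⟩⟩,
      fun z hz => ⟨h₂ ⟨hz.1, hl _ hz.2⟩, h₂' ⟨hz.1, hr _ hz.2⟩⟩⟩

/-- `k` maps the subdomain `Ω` of `D` conformally onto the annulus `A_q`. The boundary points `e₁`,
`e₂` of `D` are free boundary points of `Ω`, at which `k` has boundary values `z₁`, `z₂` on the unit
circle and derivatives `κ₁`, `κ₂`. -/
structure IsEndChart (q : ℝ) (z₁ z₂ : ℂ) (D : Set ℂ) (e₁ e₂ : ℂ) (Ω : Set ℂ) (k : ℂ → ℂ)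
    (κ₁ κ₂ : ℂ) : Prop where
  norm₁ : ‖z₁‖ = 1
  norm₂ : ‖z₂‖ = 1
  ne : z₁ ≠ z₂
  isOpen : IsOpen Ω
  subset : Ω ⊆ D
  conformal : MapsConformallyOnto k Ω (annulus q)
  map₁ : k e₁ = z₁
  map₂ : k e₂ = z₂
  deriv₁ : HasDerivWithinAt k κ₁ Ω e₁
  deriv₂ : HasDerivWithinAt k κ₂ Ω e₂
  free₁ : ∃ δ > 0, D ∩ ball e₁ δ ⊆ Ω
  free₂ : ∃ δ > 0, D ∩ ball e₂ δ ⊆ Ω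
  chart : ∀ a₁ a₂ : ℂ, ‖a₁‖ = 1 → ‖a₂‖ = 1 → a₁ ≠ a₂ → ∃ N, IsDiskChart N D a₁ a₂ e₁ e₂

namespace IsEndChart

variable {q : ℝ} {z₁ z₂ : ℂ} {D : Set ℂ} {e₁ e₂ : ℂ} {Ω : Set ℂ} {k : ℂ → ℂ} {κ₁ κ₂ : ℂ}

theorem swap (h : IsEndChart q z₁ z₂ D e₁ e₂ Ω k κ₁ κ₂) :
    IsEndChart q z₂ z₁ D e₂ e₁ Ω k κ₂ κ₁ := by
  refine ⟨h.norm₂, h.norm₁, h.ne.symm, h.isOpen, h.subset, h.conformal, h.map₂, h.map₁, h.deriv₂,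
    h.deriv₁, h.free₂, h.free₁, fun a₁ a₂ h₁ h₂ hne => ?_⟩
  obtain ⟨N, hN, hN1, hN2, n₁, n₂, hn₁, hn₂, hn⟩ := h.chart a₂ a₁ h₂ h₁ hne.symm
  exact ⟨N, hN, hN2, hN1, n₂, n₁, hn₂, hn₁, by
    rw [norm_sub_rev e₂, norm_sub_rev a₁, hn, mul_comm n₁]⟩

theorem isOpen_inter_preimage (h : IsEndChart q z₁ z₂ D e₁ e₂ Ω k κ₁ κ₂) {V : Set ℂ}
    (hV : IsOpen V) : IsOpen (Ω ∩ k ⁻¹' V) :=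
  h.conformal.1.continuousOn.isOpen_inter_preimage h.isOpen hV

theorem exists_ball_subset (h : IsEndChart q z₁ z₂ D e₁ e₂ Ω k κ₁ κ₂) {V : Set ℂ} {ε : ℝ}
    (hε : 0 < ε) (hV : unitDisk ∩ ball z₁ ε ⊆ V) :
    ∃ δ > 0, D ∩ ball e₁ δ ⊆ Ω ∩ k ⁻¹' V := by
  have hc := h.deriv₁.continuousWithinAt.tendsto
  rw [h.map₁] at hc
  obtain ⟨r, hr, hsub⟩ := Metric.mem_nhdsWithin_iff.1 (hc (ball_mem_nhds z₁ hε))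
  obtain ⟨δ, hδ, hδΩ⟩ := h.free₁
  refine ⟨min r δ, lt_min hr hδ, fun z hz => ?_⟩
  have hzΩ : z ∈ Ω := hδΩ ⟨hz.1, ball_subset_ball (min_le_right r δ) hz.2⟩
  exact ⟨hzΩ, hV ⟨(h.conformal.2.mapsTo hzΩ).2,
    hsub ⟨ball_subset_ball (min_le_left r δ) hz.2, hzΩ⟩⟩⟩

/-- The value of the restriction measure on the preimage of a conformal disk in the annulus. -/
theorem restriction_conformal (h : IsEndChart q z₁ z₂ D e₁ e₂ Ω k κ₁ κ₂) {V : Set ℂ}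
    (hV : IsOpen V) (hVA : V ⊆ annulus q) {ε : ℝ} (hε : 0 < ε) (h₁ : unitDisk ∩ ball z₁ ε ⊆ V)
    (h₂ : unitDisk ∩ ball z₂ ε ⊆ V) {ψ : ℂ → ℂ} {d₁ d₂ : ℂ} (hψ : MapsConformallyOnto ψ V unitDisk)
    (hn₁ : ‖ψ z₁‖ = 1) (hn₂ : ‖ψ z₂‖ = 1) (hne : ψ z₁ ≠ ψ z₂) (hd₁ : HasDerivWithinAt ψ d₁ V z₁)
    (hd₂ : HasDerivWithinAt ψ d₂ V z₂) {b : ℝ} {P : Measure (Hull D e₁ e₂)}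
    (hP : IsRestrictionMeasure b D e₁ e₂ P) :
    P.real (staysIn (Ω ∩ k ⁻¹' V)) =
      (‖d₁ * d₂‖ / ‖ψ z₁ - ψ z₂‖ ^ 2) ^ b * (‖e₁ - e₂‖ ^ 2 * ‖κ₁ * κ₂‖) ^ b := by
  -- `N` carries the boundary values of `ψ` back to `e₁` and `e₂`, so `N ∘ ψ ∘ k` is admissible in
  -- the restriction formula. The chart relation eliminates the derivatives of `N`.
  obtain ⟨N, hN, hN1, hN2, n₁, n₂, hn₁', hn₂', hn⟩ := h.chart _ _ hn₁ hn₂ hne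
  have hmaps : MapsTo k (Ω ∩ k ⁻¹' V) V := fun z hz => hz.2
  have hk : MapsConformallyOnto k (Ω ∩ k ⁻¹' V) V := by
    refine ⟨h.conformal.1.mono inter_subset_left, hmaps,
      h.conformal.2.injOn.mono inter_subset_left, fun w hw => ?_⟩
    obtain ⟨z, hz, rfl⟩ := h.conformal.2.surjOn (hVA hw)
    exact ⟨z, ⟨hz, hw⟩, rfl⟩
  have hcl : ∀ e : ℂ, (∃ δ > 0, D ∩ ball e δ ⊆ Ω ∩ k ⁻¹' V) → e ∉ closure (D \ (Ω ∩ k ⁻¹' V)) := by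
    rintro e ⟨δ, hδ, hsub⟩ he
    obtain ⟨z, hz, hz2, hz3⟩ := mem_closure_iff.1 he _ isOpen_ball (mem_ball_self hδ)
    exact hz3 (hsub ⟨hz2, hz⟩)
  have hder₁ : HasDerivWithinAt (N ∘ ψ ∘ k) (n₁ * (d₁ * κ₁)) (Ω ∩ k ⁻¹' V) e₁ := by
    refine HasDerivAt.comp_hasDerivWithinAt (h₂ := N) e₁ ?_ (HasDerivWithinAt.comp (h₂ := ψ) e₁ ?_
      (h.deriv₁.mono inter_subset_left) hmaps)
    · simpa [h.map₁] using hn₁'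
    · rwa [h.map₁]
  have hder₂ : HasDerivWithinAt (N ∘ ψ ∘ k) (n₂ * (d₂ * κ₂)) (Ω ∩ k ⁻¹' V) e₂ := by
    refine HasDerivAt.comp_hasDerivWithinAt (h₂ := N) e₂ ?_ (HasDerivWithinAt.comp (h₂ := ψ) e₂ ?_
      (h.deriv₂.mono inter_subset_left) hmaps)
    · simpa [h.map₂] using hn₂'
    · rwa [h.map₂]
  have hval := hP.restriction (Ω ∩ k ⁻¹' V) (N ∘ ψ ∘ k) _ _ (h.isOpen_inter_preimage hV)
    (inter_subset_left.trans h.subset) (hcl e₁ (h.exists_ball_subset hε h₁))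
    (hcl e₂ (h.swap.exists_ball_subset hε h₂)) (hN.comp (hψ.comp hk))
    (by simp [h.map₁, hN1]) (by simp [h.map₂, hN2]) hder₁ hder₂
  rw [hval, ← Real.mul_rpow (by positivity) (by positivity), hn]
  congr 1
  have : ‖ψ z₁ - ψ z₂‖ ≠ 0 := norm_ne_zero_iff.2 (sub_ne_zero.2 hne)
  simp only [norm_mul]
  field_simp

theorem mem_of_hull {γ : Set ℂ} (hγ : IsHull D e₁ e₂ γ) : e₁ ∈ γ ∧ e₂ ∈ γ := by
  have h1 : e₁ ∈ γ ∩ frontier D := by rw [hγ.2.2.2.2]; simp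
  have h2 : e₂ ∈ γ ∩ frontier D := by rw [hγ.2.2.2.2]; simp
  exact ⟨h1.1, h2.1⟩

/-- A hull in the preimage of `W` stays in the preimage of a component of `W`, if that component
touches both `z₁` and `z₂`. -/
theorem staysIn_eq (h : IsEndChart q z₁ z₂ D e₁ e₂ Ω k κ₁ κ₂) {V W : Set ℂ} (hV : IsOpen V)
    (hVW : V ⊆ W) (hWV : IsOpen (W \ V)) {ε : ℝ} (hε : 0 < ε)
    (h₁ : unitDisk ∩ ball z₁ ε ⊆ V) (h₂ : unitDisk ∩ ball z₂ ε ⊆ V) :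
    (staysIn (Ω ∩ k ⁻¹' W) : Set (Hull D e₁ e₂)) = staysIn (Ω ∩ k ⁻¹' V) := by
  refine Subset.antisymm ?_ fun γ hγ => hγ.trans (inter_subset_inter_right _ (preimage_mono hVW))
  rintro ⟨γ, hγ⟩ hs
  change γ \ {e₁, e₂} ⊆ _ at hs
  change γ \ {e₁, e₂} ⊆ _
  obtain ⟨δ₁, hδ₁, hs₁⟩ := h.exists_ball_subset hε h₁
  obtain ⟨δ₂, hδ₂, hs₂⟩ := h.swap.exists_ball_subset hε h₂
  obtain ⟨he₁, he₂⟩ := mem_of_hull hγ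
  have hA := h.isOpen_inter_preimage hV
  have hB := h.isOpen_inter_preimage hWV
  -- The small balls supply open neighbourhoods of the endpoints, which lie outside `Ω ∩ k ⁻¹' W`.
  -- Inside `D` they meet only the preimage of `V`, so connectedness of the hull applies.
  have hsub : γ ⊆ (Ω ∩ k ⁻¹' V) ∪ (ball e₁ δ₁ ∪ ball e₂ δ₂) := by
    refine hγ.2.1.isPreconnected.subset_left_of_subset_union
      (v := Ω ∩ k ⁻¹' (W \ V)) (hA.union (isOpen_ball.union isOpen_ball)) hB ?_ ?_ ?_
    · rw [disjoint_left]
      rintro z (hz | hz | hz) hz2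
      · exact hz2.2.2 hz.2
      · exact hz2.2.2 (hs₁ ⟨h.subset hz2.1, hz⟩).2
      · exact hz2.2.2 (hs₂ ⟨h.subset hz2.1, hz⟩).2
    · intro z hz
      by_cases hz1 : z = e₁
      · exact Or.inl (Or.inr (Or.inl (hz1 ▸ mem_ball_self hδ₁)))
      by_cases hz2 : z = e₂
      · exact Or.inl (Or.inr (Or.inr (hz2 ▸ mem_ball_self hδ₂)))
      have hzW := hs ⟨hz, by simp [hz1, hz2]⟩
      by_cases hzV : k z ∈ V
      · exact Or.inl (Or.inl ⟨hzW.1, hzV⟩)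
      · exact Or.inr ⟨hzW.1, hzW.2, hzV⟩
    · exact ⟨e₁, he₁, Or.inr (Or.inl (mem_ball_self hδ₁))⟩
  intro z hz
  have hzΩ := (hs hz).1
  rcases hsub hz.1 with hz' | hz' | hz'
  · exact hz'
  · exact hs₁ ⟨h.subset hzΩ, hz'⟩
  · exact hs₂ ⟨h.subset hzΩ, hz'⟩

/-- No hull stays in the preimage of `W` if `z₁` and `z₂` touch different components. -/
theorem staysIn_eq_empty (h : IsEndChart q z₁ z₂ D e₁ e₂ Ω k κ₁ κ₂) {V W : Set ℂ} (hV : IsOpen V)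
    (hWV : IsOpen (W \ V)) {ε : ℝ} (hε : 0 < ε) (he : e₁ ≠ e₂)
    (h₁ : unitDisk ∩ ball z₁ ε ⊆ V) (h₂ : unitDisk ∩ ball z₂ ε ⊆ W \ V) :
    (staysIn (Ω ∩ k ⁻¹' W) : Set (Hull D e₁ e₂)) = ∅ := by
  refine eq_empty_of_forall_notMem ?_
  rintro ⟨γ, hγ⟩ hs
  change γ \ {e₁, e₂} ⊆ _ at hs
  obtain ⟨δ₁', hδ₁', hs₁'⟩ := h.exists_ball_subset hε h₁
  obtain ⟨δ₂', hδ₂', hs₂'⟩ := h.swap.exists_ball_subset hε h₂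
  have hd := dist_pos.2 he
  obtain ⟨δ, hδ, hδ1, hδ2, hδ3⟩ : ∃ δ > 0, δ ≤ δ₁' ∧ δ ≤ δ₂' ∧ δ ≤ dist e₁ e₂ / 2 :=
    ⟨min (min δ₁' δ₂') (dist e₁ e₂ / 2), by positivity,
      (min_le_left _ _).trans (min_le_left _ _),
      (min_le_left _ _).trans (min_le_right _ _), min_le_right _ _⟩
  have hs₁ := (inter_subset_inter_right D (ball_subset_ball (x := e₁) hδ1)).trans hs₁'
  have hs₂ := (inter_subset_inter_right D (ball_subset_ball (x := e₂) hδ2)).trans hs₂'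
  obtain ⟨he₁, he₂⟩ := mem_of_hull hγ
  have hA := h.isOpen_inter_preimage hV
  have hB := h.isOpen_inter_preimage hWV
  have hdisj : Disjoint ((Ω ∩ k ⁻¹' V) ∪ ball e₁ δ) ((Ω ∩ k ⁻¹' (W \ V)) ∪ ball e₂ δ) := by
    rw [disjoint_left]
    rintro z (hz | hz) (hz2 | hz2)
    · exact hz2.2.2 hz.2
    · exact (hs₂ ⟨h.subset hz.1, hz2⟩).2.2 hz.2
    · exact hz2.2.2 (hs₁ ⟨h.subset hz2.1, hz⟩).2
    · rw [mem_ball] at hz hz2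
      have := dist_triangle_left e₁ e₂ z
      linarith
  have hsub : γ ⊆ (Ω ∩ k ⁻¹' V) ∪ ball e₁ δ := by
    refine hγ.2.1.isPreconnected.subset_left_of_subset_union
      (v := (Ω ∩ k ⁻¹' (W \ V)) ∪ ball e₂ δ) (hA.union isOpen_ball) (hB.union isOpen_ball) hdisj ?_ ?_
    · intro z hz
      by_cases hz1 : z = e₁
      · exact Or.inl (Or.inr (hz1 ▸ mem_ball_self hδ))
      by_cases hz2 : z = e₂
      · exact Or.inr (Or.inr (hz2 ▸ mem_ball_self hδ))
      have hzW := hs ⟨hz, by simp [hz1, hz2]⟩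
      by_cases hzV : k z ∈ V
      · exact Or.inl (Or.inl ⟨hzW.1, hzV⟩)
      · exact Or.inr (Or.inl ⟨hzW.1, hzW.2, hzV⟩)
    · exact ⟨e₁, he₁, Or.inr (mem_ball_self hδ)⟩
  exact disjoint_left.1 hdisj (hsub he₂) (Or.inr (mem_ball_self hδ))

theorem ends_ne (h : IsEndChart q z₁ z₂ D e₁ e₂ Ω k κ₁ κ₂) : e₁ ≠ e₂ := by
  rintro rfl
  exact h.ne (h.map₁.symm.trans h.map₂)

end IsEndChart

/-- The probability that the hull stays in the preimage of `W` depends on the chart only through a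
factor that is the same for all `W`. -/
theorem IsFreeAt.exists_restriction {q : ℝ} {z₁ z₂ : ℂ} {W : Set ℂ} (hW : IsFreeAt q z₁ z₂ W)
    (b : ℝ) : ∃ v : ℝ, ∀ (D : Set ℂ) (e₁ e₂ : ℂ) (Ω : Set ℂ) (k : ℂ → ℂ) (κ₁ κ₂ : ℂ)
      (P : Measure (Hull D e₁ e₂)), IsEndChart q z₁ z₂ D e₁ e₂ Ω k κ₁ κ₂ →
      IsRestrictionMeasure b D e₁ e₂ P →
      P.real (staysIn (Ω ∩ k ⁻¹' W)) = v * (‖e₁ - e₂‖ ^ 2 * ‖κ₁ * κ₂‖) ^ b := by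
  by_cases hz : ‖z₁‖ = 1 ∧ ‖z₂‖ = 1 ∧ z₁ ≠ z₂
  swap
  · exact ⟨0, fun D e₁ e₂ Ω k κ₁ κ₂ P h => absurd ⟨h.norm₁, h.norm₂, h.ne⟩ hz⟩
  obtain ⟨hz₁, hz₂, hne⟩ := hz
  obtain ⟨ε, hε, h₁, h₂⟩ := hW.exists_ball
  obtain ⟨p, hp⟩ := nonempty_unitDisk_inter_ball hz₁ hε
  have hV₁ : unitDisk ∩ ball z₁ ε ⊆ connectedComponentIn W p :=
    (isPreconnected_unitDisk_inter_ball _ _).subset_connectedComponentIn hp h₁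
  obtain ⟨p', hp'⟩ := nonempty_unitDisk_inter_ball hz₂ hε
  have hV₂ : unitDisk ∩ ball z₂ ε ⊆ connectedComponentIn W p' :=
    (isPreconnected_unitDisk_inter_ball _ _).subset_connectedComponentIn hp' h₂
  have hVo : IsOpen (connectedComponentIn W p) := hW.isOpen.connectedComponentIn
  have hWV := isOpen_diff_connectedComponentIn hW.isOpen p
  have hVW := connectedComponentIn_subset W p
  -- Either one component touches both marked points and the restriction formula applies to it, or
  -- no hull fits and the factor is zero in every chart.
  by_cases hpp : p' ∈ connectedComponentIn W p
  · rw [← connectedComponentIn_eq hpp] at hV₂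
    obtain ⟨φ, hφ⟩ := exists_mapsConformallyOnto_connectedComponentIn hW.isOpen
      (isBounded_ball.subset (by
        rw [← unitDisk_eq_ball]; exact hW.subset.trans (annulus_subset_unitDisk q)))
      hW.compl (h₁ hp)
    obtain ⟨ψ, d₁, d₂, hψ, hn₁, hn₂, hn, hd₁, hd₂⟩ := hφ.exists_boundary_values hVo
      (hVW.trans (hW.subset.trans (annulus_subset_unitDisk q))) hz₁ hz₂ hne hε hV₁ hV₂
    refine ⟨(‖d₁ * d₂‖ / ‖ψ z₁ - ψ z₂‖ ^ 2) ^ b, fun D e₁ e₂ Ω k κ₁ κ₂ P h hP => ?_⟩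
    rw [h.staysIn_eq hVo hVW hWV hε hV₁ hV₂]
    exact h.restriction_conformal hVo (hVW.trans hW.subset) hε hV₁ hV₂ hψ hn₁ hn₂ hn hd₁ hd₂ hP
  · refine ⟨0, fun D e₁ e₂ Ω k κ₁ κ₂ P h hP => ?_⟩
    rw [h.staysIn_eq_empty hVo hWV hε h.ends_ne hV₁ ?_]
    · simp
    intro z hz
    refine ⟨h₂ hz, fun hzV => hpp ?_⟩
    rw [connectedComponentIn_eq hzV, ← connectedComponentIn_eq (hV₂ hz)]
    exact mem_connectedComponentIn (h₂ hp')

/-! ### A countable family of free subdomains -/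

/-- A finite union of closed disks from a countable family. -/
noncomputable def diskUnion (S : Finset (ℕ × ℕ)) : Set ℂ :=
  ⋃ p ∈ S, closedBall (TopologicalSpace.denseSeq ℂ p.1) (1 / (p.2 + 1))

/-- The complement in the annulus of a finite union of closed disks. -/
noncomputable def diskUnionCompl (q : ℝ) (S : Finset (ℕ × ℕ)) : Set ℂ :=
  unitDisk \ (closedBall 0 q ∪ diskUnion S)

theorem isClosed_diskUnion (S : Finset (ℕ × ℕ)) : IsClosed (diskUnion S) :=
  S.finite_toSet.isClosed_biUnion fun _ _ => isClosed_closedBall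

theorem mem_diskUnionCompl {q : ℝ} {S : Finset (ℕ × ℕ)} {z : ℂ} :
    z ∈ diskUnionCompl q S ↔ z ∈ annulus q ∧ z ∉ diskUnion S := by
  simp only [diskUnionCompl, annulus, unitDisk, Set.mem_sdiff, mem_ofPred_eq, mem_union,
    mem_closedBall_zero_iff, not_or, not_le]
  tauto

theorem exists_closedBall_denseSeq {V : Set ℂ} (hV : IsOpen V) {x : ℂ} (hx : x ∈ V) :
    ∃ p : ℕ × ℕ, x ∈ ball (TopologicalSpace.denseSeq ℂ p.1) (1 / (p.2 + 1)) ∧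
      closedBall (TopologicalSpace.denseSeq ℂ p.1) (1 / (p.2 + 1)) ⊆ V := by
  obtain ⟨ε, hε, hsub⟩ := Metric.isOpen_iff.1 hV x hx
  obtain ⟨m, hm⟩ := exists_nat_one_div_lt (half_pos hε)
  obtain ⟨n, hn⟩ := (TopologicalSpace.denseRange_denseSeq ℂ).exists_dist_lt x
    (show (0 : ℝ) < 1 / (m + 1) by positivity)
  refine ⟨(n, m), hn, fun y hy => hsub ?_⟩
  rw [mem_closedBall] at hy
  rw [mem_ball]
  have := dist_triangle_right y x (TopologicalSpace.denseSeq ℂ n)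
  linarith

/-- A closed set which does not separate the inner disk from the exterior of the unit disk can be
avoided by a free subdomain of the countable family. -/
theorem exists_isFreeAt_diskUnionCompl {q : ℝ} (hq : 0 ≤ q) {z₁ z₂ : ℂ} {Γ : Set ℂ}
    (hΓ : IsClosed Γ) (hz₁ : z₁ ∈ Γ) (hz₂ : z₂ ∈ Γ) (hn₁ : q < ‖z₁‖) (hn₂ : q < ‖z₂‖)
    {p : ℂ} (hp : 1 ≤ ‖p‖)
    (h0 : (0 : ℂ) ∈ Γᶜ) (hpV : p ∈ connectedComponentIn Γᶜ 0) :
    ∃ S, IsFreeAt q z₁ z₂ (diskUnionCompl q S) ∧ Disjoint Γ (diskUnion S) := by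
  set V := connectedComponentIn Γᶜ 0 with hV
  have hVo : IsOpen V := hΓ.isOpen_compl.connectedComponentIn
  have hVc : IsConnected V := isConnected_connectedComponentIn_iff.2 h0
  have h0V : (0 : ℂ) ∈ V := mem_connectedComponentIn h0
  obtain ⟨γ, hγ⟩ := (hVo.isConnected_iff_isPathConnected.1 hVc).joinedIn 0 h0V p hpV
  have hR : IsCompact (range γ) := isCompact_range γ.continuous
  have hRc : IsPreconnected (range γ) := isPreconnected_range γ.continuous
  have h0R : (0 : ℂ) ∈ range γ := ⟨0, γ.source⟩
  have hpR : p ∈ range γ := ⟨1, γ.target⟩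
  -- Only disks that meet the path are used, so that adding them to the path keeps the union
  -- connected; lying in `V` keeps them off `Γ`.
  let ι := {i : ℕ × ℕ // closedBall (TopologicalSpace.denseSeq ℂ i.1) (1 / (i.2 + 1)) ⊆ V ∧
    (closedBall (TopologicalSpace.denseSeq ℂ i.1) (1 / (i.2 + 1)) ∩ range γ).Nonempty}
  obtain ⟨t, ht⟩ := hR.elim_finite_subcover
    (fun i : ι => ball (TopologicalSpace.denseSeq ℂ i.1.1) (1 / (i.1.2 + 1)))
    (fun i => isOpen_ball) (by
      rintro x ⟨s, rfl⟩
      obtain ⟨i, hi, hiV⟩ := exists_closedBall_denseSeq hVo (hγ s)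
      exact mem_iUnion.2 ⟨⟨i, hiV, γ s, ball_subset_closedBall hi, s, rfl⟩, hi⟩)
  set S : Finset (ℕ × ℕ) := t.map (Function.Embedding.subtype _) with hS
  have hSi : ∀ i ∈ S, closedBall (TopologicalSpace.denseSeq ℂ i.1) (1 / (i.2 + 1)) ⊆ V ∧
      (closedBall (TopologicalSpace.denseSeq ℂ i.1) (1 / (i.2 + 1)) ∩ range γ).Nonempty := by
    intro i hi
    obtain ⟨j, -, rfl⟩ := Finset.mem_map.1 hi
    exact j.2
  have hRS : range γ ⊆ diskUnion S := fun x hx => by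
    obtain ⟨i, hi, hxi⟩ := mem_iUnion₂.1 (ht hx)
    exact mem_iUnion₂.2 ⟨i.1, Finset.mem_map_of_mem _ hi, ball_subset_closedBall hxi⟩
  have hSV : diskUnion S ⊆ V := iUnion₂_subset fun i hi => (hSi i hi).1
  have hdisj : Disjoint Γ (diskUnion S) := disjoint_left.2 fun z hz hzS =>
    connectedComponentIn_subset _ _ (hSV hzS) hz
  have hcl : IsClosed (closedBall (0 : ℂ) q ∪ diskUnion S) :=
    isClosed_closedBall.union (isClosed_diskUnion S)
  have hball : ∀ z : ℂ, z ∈ Γ → q < ‖z‖ →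
      ∃ ε > 0, unitDisk ∩ ball z ε ⊆ diskUnionCompl q S := by
    intro z hz hqz
    have hzc : z ∈ (closedBall (0 : ℂ) q ∪ diskUnion S)ᶜ := by
      rintro (h | h)
      · rw [mem_closedBall_zero_iff] at h; linarith
      · exact disjoint_left.1 hdisj hz h
    obtain ⟨ε, hε, hsub⟩ := Metric.isOpen_iff.1 hcl.isOpen_compl z hzc
    exact ⟨ε, hε, fun y hy => ⟨hy.1, hsub hy.2⟩⟩
  obtain ⟨ε₁, hε₁, hs₁⟩ := hball z₁ hz₁ hn₁
  obtain ⟨ε₂, hε₂, hs₂⟩ := hball z₂ hz₂ hn₂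
  refine ⟨S, ⟨isOpen_unitDisk.sdiff hcl, fun z hz => (mem_diskUnionCompl.1 hz).1, ?_,
    min ε₁ ε₂, lt_min hε₁ hε₂,
    (inter_subset_inter_right _ (ball_subset_ball (min_le_left _ _))).trans hs₁,
    (inter_subset_inter_right _ (ball_subset_ball (min_le_right _ _))).trans hs₂⟩, hdisj⟩
  have hun : ∀ X : Set ℂ, IsPreconnected X → (X ∩ range γ).Nonempty →
      IsPreconnected (range γ ∪ X) := by
    rintro X hX ⟨x, hxX, hxR⟩
    exact hRc.union x hxR hxX hX
  -- Every removed piece, the exterior and the inner disk included, meets the path, so all of them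
  -- joined to the path share the point 0.
  have hpre : IsPreconnected (((range γ ∪ unitDiskᶜ) ∪ (range γ ∪ closedBall 0 q)) ∪
      (range γ ∪ diskUnion S)) := by
    refine IsPreconnected.union 0 (Or.inl (Or.inl h0R)) (Or.inl h0R)
      (IsPreconnected.union 0 (Or.inl h0R) (Or.inl h0R) ?_ ?_) ?_
    · refine hun _ isPreconnected_compl_unitDisk ⟨p, ?_, hpR⟩
      exact not_lt.2 hp
    · exact hun _ (convex_closedBall _ _).isPreconnected ⟨0, by simpa using hq, h0R⟩
    · have : range γ ∪ diskUnion S = ⋃₀ (insert (range γ) ((fun i : ℕ × ℕ =>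
          range γ ∪ closedBall (TopologicalSpace.denseSeq ℂ i.1) (1 / (i.2 + 1))) '' S)) := by
        ext z
        simp only [diskUnion, mem_union, mem_iUnion, exists_prop, sUnion_insert, sUnion_image,
          Finset.mem_coe]
        constructor
        · rintro (h | ⟨i, hi, h⟩)
          exacts [Or.inl h, Or.inr ⟨i, hi, Or.inr h⟩]
        · rintro (h | ⟨i, hi, h | h⟩)
          exacts [Or.inl h, Or.inl h, Or.inr ⟨i, hi, h⟩]
      rw [this]
      refine isPreconnected_sUnion 0 _ ?_ ?_
      · rintro X (rfl | ⟨i, hi, rfl⟩)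
        exacts [h0R, Or.inl h0R]
      · rintro X (rfl | ⟨i, hi, rfl⟩)
        exacts [hRc, hun _ (convex_closedBall _ _).isPreconnected (hSi i hi).2]
  refine (congrArg IsPreconnected ?_).mp hpre
  ext z
  have := @hRS z
  simp only [diskUnionCompl, mem_union, mem_compl_iff, Set.mem_sdiff]
  tauto

/-! ### Measurability -/

theorem measurableSet_avoids {D : Set ℂ} {e₁ e₂ : ℂ} {C : Set ℂ} (hC : IsClosed C) :
    MeasurableSet (avoids C : Set (Hull D e₁ e₂)) := by
  have : (avoids C : Set (Hull D e₁ e₂)) = ⋂ n : ℕ, avoids (C ∩ closedBall 0 n) := by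
    ext γ
    simp only [avoids, mem_iInter, mem_ofPred_eq]
    constructor
    · exact fun h n => subset_empty_iff.1 (h ▸ inter_subset_inter_right _ inter_subset_left)
    · intro h
      refine eq_empty_of_forall_notMem fun z hz => ?_
      obtain ⟨n, hn⟩ := exists_nat_ge ‖z‖
      have : z ∈ γ.1 ∩ (C ∩ closedBall 0 n) := ⟨hz.1, hz.2, by simpa using hn⟩
      rw [h n] at this
      exact this
  rw [this]
  refine MeasurableSet.iInter fun n => MeasurableSpace.measurableSet_generateFrom ?_
  exact ⟨_, (isCompact_closedBall _ _).inter_left hC, rfl⟩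

/-- A hull meets the boundary only at its endpoints, so when these are away from `D \ D'`, staying
in `D'` amounts to avoiding the closed set `closure (D \ D')`. -/
theorem measurableSet_staysIn {D D' : Set ℂ} {e₁ e₂ : ℂ} (hD' : IsOpen D')
    (h₁ : e₁ ∉ closure (D \ D')) (h₂ : e₂ ∉ closure (D \ D')) :
    MeasurableSet (staysIn D' : Set (Hull D e₁ e₂)) := by
  have : (staysIn D' : Set (Hull D e₁ e₂)) = avoids (closure (D \ D')) := by
    ext ⟨γ, hγ⟩
    simp only [avoids, staysIn]
    constructor
    · intro h
      refine eq_empty_of_forall_notMem fun z hz => ?_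
      have hzD : z ∈ D' := h ⟨hz.1, by
        rintro (rfl | hz')
        · exact h₁ hz.2
        · rw [mem_singleton_iff] at hz'; exact h₂ (hz' ▸ hz.2)⟩
      obtain ⟨y, hy, hy2⟩ := mem_closure_iff.1 hz.2 _ hD' hzD
      exact hy2.2 hy
    · intro h z hz
      have hzi : z ∈ interior D := by
        by_contra hzi
        have : z ∈ γ ∩ frontier D := ⟨hz.1, hγ.2.2.2.1 hz.1, hzi⟩
        rw [hγ.2.2.2.2] at this
        exact hz.2 this
      by_contra hzD
      have : z ∈ γ ∩ closure (D \ D') := ⟨hz.1, subset_closure ⟨interior_subset hzi, hzD⟩⟩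
      rw [h] at this
      exact this
  rw [this]
  exact measurableSet_avoids isClosed_closure

/-! ### Proportional probabilities on countable unions -/

theorem tendsto_measureReal_biUnion {α ι : Type*} [MeasurableSpace α] [Countable ι]
    (μ : Measure α) [IsFiniteMeasure μ] (E : ι → Set α) :
    Tendsto (fun S : Finset ι => μ.real (⋃ i ∈ S, E i)) atTop (𝓝 (μ.real (⋃ i, E i))) := by
  have hm : Monotone fun S : Finset ι => ⋃ i ∈ S, E i := fun S T hST =>
    biUnion_mono hST fun _ _ => Subset.rfl
  have := tendsto_measure_iUnion_atTop (μ := μ) hm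
  rw [← iUnion_eq_iUnion_finset] at this
  exact (ENNReal.tendsto_toReal (measure_ne_top _ _)).comp this

/-- Inclusion-exclusion for two countable families whose finite intersections have proportional
measures. -/
theorem measureReal_iUnion_eq_mul {α β ι : Type*} [MeasurableSpace α] [MeasurableSpace β]
    [Countable ι] {μ : Measure α} {ν : Measure β} [IsFiniteMeasure μ] [IsFiniteMeasure ν]
    {E : ι → Set α} {F : ι → Set β} (hE : ∀ i, MeasurableSet (E i))
    (hF : ∀ i, MeasurableSet (F i)) {c : ℝ}
    (h : ∀ S : Finset ι, S.Nonempty → μ.real (⋂ i ∈ S, E i) = c * ν.real (⋂ i ∈ S, F i)) :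
    μ.real (⋃ i, E i) = c * ν.real (⋃ i, F i) := by
  have hfin : ∀ S : Finset ι, μ.real (⋃ i ∈ S, E i) = c * ν.real (⋃ i ∈ S, F i) := by
    intro S
    rw [measureReal_biUnion_eq_sum_powerset fun i _ => hE i,
      measureReal_biUnion_eq_sum_powerset fun i _ => hF i, Finset.mul_sum]
    refine Finset.sum_congr rfl fun u hu => ?_
    rw [h u (Finset.mem_filter.1 hu).2]
    ring
  refine tendsto_nhds_unique (tendsto_measureReal_biUnion μ E) ?_
  simp_rw [hfin]
  exact (tendsto_measureReal_biUnion ν F).const_mul c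

namespace IsEndChart

variable {q : ℝ} {z₁ z₂ : ℂ} {D : Set ℂ} {e₁ e₂ : ℂ} {Ω : Set ℂ} {k : ℂ → ℂ} {κ₁ κ₂ : ℂ}

theorem measurableSet (h : IsEndChart q z₁ z₂ D e₁ e₂ Ω k κ₁ κ₂) {W : Set ℂ}
    (hW : IsFreeAt q z₁ z₂ W) : MeasurableSet (staysIn (Ω ∩ k ⁻¹' W) : Set (Hull D e₁ e₂)) := by
  obtain ⟨ε, hε, h₁, h₂⟩ := hW.exists_ball
  have hcl : ∀ e : ℂ, (∃ δ > 0, D ∩ ball e δ ⊆ Ω ∩ k ⁻¹' W) → e ∉ closure (D \ (Ω ∩ k ⁻¹' W)) := by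
    rintro e ⟨δ, hδ, hsub⟩ he
    obtain ⟨z, hz, hz2, hz3⟩ := mem_closure_iff.1 he _ isOpen_ball (mem_ball_self hδ)
    exact hz3 (hsub ⟨hz2, hz⟩)
  exact measurableSet_staysIn (h.isOpen_inter_preimage hW.isOpen)
    (hcl e₁ (h.exists_ball_subset hε h₁)) (hcl e₂ (h.swap.exists_ball_subset hε h₂))

/-- The event that a hull stays in some free subdomain of the annulus. -/
def staysFree (q : ℝ) (z₁ z₂ : ℂ) {D : Set ℂ} {e₁ e₂ : ℂ} (Ω : Set ℂ) (k : ℂ → ℂ) :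
    Set (Hull D e₁ e₂) :=
  ⋃ S : {S // IsFreeAt q z₁ z₂ (diskUnionCompl q S)}, staysIn (Ω ∩ k ⁻¹' diskUnionCompl q S)

/-- The probabilities of avoiding the inner boundary component in two charts are proportional. -/
theorem real_staysFree (h : IsEndChart q z₁ z₂ D e₁ e₂ Ω k κ₁ κ₂) {D' : Set ℂ} {e₁' e₂' : ℂ}
    {Ω' : Set ℂ} {k' : ℂ → ℂ} {κ₁' κ₂' : ℂ} (h' : IsEndChart q z₁ z₂ D' e₁' e₂' Ω' k' κ₁' κ₂')
    {b : ℝ} {P : Measure (Hull D e₁ e₂)} {Q : Measure (Hull D' e₁' e₂')}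
    (hP : IsRestrictionMeasure b D e₁ e₂ P) (hQ : IsRestrictionMeasure b D' e₁' e₂' Q)
    (hκ₁ : κ₁' ≠ 0) (hκ₂ : κ₂' ≠ 0) :
    P.real (staysFree q z₁ z₂ Ω k) = ((‖e₁ - e₂‖ ^ 2 * ‖κ₁ * κ₂‖) /
      (‖e₁' - e₂'‖ ^ 2 * ‖κ₁' * κ₂'‖)) ^ b * Q.real (staysFree q z₁ z₂ Ω' k') := by
  have := hP.isProbabilityMeasure
  have := hQ.isProbabilityMeasure
  refine measureReal_iUnion_eq_mul (fun S => h.measurableSet S.2)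
    (fun S => h'.measurableSet S.2) fun T hT => ?_
  have hinter : ∀ (D : Set ℂ) (e₁ e₂ : ℂ) (Ω : Set ℂ) (k : ℂ → ℂ),
      (⋂ S ∈ T, (staysIn (Ω ∩ k ⁻¹' diskUnionCompl q S) : Set (Hull D e₁ e₂))) =
        staysIn (Ω ∩ k ⁻¹' ⋂ S ∈ T, diskUnionCompl q S) := by
    intro D e₁ e₂ Ω k
    -- Nonemptiness matters: the empty intersection of events is everything, while the right side
    -- would still force the hull into `Ω`.
    obtain ⟨S₀, hS₀⟩ := hT
    ext γ
    simp only [staysIn, mem_iInter, mem_ofPred_eq, subset_inter_iff, preimage_iInter,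
      subset_iInter_iff]
    exact ⟨fun hγ => ⟨(hγ S₀ hS₀).1, fun S hS => (hγ S hS).2⟩, fun hγ S hS => ⟨hγ.1, hγ.2 S hS⟩⟩
  have hfree : IsFreeAt q z₁ z₂ (⋂ S ∈ T, diskUnionCompl q S) := by
    clear hinter
    induction hT using Finset.Nonempty.cons_induction with
    | singleton S => simpa using S.2
    | cons S T hS hT ih =>
      rw [Finset.cons_eq_insert, Finset.set_biInter_insert]
      exact S.2.inter ih
  obtain ⟨v, hv⟩ := hfree.exists_restriction b
  rw [hinter, hinter, hv _ _ _ _ _ _ _ P h hP, hv _ _ _ _ _ _ _ Q h' hQ,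
    Real.div_rpow (by positivity) (by positivity)]
  have he : ‖e₁' - e₂'‖ ≠ 0 := norm_ne_zero_iff.2 (sub_ne_zero.2 h'.ends_ne)
  have hpos : 0 < (‖e₁' - e₂'‖ ^ 2 * ‖κ₁' * κ₂'‖) ^ b := by
    refine Real.rpow_pos_of_pos ?_ b
    have := norm_ne_zero_iff.2 (mul_ne_zero hκ₁ hκ₂)
    positivity
  field_simp

theorem continuousOn_hull (h : IsEndChart q z₁ z₂ D e₁ e₂ Ω k κ₁ κ₂) {γ : Set ℂ}
    (hs : γ \ {e₁, e₂} ⊆ Ω) : ContinuousOn k γ := by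
  have hsub : γ ⊆ insert e₁ (insert e₂ Ω) := fun z hz => by
    by_cases hz1 : z = e₁
    · exact Or.inl hz1
    by_cases hz2 : z = e₂
    · exact Or.inr (Or.inl hz2)
    exact Or.inr (Or.inr (hs ⟨hz, by simp [hz1, hz2]⟩))
  intro z hz
  refine ContinuousWithinAt.mono ?_ hsub
  rw [continuousWithinAt_insert, continuousWithinAt_insert]
  rcases hsub hz with rfl | rfl | hzΩ
  · exact h.deriv₁.continuousWithinAt
  · exact h.deriv₂.continuousWithinAt
  · exact h.conformal.1.continuousOn z hzΩ

theorem image_hull_subset (h : IsEndChart q z₁ z₂ D e₁ e₂ Ω k κ₁ κ₂) {γ : Set ℂ}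
    (hs : γ \ {e₁, e₂} ⊆ Ω) : k '' γ ⊆ insert z₁ (insert z₂ (annulus q)) := by
  rintro _ ⟨z, hz, rfl⟩
  by_cases hz1 : z = e₁
  · exact Or.inl (hz1 ▸ h.map₁)
  by_cases hz2 : z = e₂
  · exact Or.inr (Or.inl (hz2 ▸ h.map₂))
  exact Or.inr (Or.inr (h.conformal.2.mapsTo (hs ⟨hz, by simp [hz1, hz2]⟩)))

theorem closedBall_subset_compl_image_hull (h : IsEndChart q z₁ z₂ D e₁ e₂ Ω k κ₁ κ₂) {γ : Set ℂ}
    (hq1 : q < 1) (hs : γ \ {e₁, e₂} ⊆ Ω) : closedBall 0 q ⊆ (k '' γ)ᶜ := by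
  intro z hz hzk
  rw [mem_closedBall_zero_iff] at hz
  rcases h.image_hull_subset hs hzk with rfl | rfl | hz'
  · linarith [h.norm₁]
  · linarith [h.norm₂]
  · linarith [hz'.1]

/-- The existence of `p` says that the image of the hull does not separate the inner disk from the
exterior, which is what the disk construction needs. -/
theorem mem_staysFree (h : IsEndChart q z₁ z₂ D e₁ e₂ Ω k κ₁ κ₂) (hq : 0 ≤ q) (hq1 : q < 1)
    (γ : Hull D e₁ e₂) (hs : γ.1 \ {e₁, e₂} ⊆ Ω) {p : ℂ} (hp : 1 ≤ ‖p‖)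
    (hpV : p ∈ connectedComponentIn (k '' γ.1)ᶜ 0) : γ ∈ staysFree q z₁ z₂ Ω k := by
  have hcpt : IsCompact (k '' γ.1) := γ.2.1.image_of_continuousOn (h.continuousOn_hull hs)
  obtain ⟨he₁, he₂⟩ := mem_of_hull γ.2
  obtain ⟨S, hS, hdisj⟩ := exists_isFreeAt_diskUnionCompl hq hcpt.isClosed ⟨e₁, he₁, h.map₁⟩
    ⟨e₂, he₂, h.map₂⟩ (h.norm₁ ▸ hq1) (h.norm₂ ▸ hq1) hp
    (h.closedBall_subset_compl_image_hull hq1 hs (by simpa using hq)) hpV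
  refine mem_iUnion.2 ⟨⟨S, hS⟩, fun z hz => ⟨hs hz, ?_⟩⟩
  exact mem_diskUnionCompl.2 ⟨h.conformal.2.mapsTo (hs hz),
    disjoint_left.1 hdisj (mem_image_of_mem k hz.1)⟩

theorem subset_of_mem_staysFree {γ : Hull D e₁ e₂} (hγ : γ ∈ staysFree q z₁ z₂ Ω k) :
    γ.1 \ {e₁, e₂} ⊆ Ω := by
  obtain ⟨S, hS⟩ := mem_iUnion.1 hγ
  exact fun z hz => (hS hz).1

end IsEndChart

theorem IsHull.subset_diff {D : Set ℂ} {e₁ e₂ : ℂ} {γ : Set ℂ} (hγ : IsHull D e₁ e₂ γ) :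
    γ \ {e₁, e₂} ⊆ D := by
  intro z hz
  by_contra hzD
  have : z ∈ γ ∩ frontier D := ⟨hz.1, hγ.2.2.2.1 hz.1, fun h => hzD (interior_subset h)⟩
  rw [hγ.2.2.2.2] at this
  exact hz.2 this

/-! ### The two charts: the rotated annulus and the slit half-plane -/

theorem isEndChart_rotation {q : ℝ} (hq : q < 1) {c z₁ z₂ : ℂ} (hc : ‖c‖ = 1) (h₁ : ‖z₁‖ = 1)
    (h₂ : ‖z₂‖ = 1) (hne : z₁ ≠ z₂) :
    IsEndChart q z₁ z₂ unitDisk (c * z₁) (c * z₂) (annulus q) (fun z => c⁻¹ * z) c⁻¹ c⁻¹ := by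
  have hc0 : c ≠ 0 := by rintro rfl; simp at hc
  have hder : ∀ z : ℂ, HasDerivWithinAt (fun z => c⁻¹ * z) c⁻¹ (annulus q) z := fun z => by
    simpa using ((hasDerivAt_id z).const_mul c⁻¹).hasDerivWithinAt
  have hfree : ∀ z : ℂ, ‖z‖ = 1 → ∃ δ > 0, unitDisk ∩ ball (c * z) δ ⊆ annulus q := fun z hz =>
    ⟨1 - q, sub_pos.2 hq, unitDisk_inter_ball_subset_annulus (by rw [norm_mul, hc, hz, one_mul])⟩
  refine ⟨h₁, h₂, hne, isOpen_annulus q, annulus_subset_unitDisk q, ⟨by fun_prop, ?_⟩,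
    by simp [hc0], by simp [hc0], hder _, hder _, hfree z₁ h₁, hfree z₂ h₂,
    fun a₁ a₂ ha₁ ha₂ ha => exists_isDiskChart_unitDisk ha₁ ha₂ ha (by simp [hc, h₁])
      (by simp [hc, h₂]) fun h => hne (mul_left_cancel₀ hc0 h)⟩
  refine (show InvOn (fun z => c * z) (fun z => c⁻¹ * z) (annulus q) (annulus q) from
    ⟨fun z _ => by simp [hc0], fun z _ => by simp [hc0]⟩).bijOn (fun z hz => ?_) (fun z hz => ?_)
  · simpa [annulus, hc] using hz
  · simpa [annulus, hc] using hz

/-- The rotation is a homeomorphism of the plane, so the complement of the rotated hull is connected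
and joins 0 to the exterior point 2. -/
theorem staysFree_rotation {q : ℝ} (hq : 0 ≤ q) (hq1 : q < 1) {c z₁ z₂ : ℂ} (hc : ‖c‖ = 1)
    (h₁ : ‖z₁‖ = 1) (h₂ : ‖z₂‖ = 1) (hne : z₁ ≠ z₂) :
    (IsEndChart.staysFree q z₁ z₂ (annulus q) (fun z => c⁻¹ * z) :
      Set (Hull unitDisk (c * z₁) (c * z₂))) = staysIn (annulus q) := by
  have hc0 : c ≠ 0 := by rintro rfl; simp at hc
  have h := isEndChart_rotation hq1 hc h₁ h₂ hne
  refine Subset.antisymm (fun γ hγ => IsEndChart.subset_of_mem_staysFree hγ) fun γ hγ => ?_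
  have himage := h.image_hull_subset hγ
  have hcompl : (fun z => c⁻¹ * z) '' γ.1ᶜ = ((fun z => c⁻¹ * z) '' γ.1)ᶜ :=
    image_compl_eq (mulLeft_bijective₀ _ (inv_ne_zero hc0))
  have hpre : IsPreconnected ((fun z => c⁻¹ * z) '' γ.1)ᶜ := by
    rw [← hcompl]
    exact γ.2.2.2.1.isPreconnected.image _ (by fun_prop)
  have h0 := h.closedBall_subset_compl_image_hull hq1 hγ (mem_closedBall_self hq)
  refine h.mem_staysFree hq hq1 γ hγ (p := 2) (by norm_num) ?_
  refine hpre.subset_connectedComponentIn h0 Subset.rfl fun h2 => ?_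
  rcases himage h2 with h3 | h3 | h3
  · rw [← h3] at h₁; norm_num at h₁
  · rw [← h3] at h₂; norm_num at h₂
  · have := h3.2; norm_num at this

theorem imagSegment_eq_image_cayley {L : ℝ} (hL0 : 0 ≤ L) (hL1 : L < 1) :
    imagSegment ((1 - L) / (1 + L)) ((1 + L) / (1 - L)) = cayley '' realSlit L := by
  have h1 : (0 : ℝ) < 1 - L := by linarith
  have h2 : (0 : ℝ) < 1 + L := by linarith
  have hcay : ∀ t : ℝ, t < 1 → cayley t = Complex.I * ((1 + t) / (1 - t) : ℝ) := fun t ht => by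
    rw [cayley_apply]; push_cast; ring
  ext ζ
  constructor
  · rintro ⟨y, ⟨hy1, hy2⟩, rfl⟩
    rw [div_le_iff₀ h2] at hy1
    rw [le_div_iff₀ h1] at hy2
    have hy : 0 < y + 1 := by
      have : 0 < y * (1 + L) := h1.trans_le hy1
      have := pos_of_mul_pos_left this h2.le
      linarith
    have ht1 : (y - 1) / (y + 1) < 1 := by rw [div_lt_one hy]; linarith
    refine ⟨((y - 1) / (y + 1) : ℝ), ⟨_, ⟨?_, ?_⟩, rfl⟩, ?_⟩
    · rw [le_div_iff₀ hy]; nlinarith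
    · rw [div_le_iff₀ hy]; nlinarith
    · rw [hcay _ ht1]
      congr 2
      have : 1 - (y - 1) / (y + 1) = 2 / (y + 1) := by field_simp; ring
      have h' : 1 + (y - 1) / (y + 1) = 2 * y / (y + 1) := by field_simp; ring
      rw [this, h']
      field_simp
  · rintro ⟨_, ⟨t, ⟨ht1, ht2⟩, rfl⟩, rfl⟩
    have ht : t < 1 := ht2.trans_lt hL1
    refine ⟨(1 + t) / (1 - t), ⟨?_, ?_⟩, (hcay t ht).symm⟩
    · rw [div_le_div_iff₀ h2 (by linarith)]; nlinarith
    · rw [div_le_div_iff₀ (by linarith) h1]; nlinarith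

/-- The upper half-plane without the image of the slit. -/
def slitHalf (L : ℝ) : Set ℂ := {ζ | 0 < ζ.im ∧ cayleyInv ζ ∉ realSlit L}

theorem hasDerivAt_cayleyInv_cayley {w : ℂ} (hw : w ≠ 1) :
    HasDerivAt cayleyInv (-Complex.I * (1 - w) ^ 2 / 2) (cayley w) := by
  have h1 : 1 - w ≠ 0 := sub_ne_zero.2 hw.symm
  have h3 : 1 * cayley w + Complex.I = 2 * Complex.I / (1 - w) := by
    rw [cayley_apply]; field_simp; ring
  have hne : 1 * cayley w + Complex.I ≠ 0 := by
    rw [h3]; exact div_ne_zero (by simp) h1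
  refine (hasDerivAt_moebius (a := 1) (b := -Complex.I) hne).congr_deriv ?_
  rw [h3]
  have := Complex.I_ne_zero
  have hI : Complex.I ^ 2 = -1 := Complex.I_sq
  field_simp
  linear_combination (2 : ℂ) * hI

theorem norm_cayley_sub_sq {w₁ w₂ : ℂ} (h₁ : w₁ ≠ 1) (h₂ : w₂ ≠ 1) :
    ‖cayley w₁ - cayley w₂‖ ^ 2 *
      (‖-Complex.I * (1 - w₁) ^ 2 / 2‖ * ‖-Complex.I * (1 - w₂) ^ 2 / 2‖) = ‖w₁ - w₂‖ ^ 2 := by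
  have h1 : 1 - w₁ ≠ 0 := sub_ne_zero.2 h₁.symm
  have h2 : 1 - w₂ ≠ 0 := sub_ne_zero.2 h₂.symm
  have : cayley w₁ - cayley w₂ = 2 * Complex.I * (w₁ - w₂) / ((1 - w₁) * (1 - w₂)) := by
    rw [cayley_apply, cayley_apply]; field_simp; ring
  rw [this]
  have h1' := norm_ne_zero_iff.2 h1
  have h2' := norm_ne_zero_iff.2 h2
  simp only [norm_mul, norm_div, norm_pow, norm_neg, Complex.norm_I, Complex.norm_ofNat]
  field_simp

theorem norm_cayleyInv_eq_one {ζ : ℂ} (h : ζ.im = 0) : ‖cayleyInv ζ‖ = 1 := by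
  rw [cayleyInv_apply, norm_div, div_eq_one_iff_eq (norm_ne_zero_iff.2 (add_I_ne_zero h.ge))]
  rw [← sq_eq_sq₀ (norm_nonneg _) (norm_nonneg _), Complex.sq_norm, Complex.sq_norm,
    Complex.normSq_apply, Complex.normSq_apply]
  simp [h]

theorem continuousAt_cayleyInv {ζ : ℂ} (h : 0 ≤ ζ.im) : ContinuousAt cayleyInv ζ := by
  refine (hasDerivAt_moebius (a := 1) (b := -Complex.I) (c := 1) (d := Complex.I) ?_).continuousAt
  rw [one_mul]; exact add_I_ne_zero h

theorem mapsConformallyOnto_cayleyInv (L : ℝ) :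
    MapsConformallyOnto cayleyInv (slitHalf L) (unitDisk \ realSlit L) := by
  have hne : ∀ w ∈ unitDisk, w ≠ 1 := by
    rintro w hw rfl
    simp [unitDisk] at hw
  refine ⟨fun ζ hζ => ?_, (show InvOn cayley cayleyInv (slitHalf L) (unitDisk \ realSlit L) from
    ⟨fun ζ hζ => cayley_cayleyInv (add_I_ne_zero hζ.1.le),
      fun w hw => cayleyInv_cayley (hne w hw.1)⟩).bijOn
    (fun ζ hζ => ⟨norm_cayleyInv_lt_one hζ.1, hζ.2⟩) fun w hw => ⟨mapsTo_cayley hw.1, ?_⟩⟩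
  · refine (hasDerivAt_moebius (a := 1) (b := -Complex.I) (c := 1) (d := Complex.I)
      ?_).differentiableAt.differentiableWithinAt
    rw [one_mul]; exact add_I_ne_zero hζ.1.le
  · rw [cayleyInv_cayley (hne w hw.1)]; exact hw.2

theorem isOpen_slitHalf (L : ℝ) : IsOpen (slitHalf L) := by
  rw [isOpen_iff_mem_nhds]
  rintro ζ ⟨h1, h2⟩
  filter_upwards [(isOpen_lt continuous_const Complex.continuous_im).mem_nhds h1,
    continuousAt_cayleyInv h1.le ((isCompact_realSlit L).isClosed.isOpen_compl.mem_nhds h2)]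
    with y hy1 hy2 using ⟨hy1, hy2⟩

theorem cayley_im_eq_zero {w : ℂ} (hw : ‖w‖ = 1) : (cayley w).im = 0 := by
  rw [cayley_im, Complex.normSq_eq_norm_sq, hw]; simp

theorem eventually_cayleyInv_notMem_realSlit {L : ℝ} (hL : L < 1) {ζ : ℂ} (hζ : ζ.im = 0) :
    ∀ᶠ y in 𝓝 ζ, cayleyInv y ∉ realSlit L := by
  refine (continuousAt_cayleyInv hζ.ge) ((isCompact_realSlit L).isClosed.isOpen_compl.mem_nhds ?_)
  intro h
  have := norm_le_of_mem_realSlit h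
  rw [norm_cayleyInv_eq_one hζ] at this
  linarith

namespace IsSlitMap

variable {q L : ℝ} {f : ℂ → ℂ}

theorem isEndChart (h : IsSlitMap q L f) {z₁ z₂ d₁ d₂ : ℂ} (h₁ : ‖z₁‖ = 1) (h₂ : ‖z₂‖ = 1)
    (hne : z₁ ≠ z₂) (hf₁ : f z₁ ≠ 1) (hf₂ : f z₂ ≠ 1)
    (hd₁ : HasDerivWithinAt f d₁ (annulus q) z₁) (hd₂ : HasDerivWithinAt f d₂ (annulus q) z₂) :
    IsEndChart q z₁ z₂ upperHalf (cayley (f z₁)) (cayley (f z₂)) (slitHalf L)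
      (inverse q f ∘ cayleyInv) (d₁⁻¹ * (-Complex.I * (1 - f z₁) ^ 2 / 2))
      (d₂⁻¹ * (-Complex.I * (1 - f z₂) ^ 2 / 2)) := by
  have hmap : ∀ z : ℂ, ‖z‖ = 1 → f z ≠ 1 → (inverse q f ∘ cayleyInv) (cayley (f z)) = z := by
    intro z hz hfz
    rw [Function.comp_apply, cayleyInv_cayley hfz, h.inverse_apply ⟨hz ▸ h.q_lt, hz.le⟩]
  have hder : ∀ z d : ℂ, ‖z‖ = 1 → f z ≠ 1 → HasDerivWithinAt f d (annulus q) z →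
      HasDerivWithinAt (inverse q f ∘ cayleyInv) (d⁻¹ * (-Complex.I * (1 - f z) ^ 2 / 2))
        (slitHalf L) (cayley (f z)) := by
    intro z d hz hfz hd
    refine HasDerivWithinAt.comp (h₂ := inverse q f) _ ?_
      (hasDerivAt_cayleyInv_cayley hfz).hasDerivWithinAt (mapsConformallyOnto_cayleyInv L).2.mapsTo
    rw [cayleyInv_cayley hfz]
    exact (h.hasDerivWithinAt_inverse hz hd).2
  have hfree : ∀ z : ℂ, ‖z‖ = 1 → ∃ δ > 0, upperHalf ∩ ball (cayley (f z)) δ ⊆ slitHalf L := by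
    intro z hz
    obtain ⟨δ, hδ, hsub⟩ := Metric.mem_nhds_iff.1
      (eventually_cayleyInv_notMem_realSlit h.L_lt (cayley_im_eq_zero (h.norm_eq_one hz)))
    exact ⟨δ, hδ, fun y hy => ⟨hy.1, hsub hy.2⟩⟩
  refine ⟨h₁, h₂, hne, isOpen_slitHalf L, fun ζ hζ => hζ.1,
    h.conformal_inverse.comp (mapsConformallyOnto_cayleyInv L), hmap z₁ h₁ hf₁, hmap z₂ h₂ hf₂,
    hder z₁ d₁ h₁ hf₁ hd₁, hder z₂ d₂ h₂ hf₂ hd₂, hfree z₁ h₁, hfree z₂ h₂,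
    fun a₁ a₂ ha₁ ha₂ ha => ?_⟩
  refine exists_isDiskChart_upperHalf ha₁ ha₂ ha (h.norm_eq_one h₁) (h.norm_eq_one h₂) ?_ hf₁ hf₂
  exact fun heq => hne (h.injOn_outerAnnulus ⟨h₁ ▸ h.q_lt, h₁.le⟩ ⟨h₂ ▸ h.q_lt, h₂.le⟩ heq)

/-- The chart `k` is not defined on the whole plane, so connectedness of the hull's complement has
to be transported by hand. If the component `V` of 0 off `k(γ)` stayed in the unit disk, the slit
together with `k⁻¹(V)` would be relatively clopen in the complement of the hull. It would then be
the whole complement, but the complement contains `-i`. -/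
theorem staysFree_eq (h : IsSlitMap q L f) {z₁ z₂ : ℂ} (h₁ : ‖z₁‖ = 1) (h₂ : ‖z₂‖ = 1)
    (hne : z₁ ≠ z₂) (hf₁ : f z₁ ≠ 1) (hf₂ : f z₂ ≠ 1) :
    (IsEndChart.staysFree q z₁ z₂ (slitHalf L) (inverse q f ∘ cayleyInv) :
      Set (Hull upperHalf (cayley (f z₁)) (cayley (f z₂)))) =
      avoids (imagSegment ((1 - L) / (1 + L)) ((1 + L) / (1 - L))) := by
  obtain ⟨d₁, hd₁⟩ := h.hasDerivWithinAt h₁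
  obtain ⟨d₂, hd₂⟩ := h.hasDerivWithinAt h₂
  have hch := h.isEndChart h₁ h₂ hne hf₁ hf₂ hd₁ hd₂
  have hseg := imagSegment_eq_image_cayley h.L_nonneg h.L_lt
  have him : ∀ z : ℂ, ‖z‖ = 1 → (cayley (f z)).im = 0 := fun z hz =>
    cayley_im_eq_zero (h.norm_eq_one hz)
  have hslit1 : ∀ t ∈ realSlit L, t ∈ unitDisk := fun t ht =>
    (norm_le_of_mem_realSlit ht).trans_lt h.L_lt
  have hslit2 : ∀ t ∈ realSlit L, t ≠ 1 := by
    rintro t ht rfl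
    have := norm_le_of_mem_realSlit ht
    rw [norm_one] at this
    linarith [h.L_lt]
  refine Subset.antisymm ?_ ?_
  · intro γ hγ
    have hs := IsEndChart.subset_of_mem_staysFree hγ
    refine eq_empty_of_forall_notMem fun ζ hζ => ?_
    obtain ⟨hζγ, hζ⟩ := hζ
    rw [hseg] at hζ
    obtain ⟨t, ht, rfl⟩ := hζ
    have hpos : 0 < (cayley t).im := mapsTo_cayley (hslit1 t ht)
    have := hs ⟨hζγ, by
      rintro (heq | heq)
      · rw [heq, him z₁ h₁] at hpos; exact lt_irrefl _ hpos
      · rw [mem_singleton_iff.1 heq, him z₂ h₂] at hpos; exact lt_irrefl _ hpos⟩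
    exact this.2 (by rwa [cayleyInv_cayley (hslit2 t ht)])
  intro γ hγ
  have hγseg : ∀ t ∈ realSlit L, cayley t ∉ γ.1 := fun t ht htγ => by
    have : cayley t ∈ γ.1 ∩ imagSegment ((1 - L) / (1 + L)) ((1 + L) / (1 - L)) :=
      ⟨htγ, hseg ▸ mem_image_of_mem _ ht⟩
    rw [show γ.1 ∩ imagSegment ((1 - L) / (1 + L)) ((1 + L) / (1 - L)) = ∅ from hγ] at this
    exact this
  have hs : γ.1 \ {cayley (f z₁), cayley (f z₂)} ⊆ slitHalf L := by
    intro ζ hζ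
    have hpos : 0 < ζ.im := γ.2.subset_diff hζ
    refine ⟨hpos, fun hsl => hγseg _ hsl ?_⟩
    rw [cayley_cayleyInv (add_I_ne_zero hpos.le)]
    exact hζ.1
  obtain ⟨he₁, he₂⟩ := IsEndChart.mem_of_hull γ.2
  set k := inverse q f ∘ cayleyInv with hk
  have hΓ : IsClosed (k '' γ.1) := (γ.2.1.image_of_continuousOn (hch.continuousOn_hull hs)).isClosed
  have hdisk := hch.closedBall_subset_compl_image_hull h.q_lt hs
  have h0 : (0 : ℂ) ∈ (k '' γ.1)ᶜ := hdisk (mem_closedBall_self h.q_nonneg)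
  set V := connectedComponentIn (k '' γ.1)ᶜ 0 with hV
  have hVo : IsOpen V := hΓ.isOpen_compl.connectedComponentIn
  have hOo : IsOpen ((k '' γ.1)ᶜ \ V) := isOpen_diff_connectedComponentIn hΓ.isOpen_compl 0
  have hdiskV : closedBall 0 q ⊆ V := (convex_closedBall (0 : ℂ) q).isPreconnected
    |>.subset_connectedComponentIn (mem_closedBall_self h.q_nonneg) hdisk
  suffices hp : ∃ p ∈ V, 1 ≤ ‖p‖ by
    obtain ⟨p, hpV, hp⟩ := hp
    exact hch.mem_staysFree h.q_nonneg h.q_lt γ hs hp hpV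
  by_contra! hVU
  have hfk : ∀ ζ ∈ slitHalf L, f (k ζ) = cayleyInv ζ := fun ζ hζ =>
    h.apply_inverse ((mapsConformallyOnto_cayleyInv L).2.mapsTo hζ)
  have hkc : ∀ ζ ∈ slitHalf L, ContinuousAt k ζ := fun ζ hζ =>
    (hch.conformal.1.differentiableAt ((isOpen_slitHalf L).mem_nhds hζ)).continuousAt
  have hpos : ∀ ζ : ℂ, 0 < ζ.im → ∀ᶠ y in 𝓝 ζ, 0 < y.im := fun ζ hζ =>
    (isOpen_lt continuous_const Complex.continuous_im).mem_nhds hζ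
  -- the part of the half-plane enclosed by the hull together with the slit
  set T : Set ℂ := {ζ | 0 < ζ.im ∧ (cayleyInv ζ ∈ realSlit L ∨ k ζ ∈ V)} with hT
  have hTo : IsOpen T := by
    rw [isOpen_iff_mem_nhds]
    rintro ζ ⟨hζ, hζT⟩
    by_cases hsl : cayleyInv ζ ∈ realSlit L
    · obtain ⟨δ, hδ, hδV⟩ := (isCompact_closedBall (0 : ℂ) q).exists_thickening_subset_open hVo hdiskV
      rw [thickening_closedBall hδ h.q_nonneg] at hδV
      obtain ⟨N, hN, hNs, hNr⟩ := h.exists_nhds_slit (show q < δ + q by linarith)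
      filter_upwards [hpos ζ hζ, continuousAt_cayleyInv hζ.le (hN.mem_nhds (hNs hsl))] with y hy hyN
      refine ⟨hy, or_iff_not_imp_left.2 fun hysl => hδV ?_⟩
      rw [mem_ball_zero_iff]
      refine hNr _ (hch.conformal.2.mapsTo ⟨hy, hysl⟩) ?_
      rw [hfk y ⟨hy, hysl⟩]
      exact hyN
    · have hmem : ζ ∈ slitHalf L := ⟨hζ, hsl⟩
      filter_upwards [hpos ζ hζ, hkc ζ hmem (hVo.mem_nhds (hζT.resolve_left hsl))] with y hy hyV
      exact ⟨hy, Or.inr hyV⟩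
  have hTc : IsOpen (γ.1ᶜ \ T) := by
    rw [isOpen_iff_mem_nhds]
    rintro ζ ⟨hζγ, hζT⟩
    have hγc := γ.2.1.isClosed.isOpen_compl.mem_nhds hζγ
    rcases lt_trichotomy ζ.im 0 with hζ | hζ | hζ
    · filter_upwards [hγc, (isOpen_lt Complex.continuous_im continuous_const).mem_nhds hζ] with y hy hy2
      exact ⟨hy, fun hyT => absurd hyT.1 (not_lt.2 (le_of_lt hy2))⟩
    · obtain ⟨a, ha, hfa⟩ := h.surjOn_circle (norm_cayleyInv_eq_one hζ)
      have hcay : cayley (f a) = ζ := by rw [hfa, cayley_cayleyInv (add_I_ne_zero hζ.ge)]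
      -- A real point off the hull corresponds to a circle point that is not in `V` by assumption
      -- and not in the image of the hull, which meets the circle only at `z₁` and `z₂`. By
      -- continuity of the inverse up to the circle, nearby points stay out of `V`.
      have haO : a ∈ (k '' γ.1)ᶜ \ V := by
        refine ⟨fun haΓ => hζγ ?_, fun haV => absurd (hVU a haV) (by simp [ha])⟩
        rcases hch.image_hull_subset hs haΓ with h3 | h3 | h3
        · rw [← hcay, h3]; exact he₁
        · rw [← hcay, mem_singleton_iff.1 h3]; exact he₂
        · linarith [h3.2]
      have hlim := h.tendsto_inverse ha (hOo.mem_nhds haO)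
      rw [hfa, mem_map, mem_nhdsWithin_iff_eventually] at hlim
      filter_upwards [hγc, continuousAt_cayleyInv hζ.ge hlim,
        eventually_cayleyInv_notMem_realSlit h.L_lt hζ] with y hy hy2 hy3
      refine ⟨hy, fun hyT => ?_⟩
      rcases hyT.2 with h4 | h4
      · exact hy3 h4
      · exact (hy2 ⟨norm_cayleyInv_lt_one hyT.1, hy3⟩).2 h4
    · have hnot : cayleyInv ζ ∉ realSlit L ∧ k ζ ∉ V := by
        have := fun h' => hζT ⟨hζ, h'⟩
        tauto
      have hmem : ζ ∈ slitHalf L := ⟨hζ, hnot.1⟩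
      have hkO : k ζ ∈ (k '' γ.1)ᶜ \ V := by
        refine ⟨?_, hnot.2⟩
        rintro ⟨y, hy, hyk⟩
        have hkA := (hch.conformal.2.mapsTo hmem).2
        by_cases hy1 : y = cayley (f z₁)
        · rw [← hyk, hy1, hch.map₁] at hkA; linarith
        by_cases hy2 : y = cayley (f z₂)
        · rw [← hyk, hy2, hch.map₂] at hkA; linarith
        have := hch.conformal.2.injOn (hs ⟨hy, by simp [hy1, hy2]⟩) hmem hyk
        exact hζγ (this ▸ hy)
      filter_upwards [hγc, hkc ζ hmem (hOo.mem_nhds hkO), (isOpen_slitHalf L).mem_nhds hmem]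
        with y hy hy2 hy3
      refine ⟨hy, fun hyT => ?_⟩
      rcases hyT.2 with h4 | h4
      · exact hy3.2 h4
      · exact hy2.2 h4
  have hsub : γ.1ᶜ ⊆ T := by
    refine γ.2.2.2.1.isPreconnected.subset_left_of_subset_union hTo hTc
      (disjoint_sdiff_right) (fun ζ hζ => ?_) ⟨cayley 0, hγseg 0 ?_, ?_⟩
    · by_cases hζT : ζ ∈ T
      exacts [Or.inl hζT, Or.inr ⟨hζ, hζT⟩]
    · exact ⟨0, ⟨by linarith [h.L_nonneg], h.L_nonneg⟩, by simp⟩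
    · refine ⟨mapsTo_cayley (by simp [unitDisk]), Or.inl ?_⟩
      rw [cayleyInv_cayley zero_ne_one]
      exact ⟨0, ⟨by linarith [h.L_nonneg], h.L_nonneg⟩, by simp⟩
  have hI : -Complex.I ∈ γ.1ᶜ := fun hIγ => by
    have hcl : closure upperHalf ⊆ {ζ : ℂ | 0 ≤ ζ.im} :=
      closure_minimal (fun ζ hζ => show 0 ≤ ζ.im from le_of_lt hζ) (isClosed_le continuous_const Complex.continuous_im)
    have := hcl (γ.2.2.2.2.1 hIγ)
    norm_num at this
  have := (hsub hI).1
  norm_num at this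

end IsSlitMap

/-! ### Evaluation of the constant and conclusion -/

/-- The charts give the constants `|z₁ - z₂|²` and `|f(z₁) - f(z₂)|² / |d|²`, the latter because the
derivatives at `z₁` and `z₂` are conjugate. The squares turn the exponent `b` into `2b`. -/
theorem real_staysIn_annulus {b q L : ℝ} {f : ℂ → ℂ} (h : IsSlitMap q L f) {c z₁ z₂ d : ℂ}
    (hc : ‖c‖ = 1) (h₁ : ‖z₁‖ = 1) (hz₂ : z₂ = conj z₁) (hne : z₁ ≠ z₂) (hz1 : z₁ ≠ 1)
    (hd : HasDerivWithinAt f d (annulus q) z₁) {e₁ e₂ u u' : ℂ} (he₁ : e₁ = c * z₁) (he₂ : e₂ = c * z₂)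
    (hu : u = cayley (f z₁)) (hu' : u' = -u) {P : Measure (Hull unitDisk e₁ e₂)}
    (hP : IsRestrictionMeasure b unitDisk e₁ e₂ P) {Q : Measure (Hull upperHalf u u')}
    (hQ : IsRestrictionMeasure b upperHalf u u' Q) :
    P.real (staysIn (annulus q)) =
      Q.real (avoids (imagSegment ((1 - L) / (1 + L)) ((1 + L) / (1 - L)))) *
        ‖d * (z₁ - z₂) / (f z₁ - f z₂)‖ ^ (2 * b) := by
  subst he₁ he₂
  have h₂ : ‖z₂‖ = 1 := by rw [hz₂, Complex.norm_conj, h₁]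
  have hmem : ∀ z : ℂ, ‖z‖ = 1 → z ∈ outerAnnulus q := fun z hz => ⟨hz ▸ h.q_lt, hz.le⟩
  have hne1 : ∀ z : ℂ, ‖z‖ = 1 → z ≠ 1 → f z ≠ 1 := fun z hz hz' heq =>
    hz' (h.injOn_outerAnnulus (hmem z hz) (hmem 1 (by simp)) (heq.trans h.map_one.symm))
  have hf₁ : f z₁ ≠ 1 := hne1 z₁ h₁ hz1
  have hf₂ : f z₂ ≠ 1 := hne1 z₂ h₂ fun heq => hz1 (by
    rw [← Complex.conj_conj z₁, ← hz₂, heq, map_one])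
  have hfne : f z₁ - f z₂ ≠ 0 := sub_ne_zero.2 fun heq =>
    hne (h.injOn_outerAnnulus (hmem z₁ h₁) (hmem z₂ h₂) heq)
  have hd₂ := h.hasDerivWithinAt_conj h₁ hd
  rw [← hz₂] at hd₂
  have hd0 : d ≠ 0 := (h.hasDerivWithinAt_inverse h₁ hd).1
  have hconj : f z₂ = (f z₁)⁻¹ := by
    rw [hz₂, h.apply_conj (hmem z₁ h₁), Complex.inv_def, Complex.normSq_eq_norm_sq,
      h.norm_eq_one h₁]
    simp
  -- By symmetry `f z₂` is the inverse of `f z₁`, and the Cayley transform turns inversion into a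
  -- change of sign.
  have hu₂ : u' = cayley (f z₂) := by
    have hf0 : f z₁ ≠ 0 := by
      intro h0
      have := h.norm_eq_one h₁
      simp [h0] at this
    have hs : 1 - f z₁ ≠ 0 := sub_ne_zero.2 hf₁.symm
    have hs' : f z₁ - 1 ≠ 0 := sub_ne_zero.2 hf₁
    have e1 : 1 + (f z₁)⁻¹ = (f z₁ + 1) / f z₁ := by field_simp
    have e2 : 1 - (f z₁)⁻¹ = (f z₁ - 1) / f z₁ := by field_simp
    rw [hu', hu, cayley_apply, cayley_apply, hconj, e1, e2, mul_div_assoc, mul_div_assoc,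
      div_div_div_cancel_right₀ hf0, ← neg_sub (1 : ℂ) (f z₁), div_neg, add_comm (1 : ℂ), mul_neg]
  clear hu'
  subst hu hu₂
  have hch := h.isEndChart h₁ h₂ hne hf₁ hf₂ hd hd₂
  have hrot := isEndChart_rotation h.q_lt hc h₁ h₂ hne
  have hsq : ∀ {w : ℂ}, w ≠ 1 → -Complex.I * (1 - w) ^ 2 / 2 ≠ 0 := fun hw =>
    div_ne_zero (mul_ne_zero (neg_ne_zero.2 Complex.I_ne_zero)
      (pow_ne_zero 2 (sub_ne_zero.2 hw.symm))) two_ne_zero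
  have hdc : conj d ≠ 0 := (map_ne_zero _).2 hd0
  have key := hrot.real_staysFree hch hP hQ (mul_ne_zero (inv_ne_zero hd0) (hsq hf₁))
    (mul_ne_zero (inv_ne_zero hdc) (hsq hf₂))
  rw [staysFree_rotation h.q_nonneg h.q_lt hc h₁ h₂ hne, h.staysFree_eq h₁ h₂ hne hf₁ hf₂] at key
  rw [key, mul_comm]
  congr 1
  rw [Real.rpow_mul (norm_nonneg _), Real.rpow_two]
  congr 1
  have hnum : ‖c * z₁ - c * z₂‖ ^ 2 * ‖c⁻¹ * c⁻¹‖ = ‖z₁ - z₂‖ ^ 2 := by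
    rw [← mul_sub]; simp [hc]
  have hden : ‖cayley (f z₁) - cayley (f z₂)‖ ^ 2 * ‖d⁻¹ * (-Complex.I * (1 - f z₁) ^ 2 / 2) *
      ((conj d)⁻¹ * (-Complex.I * (1 - f z₂) ^ 2 / 2))‖ = ‖f z₁ - f z₂‖ ^ 2 * (‖d‖ ^ 2)⁻¹ := by
    rw [← norm_cayley_sub_sq hf₁ hf₂, norm_mul, norm_mul (d⁻¹), norm_mul ((conj d)⁻¹), norm_inv,
      norm_inv, Complex.norm_conj, sq ‖d‖, mul_inv]
    ring
  rw [hnum, hden]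
  have h1 := norm_ne_zero_iff.2 hd0
  have h2 := norm_ne_zero_iff.2 hfne
  rw [norm_div, norm_mul]
  field_simp

theorem lemma2 (b : ℝ) (hb : 5 / 8 ≤ b) (x : ℝ) (hx0 : 0 < x) (hxπ : x ≤ Real.pi)
    (q : ℝ) (hq0 : 0 ≤ q) (hq1 : q < 1)
    -- `f` is the conformal equivalence of `A_q` and the slit disk, extended continuously to the
    -- unit circle and normalized by `f 1 = 1`
    (L : ℝ) (hL0 : 0 ≤ L) (hL1 : L < 1) (f : ℂ → ℂ)
    (hf : MapsConformallyOnto f (annulus q) (unitDisk \ realSlit L))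
    (hfc : ContinuousOn f {z : ℂ | q < ‖z‖ ∧ ‖z‖ ≤ 1}) (hf1 : f 1 = 1)
    (z₁ z₂ : ℂ) (hz₁ : z₁ = Complex.exp (Complex.I * x / 2))
    (hz₂ : z₂ = Complex.exp (-(Complex.I * x / 2)))
    (u : ℂ) (hu : u = Complex.I * (1 + f z₁) / (1 - f z₁))
    (P : Measure (Hull unitDisk (Complex.exp (Complex.I * x)) 1))
    (hP : IsRestrictionMeasure b unitDisk (Complex.exp (Complex.I * x)) 1 P)
    (Q : Measure (Hull upperHalf u (-u)))
    (hQ : IsRestrictionMeasure b upperHalf u (-u) Q) :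
    DifferentiableWithinAt ℂ f (annulus q) z₁ ∧
    P.real (staysIn (annulus q)) =
      Q.real (avoids (imagSegment ((1 - L) / (1 + L)) ((1 + L) / (1 - L)))) *
        ‖derivWithin f (annulus q) z₁ * (z₁ - z₂) / (f z₁ - f z₂)‖ ^ (2 * b) := by
  have h : IsSlitMap q L f := ⟨hq0, hq1, hL0, hL1, hf, hfc, hf1⟩
  have hI : Complex.I * x / 2 = ((x / 2 : ℝ) : ℂ) * Complex.I := by push_cast; ring
  have h₁ : ‖z₁‖ = 1 := by rw [hz₁, hI, Complex.norm_exp_ofReal_mul_I]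
  have hinv : z₂ = z₁⁻¹ := by rw [hz₁, hz₂, Complex.exp_neg]
  have hconj : z₂ = conj z₁ := by
    rw [hinv, Complex.inv_def, Complex.normSq_eq_norm_sq, h₁]
    simp
  have him : 0 < z₁.im := by
    rw [hz₁, hI, Complex.exp_ofReal_mul_I_im]
    exact Real.sin_pos_of_pos_of_lt_pi (by linarith) (by linarith [Real.pi_pos])
  have hne : z₁ ≠ z₂ := fun heq => by
    have := congrArg Complex.im (heq.trans hconj)
    rw [Complex.conj_im] at this
    linarith
  have hz1 : z₁ ≠ 1 := by
    rintro h1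
    rw [h1] at him
    simp at him
  obtain ⟨d, hd⟩ := h.hasDerivWithinAt h₁
  refine ⟨hd.differentiableWithinAt, ?_⟩
  have huniq : UniqueDiffWithinAt ℂ (annulus q) z₁ := h.uniqueDiffWithinAt h₁
  rw [hd.derivWithin huniq]
  -- Rotation by `z₁` takes the symmetric pair `z₁`, `z₂` to `e^{ix}`, `1`, since `z₁² = e^{ix}` and
  -- `z₁ z₂ = 1`.
  refine real_staysIn_annulus h (c := z₁) h₁ h₁ hconj hne hz1 hd ?_ ?_ ?_ rfl hP hQ
  · rw [hz₁, ← Complex.exp_add]; congr 1; ring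
  · rw [hinv, mul_inv_cancel₀]
    rintro h0
    simp [h0] at h₁
  · rw [hu, cayley_apply]
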